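/- Write $e(x)=e^{2\pi i x}$, $q=e(\tau)$, $y=e(z)$ for $\tau\in\mathbb H$, $z\in\mathbb C$, let $\eta(\tau)=q^{1/24}\prod_{n\ge1}(1-q^n)$, and put $$\theta_1=-iq^{1/8}y^{1/2}\prod_{n\ge1}(1-q^n)(1-yq^n)(1-y^{-1}q^{n-1}),\qquad \theta_2=q^{1/8}y^{1/2}\prod_{n\ge1}(1-q^n)(1+yq^n)(1+y^{-1}q^{n-1}),$$ $$\theta_3=\prod_{n\ge1}(1-q^n)(1+yq^{n-1/2})(1+y^{-1}q^{n-1/2}),\qquad \theta_4=\prod_{n\ge1}(1-q^n)(1-yq^{n-1/2})(1-y^{-1}q^{n-1/2}),$$ $$\varphi_{0,1}(\tau,z)=4\sum_{i=2,3,4}\left(\frac{\theta_i(\tau,z)}{\theta_i(\tau,0)}\right)^2,\qquad \varphi_{-2,1}(\tau,z)=-\frac{\theta_1(\tau,z)^2}{\eta(\tau)^6}.$$ Let $M_{24}\subset S_{24}$ be the automorphism group of an extended binary Golay code (a self-dual doubly even binary linear code of length $24$ with no words of weight $4$). For $g\in M_{24}$ let $\chi(g)$ be the trace of $g$ in the permutation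 representation of degree $24$, let $n_g$ and $h_g$ be the lengths of the longest and of the shortest cycle of $g$ (fixed points are cycles of length $1$), and let $N_g$ be the level of $g$: the positive integer such that the multiset of cycle lengths of $g$ is invariant under $i\mapsto N_g/i$. Write $\eta_k=\eta(k\tau)$ and $\Lambda_N=N\,q\frac{d}{dq}\log\frac{\eta(N\tau)}{\eta(\tau)}$, and let $f_{23,1}=\eta_1^2\eta_{23}^2$ and $f_{23,2}=\frac{\eta_1^3\eta_{23}^3}{\eta_2\eta_{46}}+4\eta_1\eta_2\eta_{23}\eta_{46}+4\eta_2^2\eta_{46}^2$. Define $\tilde T_g$ by the cycle shape of $g$: $$\begin{array}{ll} 1^{24}: 0 & 1^82^8: 16\Lambda_2\\ 2^{12}: 2\eta_1^8/\eta_2^4 & 1^63^6: 6\Lambda_3\\ 3^8: 2\eta_1^6/\eta_3^2 & 2^44^4: 2\eta_2^8/\eta_4^4\\ 1^42^24^4: 4(-\Lambda_2+\Lambda_4) & 4^6: 2\eta_1^4\eta_2^2/\eta_4^2\\ 1^45^4: 2\Lambda_5 & 1^22^23^26^2: 2(-\Lambda_2-\Lambda_3+\Lambda_6)\\ 6^4: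 2\eta_1^2\eta_2^2\eta_3^2/\eta_6^2 & 1^37^3: \Lambda_7\\ 1^2 2\,4\,8^2: -\Lambda_4+\Lambda_8 & 2^210^2: 2\eta_1^3\eta_2\eta_5/\eta_{10}\\ 1^211^2: \tfrac25(\Lambda_{11}-11\eta_1^2\eta_{11}^2) & 2\,4\,6\,12: 2\eta_1^3\eta_4^2\eta_6^3/(\eta_2\eta_3\eta_{12}^2)\\ 12^2: 2\eta_1^4\eta_4\eta_6/(\eta_2\eta_{12}) & 1\,2\,7\,14: \tfrac13(-\Lambda_2-\Lambda_7+\Lambda_{14}-14\eta_1\eta_2\eta_7\eta_{14})\\ 1\,3\,5\,15: \tfrac14(-\Lambda_3-\Lambda_5+\Lambda_{15}-15\eta_1\eta_3\eta_5\eta_{15}) & 3\,21: \tfrac13\big(7\eta_1^3\eta_7^3/(\eta_3\eta_{21})-\eta_1^6/\eta_3^2\big)\\ 1\,23: \tfrac1{11}(\Lambda_{23}-23f_{23,1}+23f_{23,2}) & \end{array}$$ (these $21$ shapes are those of the elements of $M_{24}$; for any other permutation put $\tilde T_g=0$). A weak Jacobi form of weight $w$ and index $t$ for $\Gamma_0(N)$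 is a holomorphic function $\phi:\mathbb H\times\mathbb C\to\mathbb C$ such that $\phi=\phi|_{w,t}\gamma$ for all $\gamma\in\Gamma_0(N)$, where for $\gamma=\begin{pmatrix}a&b\\c&d\end{pmatrix}$ $$(\phi|_{w,t}\gamma)(\tau,z)=(c\tau+d)^{-w}\,e\!\left(-\tfrac{tcz^2}{c\tau+d}\right)\phi\!\left(\tfrac{a\tau+b}{c\tau+d},\tfrac{z}{c\tau+d}\right),$$ such that $\phi(\tau,z)=e(t(\lambda^2\tau+2\lambda z))\,\phi(\tau,z+\lambda\tau+\mu)$ for all $\lambda,\mu\in\mathbb Z$, and such that $\phi$ has a Fourier expansion $\sum_{n\ge0,\ell\in\mathbb Z}c(n,\ell)q^ny^\ell$ and, for every $\gamma\in SL_2(\mathbb Z)$, $\phi|_{w,t}\gamma$ has a Fourier expansion $\sum_{n\ge0,\ell\in\mathbb Z}c_\gamma(n,\ell)q^{n/M}y^\ell$ for some integer $M\ge1$. **Proposition.** For every $g\in M_{24}$, the function $$\mathcal Z_g(\tau,z)=\frac{\chi(g)}{12}\varphi_{0,1}(\tau,z)+\tilde T_g(\tau)\,\varphi_{-2,1}(\tau,z)$$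 is a weak Jacobi form of weight $0$ and index $1$ for $\Gamma_0(N_g)$. Moreover, for all $\gamma=\begin{pmatrix}a&b\\c&d\end{pmatrix}\in\Gamma_0(n_g)$, $\tau\in\mathbb H$ and $z\in\mathbb C$, $$\mathcal Z_g(\tau,z)=\rho_{n_g|h_g}(\gamma)\,e\!\left(-\frac{cz^2}{c\tau+d}\right)\mathcal Z_g\!\left(\frac{a\tau+b}{c\tau+d},\frac{z}{c\tau+d}\right),\qquad \rho_{n|h}(\gamma)=e\!\left(-\frac{cd}{nh}\right).$$ -/

import Mathlib

open UpperHalfPlane hiding I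
open Complex
open scoped Real MatrixGroups

namespace MathieuMoonshine

/-! ### The Mathieu group `M₂₄` and cycle shapes -/

/-- `C` is an extended binary Golay code: a self-dual, doubly even binary linear code of length
`24` without words of weight `4`. -/
structure IsGolayCode (C : Submodule (ZMod 2) (Fin 24 → ZMod 2)) : Prop where
  selfDual : ∀ v, v ∈ C ↔ ∀ w ∈ C, ∑ i, v i * w i = 0
  doublyEven : ∀ v ∈ C, 4 ∣ hammingNorm v
  no_weight_four : ∀ v ∈ C, hammingNorm v ≠ 4

/-- The group of permutations of the `24` coordinates that preserve the code `C`; for a Golay code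
this is the Mathieu group `M₂₄` in its defining permutation representation. -/
def mathieu24 (C : Submodule (ZMod 2) (Fin 24 → ZMod 2)) : Subgroup (Equiv.Perm (Fin 24)) where
  carrier := {g | ∀ v : Fin 24 → ZMod 2, v ∘ g ∈ C ↔ v ∈ C}
  one_mem' := fun _ => Iff.rfl
  mul_mem' := fun {a b} ha hb v => (hb (v ∘ a)).trans (ha v)
  inv_mem' := fun {a} ha v => by
    rw [← ha (v ∘ ⇑a⁻¹)]
    have : (v ∘ ⇑a⁻¹) ∘ ⇑a = v := by
      funext i
      simp
    rw [this]

/-- The cycle shape of `g`: the multiset of the lengths of all its cycles, fixed points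
included. -/
def cycleShape (g : Equiv.Perm (Fin 24)) : Multiset ℕ := g.partition.parts

/-- `n_g`: the length of the longest cycle. -/
def longest (g : Equiv.Perm (Fin 24)) : ℕ := (cycleShape g).sup

/-- `h_g`: the length of the shortest cycle. -/
noncomputable def shortest (g : Equiv.Perm (Fin 24)) : ℕ := sInf {i | i ∈ cycleShape g}

/-- The cycle shape of `g` is balanced of level `N`: it is mapped to itself by `i ↦ N / i`. -/
def IsBalanced (g : Equiv.Perm (Fin 24)) (N : ℕ) : Prop :=
  0 < N ∧ (∀ i ∈ cycleShape g, i ∣ N) ∧ (cycleShape g).map (fun i => N / i) = cycleShape g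

/-- `N_g`: the level of `g`, the positive integer for which its cycle shape is balanced. -/
noncomputable def level (g : Equiv.Perm (Fin 24)) : ℕ := sInf {N | IsBalanced g N}

/-- `χ(g)`: the trace of `g` in the `24`-dimensional permutation representation. -/
noncomputable def chi (g : Equiv.Perm (Fin 24)) : ℂ := Matrix.trace (g.permMatrix ℂ)

/-! ### Eta products, theta functions, and the basic forms -/

/-- `e(x) = exp(2πix)`. -/
noncomputable def e (x : ℂ) : ℂ := exp (2 * π * I * x)

/-- `η(kτ)`, with `η` the Dedekind eta function. -/
noncomputable def etaAt (k : ℕ) (τ : ℍ) : ℂ := ModularForm.eta (k * (τ : ℂ))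

/-- `Λ_N = N q d/dq log (η(Nτ) / η(τ))`, where `q d/dq = (2πi)⁻¹ d/dτ`. -/
noncomputable def Lam (N : ℕ) (τ : ℍ) : ℂ :=
  N * ((2 * π * I)⁻¹ *
    logDeriv (fun w : ℂ => ModularForm.eta (N * w) / ModularForm.eta w) (τ : ℂ))

/-- The second form of the chosen basis of newforms of level `23`. -/
noncomputable def f232 (τ : ℍ) : ℂ :=
  etaAt 1 τ ^ 3 * etaAt 23 τ ^ 3 / (etaAt 2 τ * etaAt 46 τ)
    + 4 * etaAt 1 τ * etaAt 2 τ * etaAt 23 τ * etaAt 46 τ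
    + 4 * etaAt 2 τ ^ 2 * etaAt 46 τ ^ 2

/-! The Jacobi theta functions, with `q = e(τ)`, `y = e(z)`; the product index is shifted to start
at `n = 0`. -/

noncomputable def theta1 (τ : ℍ) (z : ℂ) : ℂ :=
  -I * e (τ / 8) * e (z / 2) *
    ∏' n : ℕ, (1 - e τ ^ (n + 1)) * (1 - e z * e τ ^ (n + 1)) * (1 - (e z)⁻¹ * e τ ^ n)

noncomputable def theta2 (τ : ℍ) (z : ℂ) : ℂ :=
  e (τ / 8) * e (z / 2) *
    ∏' n : ℕ, (1 - e τ ^ (n + 1)) * (1 + e z * e τ ^ (n + 1)) * (1 + (e z)⁻¹ * e τ ^ n)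

noncomputable def theta3 (τ : ℍ) (z : ℂ) : ℂ :=
  ∏' n : ℕ, (1 - e τ ^ (n + 1)) * (1 + e z * e ((n + 1 / 2) * τ)) *
    (1 + (e z)⁻¹ * e ((n + 1 / 2) * τ))

noncomputable def theta4 (τ : ℍ) (z : ℂ) : ℂ :=
  ∏' n : ℕ, (1 - e τ ^ (n + 1)) * (1 - e z * e ((n + 1 / 2) * τ)) *
    (1 - (e z)⁻¹ * e ((n + 1 / 2) * τ))

/-- `φ_{0,1}`. -/
noncomputable def phi01 (τ : ℍ) (z : ℂ) : ℂ :=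
  4 * ((theta2 τ z / theta2 τ 0) ^ 2 + (theta3 τ z / theta3 τ 0) ^ 2
    + (theta4 τ z / theta4 τ 0) ^ 2)

/-- `φ_{-2,1}`. -/
noncomputable def phi21 (τ : ℍ) (z : ℂ) : ℂ := -(theta1 τ z ^ 2 / etaAt 1 τ ^ 6)

/-! ### The forms `T̃_g` and the twisted elliptic genera -/

/-- The shape `∏ iˡ`, given as the list of the pairs `(i, l)`. -/
def shape (s : List (ℕ × ℕ)) : Multiset ℕ := (s.map fun p => Multiset.replicate p.2 p.1).sum

/-- The weight two forms `T̃_g`, listed by the cycle shape of `g`. The 21 shapes listed (of the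
classes 1A, 2A, 2B, 3A, 3B, 4A, 4B, 4C, 5A, 6A, 6B, 7AB, 8A, 10A, 11A, 12A, 12B, 14AB, 15AB, 21AB,
23AB, in this order) are those of the elements of `M₂₄`; the last value, for permutations of any
other shape, is a placeholder. -/
noncomputable def tildeT (g : Equiv.Perm (Fin 24)) (τ : ℍ) : ℂ :=
  let H := fun k : ℕ => etaAt k τ
  let L := fun N : ℕ => Lam N τ
  if cycleShape g = shape [(1, 24)] then 0
  else if cycleShape g = shape [(1, 8), (2, 8)] then 16 * L 2
  else if cycleShape g = shape [(2, 12)] then 2 * H 1 ^ 8 / H 2 ^ 4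
  else if cycleShape g = shape [(1, 6), (3, 6)] then 6 * L 3
  else if cycleShape g = shape [(3, 8)] then 2 * H 1 ^ 6 / H 3 ^ 2
  else if cycleShape g = shape [(2, 4), (4, 4)] then 2 * H 2 ^ 8 / H 4 ^ 4
  else if cycleShape g = shape [(1, 4), (2, 2), (4, 4)] then 4 * (-L 2 + L 4)
  else if cycleShape g = shape [(4, 6)] then 2 * H 1 ^ 4 * H 2 ^ 2 / H 4 ^ 2
  else if cycleShape g = shape [(1, 4), (5, 4)] then 2 * L 5
  else if cycleShape g = shape [(1, 2), (2, 2), (3, 2), (6, 2)] then 2 * (-L 2 - L 3 + L 6)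
  else if cycleShape g = shape [(6, 4)] then 2 * H 1 ^ 2 * H 2 ^ 2 * H 3 ^ 2 / H 6 ^ 2
  else if cycleShape g = shape [(1, 3), (7, 3)] then L 7
  else if cycleShape g = shape [(1, 2), (2, 1), (4, 1), (8, 2)] then -L 4 + L 8
  else if cycleShape g = shape [(2, 2), (10, 2)] then 2 * H 1 ^ 3 * H 2 * H 5 / H 10
  else if cycleShape g = shape [(1, 2), (11, 2)] then 2 * (L 11 - 11 * H 1 ^ 2 * H 11 ^ 2) / 5
  else if cycleShape g = shape [(2, 1), (4, 1), (6, 1), (12, 1)] then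
    2 * H 1 ^ 3 * H 4 ^ 2 * H 6 ^ 3 / (H 2 * H 3 * H 12 ^ 2)
  else if cycleShape g = shape [(12, 2)] then 2 * H 1 ^ 4 * H 4 * H 6 / (H 2 * H 12)
  else if cycleShape g = shape [(1, 1), (2, 1), (7, 1), (14, 1)] then
    (-L 2 - L 7 + L 14 - 14 * H 1 * H 2 * H 7 * H 14) / 3
  else if cycleShape g = shape [(1, 1), (3, 1), (5, 1), (15, 1)] then
    (-L 3 - L 5 + L 15 - 15 * H 1 * H 3 * H 5 * H 15) / 4
  else if cycleShape g = shape [(3, 1), (21, 1)] then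
    (7 * H 1 ^ 3 * H 7 ^ 3 / (H 3 * H 21) - H 1 ^ 6 / H 3 ^ 2) / 3
  else if cycleShape g = shape [(1, 1), (23, 1)] then
    (L 23 - 23 * (H 1 ^ 2 * H 23 ^ 2) + 23 * f232 τ) / 11
  else 0

/-- The twisted elliptic genus `𝒵_g = (χ(g)/12) φ_{0,1} + T̃_g φ_{-2,1}`. -/
noncomputable def ellGenus (g : Equiv.Perm (Fin 24)) (τ : ℍ) (z : ℂ) : ℂ :=
  chi g / 12 * phi01 τ z + tildeT g τ * phi21 τ z

/-- `ρ_{n|h}(γ) = e(-cd/(nh))`. -/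
noncomputable def rho (n h : ℕ) (γ : SL(2, ℤ)) : ℂ := e (-((γ 1 0 : ℂ) * (γ 1 1 : ℂ) / (n * h)))

/-! ### Weak Jacobi forms for `Γ₀(N)` -/

/-- The weight `w`, index `t` action of `γ ∈ SL₂(ℤ)`:
`(cτ+d)^{-w} e(-t c z² / (cτ+d)) φ((aτ+b)/(cτ+d), z/(cτ+d))`. -/
noncomputable def jacobiSlash (w t : ℤ) (φ : ℍ → ℂ → ℂ) (γ : SL(2, ℤ)) (τ : ℍ) (z : ℂ) : ℂ :=
  ((γ 1 0 : ℂ) * τ + (γ 1 1 : ℂ)) ^ (-w) *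
    e (-(t * ((γ 1 0 : ℂ) * z ^ 2 / ((γ 1 0 : ℂ) * τ + (γ 1 1 : ℂ))))) *
    φ (γ • τ) (z / ((γ 1 0 : ℂ) * τ + (γ 1 1 : ℂ)))

/-- `φ` has an (absolutely convergent) Fourier expansion in integral powers of `q^{1/M}` and `y`
without negative powers of `q`. -/
def HasWeakFourierExpansion (M : ℕ) (φ : ℍ → ℂ → ℂ) : Prop :=
  ∃ c : ℕ × ℤ → ℂ, ∀ (τ : ℍ) (z : ℂ),
    HasSum (fun p : ℕ × ℤ => c p * e (p.1 * τ / M) * e (p.2 * z)) (φ τ z)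

/-- Weak Jacobi forms of weight `w` and index `t` for `Γ₀(N)`: holomorphic functions on `ℍ × ℂ`
with the modular and the elliptic transformation law, whose Fourier expansion has no negative
powers of `q`, also at the other cusps. -/
structure IsWeakJacobiForm (N : ℕ) (w t : ℤ) (φ : ℍ → ℂ → ℂ) : Prop where
  holo : DifferentiableOn ℂ (fun p : ℂ × ℂ => φ (ofComplex p.1) p.2) {p | 0 < p.1.im}
  modular : ∀ γ ∈ CongruenceSubgroup.Gamma0 N, ∀ (τ : ℍ) (z : ℂ), φ τ z = jacobiSlash w t φ γ τ z
  elliptic : ∀ (lam mu : ℤ) (τ : ℍ) (z : ℂ),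
    φ τ z = e (t * (lam ^ 2 * τ + 2 * lam * z)) * φ τ (z + lam * τ + mu)
  fourier : HasWeakFourierExpansion 1 φ
  cusps : ∀ γ : SL(2, ℤ), ∃ M : ℕ, 0 < M ∧ HasWeakFourierExpansion M (jacobiSlash w t φ γ)

end MathieuMoonshine

open MathieuMoonshine

/-! The forms φ_{0,1} and φ_{-2,1} are weak Jacobi forms of index 1 and weights 0 and -2 for all of
SL₂(ℤ) (`phi01_slash`, `phi21_slash` and the companion lemmas on elliptic laws, holomorphy and
Fourier expansions). The dependence on g sits in χ(g) and T̃_g alone, so everything reduces to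
`isTwistedForm_tildeT`: with n = n_g and h = h_g, the function T̃_g is holomorphic, its weight two
transforms are bounded at i∞, and T̃_g(γτ) = e(cd/(nh)) (cτ+d)² T̃_g(τ) for γ in Γ₀(n).

Granting this, the second term of 𝒵_g transforms with the inverse of ρ. For the first term either
χ(g) = 0, or g has a fixed point, so that h = 1 and ρ is trivial on Γ₀(n). The map i ↦ N/i reverses
the order of the cycle lengths, hence N_g = nh (`IsBalanced.eq_mul`), and ρ is trivial on Γ₀(nh). At
a cusp, the transform of T̃_g is bounded and has period nh, so it is a power series in q^{1/(nh)}.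

The pieces of T̃_g are of three kinds. For Λ_N = (N/24)(N E₂(Nτ) - E₂(τ)) the quasimodular terms
cancel (`Lam_smul`). For eta quotients the multiplier of η is computed by Euclidean descent and
quadratic reciprocity (`etaLaw_of_odd`), the orders at the cusps come from
`exists_upper_triangular`, and what remains are finite numerical checks (`EtaQuotCheck`).

The third kind is f_{23,2}, whose eta quotients only have level 46. Put t₀ = η₂η₄₆/(η₁η₂₃), and let
t₁, t₂ be its conjugates over Γ₀(23). Then t₀t₁t₂ = -1/4 is an identity of Euler products, and t₀ +
t₁ + t₂ = -1 because the sum is a holomorphic function on a compact modular curve (`conj23_sum`). It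
follows that f_{23,2} = -4 η₁²η₂₃² (t₀t₁ + t₀t₂ + t₁t₂) (`f232_eq`), and the symmetric function is
invariant under Γ₀(23).

The theta functions are given as products, whereas their transformation laws come from series; the
Jacobi triple product links the two. -/

namespace MathieuMoonshine

/-! ### The Jacobi triple product -/

section TripleProduct

open Filter Topology

/-- The finite product `∏_{k ≤ m} (1 - q ^ k)`. -/
noncomputable def qPoch (q : ℂ) (m : ℕ) : ℂ := ∏ k ∈ Finset.range m, (1 - q ^ (k + 1))

/-- The inverse of `qPoch q m`, extended by zero to negative `m`. -/
noncomputable def qPochInv (q : ℂ) (m : ℤ) : ℂ := if m < 0 then 0 else (qPoch q m.toNat)⁻¹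

lemma one_sub_pow_ne_zero {q : ℂ} (hq : ‖q‖ < 1) (k : ℕ) : 1 - q ^ (k + 1) ≠ 0 := by
  intro h
  have h1 : ‖q ^ (k + 1)‖ = 1 := by rw [← sub_eq_zero.1 h, norm_one]
  rw [norm_pow] at h1
  exact absurd h1 (pow_lt_one₀ (norm_nonneg _) hq (Nat.succ_ne_zero k)).ne

lemma qPoch_ne_zero {q : ℂ} (hq : ‖q‖ < 1) (m : ℕ) : qPoch q m ≠ 0 :=
  Finset.prod_ne_zero_iff.2 fun k _ => one_sub_pow_ne_zero hq k

/-- The extension by zero makes the recursion hold for every integer: at `m = 0` the factor `1 - q ^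
0` vanishes. -/
lemma qPochInv_sub_one {q : ℂ} (hq : ‖q‖ < 1) (m : ℤ) :
    qPochInv q (m - 1) = (1 - q ^ m) * qPochInv q m := by
  rcases lt_trichotomy m 0 with h | h | h
  · simp [qPochInv, h, show m - 1 < 0 by omega]
  · subst h; simp [qPochInv]
  · obtain ⟨k, rfl⟩ : ∃ k : ℕ, m = k + 1 := ⟨(m - 1).toNat, by omega⟩
    have h1 : ¬ ((k : ℤ) + 1 - 1 < 0) := by omega
    have h2 : ¬ ((k : ℤ) + 1 < 0) := by omega
    have h3 : ((k : ℤ) + 1 - 1).toNat = k := by omega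
    have h4 : ((k : ℤ) + 1).toNat = k + 1 := by omega
    simp only [qPochInv, if_neg h1, if_neg h2, h3, h4]
    have := one_sub_pow_ne_zero hq k
    have := qPoch_ne_zero hq k
    have h5 : qPoch q (k + 1) = qPoch q k * (1 - q ^ (k + 1)) := by
      simp [qPoch, Finset.prod_range_succ]
    rw [h5]
    have h6 : q ^ ((k : ℤ) + 1) = q ^ (k + 1) := by exact_mod_cast zpow_natCast q (k + 1)
    rw [h6]
    field_simp

/-- The coefficients of the finite form of the triple product. -/
noncomputable def tripleCoeff (q : ℂ) (N : ℕ) (n : ℤ) : ℂ :=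
  qPoch q (2 * N) * qPochInv q (N - n) * qPochInv q (N + n)

/-- For |n| ≤ N, `tripleCoeff q N n` is the Gaussian binomial coefficient of 2N over N + n. The
recursion is the q-Pascal rule used twice, and corresponds to one more pair of factors in the
product. -/
lemma tripleCoeff_succ {q : ℂ} (hq : ‖q‖ < 1) (hq0 : q ≠ 0) (N : ℕ) (n : ℤ) :
    tripleCoeff q (N + 1) n = (1 + q ^ (2 * N + 1)) * tripleCoeff q N n
      + q ^ (N + 1 - n) * tripleCoeff q N (n - 1) + q ^ (N + 1 + n) * tripleCoeff q N (n + 1) := by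
  have hQ : qPoch q (2 * (N + 1)) =
      qPoch q (2 * N) * (1 - q ^ (2 * N + 1)) * (1 - q ^ (2 * N + 2)) := by
    simp [qPoch, show 2 * (N + 1) = 2 * N + 1 + 1 by ring, Finset.prod_range_succ]
  have e1 := qPochInv_sub_one hq (N + 1 - n)
  have e2 := qPochInv_sub_one hq (N + 1 + n)
  have e3 := qPochInv_sub_one hq (N - n)
  have e4 := qPochInv_sub_one hq (N + n)
  have hαβ : q ^ ((N : ℤ) + 1 - n) * q ^ ((N : ℤ) + 1 + n) = q ^ (2 * N + 2) := by
    rw [← zpow_add₀ hq0, ← zpow_natCast]; congr 1; push_cast; ring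
  have hα : q ^ ((N : ℤ) - n) = q ^ ((N : ℤ) + 1 - n) / q := by
    rw [div_eq_mul_inv, ← zpow_sub_one₀ hq0]; congr 1; ring
  have hβ : q ^ ((N : ℤ) + n) = q ^ ((N : ℤ) + 1 + n) / q := by
    rw [div_eq_mul_inv, ← zpow_sub_one₀ hq0]; congr 1; ring
  have hγ : q ^ (2 * N + 1) = q ^ ((N : ℤ) + 1 - n) * q ^ ((N : ℤ) + 1 + n) / q := by
    rw [hαβ, eq_div_iff hq0]; ring
  have r1 : (N : ℤ) + 1 - n - 1 = N - n := by ring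
  have r2 : (N : ℤ) + 1 + n - 1 = N + n := by ring
  rw [r1] at e1
  rw [r2] at e2
  rw [hα, e1] at e3
  rw [hβ, e2] at e4
  simp only [tripleCoeff]
  have t1 : ((N : ℤ) - (n - 1)) = N + 1 - n := by ring
  have t2 : ((N : ℤ) + (n - 1)) = N + n - 1 := by ring
  have t3 : ((N : ℤ) - (n + 1)) = N - n - 1 := by ring
  have t4 : ((N : ℤ) + (n + 1)) = N + 1 + n := by ring
  have t5 : (((N + 1 : ℕ) : ℤ) - n) = N + 1 - n := by push_cast; ring
  have t6 : (((N + 1 : ℕ) : ℤ) + n) = N + 1 + n := by push_cast; ring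
  rw [t1, t2, t3, t4, t5, t6, e3, e4, e1, e2, hQ, hγ, ← hαβ]
  -- Every `qPochInv` is now expressed by its values at `N + 1 - n` and `N + 1 + n`, and a rational
  -- identity in α, β and q is left.
  generalize q ^ ((N : ℤ) + 1 - n) = α
  generalize q ^ ((N : ℤ) + 1 + n) = β
  field_simp
  ring

/-- Here `s` is a square root of q, which keeps all exponents integral. The new pair of factors is 1
+ q^{2N+1} + s q^N (y + y⁻¹), and its last two terms shift n by one. -/
lemma hasSum_finite_tripleProduct {s y : ℂ} (hs : ‖s‖ < 1) (hs0 : s ≠ 0) (hy : y ≠ 0) (N : ℕ) :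
    HasSum (fun n : ℤ => tripleCoeff (s ^ 2) N n * (s ^ (n ^ 2) * y ^ n))
      (∏ k ∈ Finset.range N, (1 + y * (s * (s ^ 2) ^ k)) * (1 + y⁻¹ * (s * (s ^ 2) ^ k))) := by
  have hq : ‖s ^ 2‖ < 1 := by
    rw [norm_pow]; exact pow_lt_one₀ (norm_nonneg _) hs two_ne_zero
  have hq0 : s ^ 2 ≠ 0 := pow_ne_zero _ hs0
  induction N with
  | zero =>
    have := hasSum_single (f := fun n : ℤ => tripleCoeff (s ^ 2) 0 n * (s ^ (n ^ 2) * y ^ n)) 0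
      (by
        intro n hn
        rcases lt_or_gt_of_ne hn with h | h
        · simp [tripleCoeff, qPochInv, h]
        · simp [tripleCoeff, qPochInv, h])
    simpa [tripleCoeff, qPochInv, qPoch] using this
  | succ N ih =>
    rw [Finset.prod_range_succ]
    set F := ∏ k ∈ Finset.range N, (1 + y * (s * (s ^ 2) ^ k)) * (1 + y⁻¹ * (s * (s ^ 2) ^ k))
    have hp := ((Equiv.addRight (-1 : ℤ)).hasSum_iff.2 ih).mul_left (s * (s ^ 2) ^ N * y)
    have hm := ((Equiv.addRight (1 : ℤ)).hasSum_iff.2 ih).mul_left (s * (s ^ 2) ^ N * y⁻¹)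
    have h0 := ih.mul_left (1 + (s ^ 2) ^ (2 * N + 1))
    convert! (h0.add hp).add hm using 1
    · funext n
      rw [tripleCoeff_succ hq hq0]
      simp only [Function.comp, Equiv.coe_addRight]
      have a1 : s * (s ^ 2) ^ N * y * (s ^ ((n + -1) ^ 2) * y ^ (n + -1)) =
          (s ^ 2) ^ ((N : ℤ) + 1 - n) * (s ^ (n ^ 2) * y ^ n) := by
        have : y * y ^ (n + -1) = y ^ n := by
          rw [← zpow_one_add₀ hy]; congr 1; ring
        have h2 : s * (s ^ 2) ^ N * s ^ ((n + -1) ^ 2) =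
            (s ^ 2) ^ ((N : ℤ) + 1 - n) * s ^ (n ^ 2) := by
          rw [← pow_mul, ← zpow_natCast, ← zpow_one_add₀ hs0, ← zpow_add₀ hs0,
            ← zpow_natCast s 2, ← zpow_mul, ← zpow_add₀ hs0]
          congr 1; push_cast; ring
        linear_combination s * (s ^ 2) ^ N * s ^ ((n + -1) ^ 2) * this + y ^ n * h2
      have a2 : s * (s ^ 2) ^ N * y⁻¹ * (s ^ ((n + 1) ^ 2) * y ^ (n + 1)) =
          (s ^ 2) ^ ((N : ℤ) + 1 + n) * (s ^ (n ^ 2) * y ^ n) := by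
        have : y⁻¹ * y ^ (n + 1) = y ^ n := by
          rw [zpow_add_one₀ hy]; field_simp
        have h2 : s * (s ^ 2) ^ N * s ^ ((n + 1) ^ 2) =
            (s ^ 2) ^ ((N : ℤ) + 1 + n) * s ^ (n ^ 2) := by
          rw [← pow_mul, ← zpow_natCast, ← zpow_one_add₀ hs0, ← zpow_add₀ hs0,
            ← zpow_natCast s 2, ← zpow_mul, ← zpow_add₀ hs0]
          congr 1; push_cast; ring
        linear_combination s * (s ^ 2) ^ N * s ^ ((n + 1) ^ 2) * this + y ^ n * h2
      rw [← sub_eq_add_neg] at a1 ⊢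
      linear_combination -tripleCoeff (s ^ 2) N (n - 1) * a1 - tripleCoeff (s ^ 2) N (n + 1) * a2
    · field_simp
      ring

lemma tendsto_qPoch {q : ℂ} (hq : ‖q‖ < 1) :
    Tendsto (qPoch q) atTop (𝓝 (∏' n : ℕ, (1 - q ^ (n + 1)))) :=
  (ModularForm.multipliable_one_sub_pow hq).hasProd.tendsto_prod_nat

lemma tprod_one_add_ne_zero {u : ℕ → ℂ} (hu : Summable fun n => ‖u n‖) (h : ∀ n, 1 + u n ≠ 0) :
    ∏' n, (1 + u n) ≠ 0 :=
  tprod_one_add_ne_zero_of_summable h hu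

lemma tprod_one_sub_pow_ne_zero {q : ℂ} (hq : ‖q‖ < 1) : ∏' n : ℕ, (1 - q ^ (n + 1)) ≠ 0 := by
  have := tprod_one_add_ne_zero (u := fun n => -q ^ (n + 1))
    (by simpa using (summable_nat_add_iff 1).mpr (summable_geometric_of_lt_one (norm_nonneg _) hq))
    (fun n => by simpa [sub_eq_add_neg] using one_sub_pow_ne_zero hq n)
  simpa [sub_eq_add_neg] using this

lemma tendsto_qPochInv {q : ℂ} (hq : ‖q‖ < 1) :
    Tendsto (qPochInv q) atTop (𝓝 (∏' n : ℕ, (1 - q ^ (n + 1)))⁻¹) := by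
  have h1 : Tendsto (fun m : ℤ => (qPoch q m.toNat)⁻¹) atTop (𝓝 (∏' n : ℕ, (1 - q ^ (n + 1)))⁻¹) :=
    ((tendsto_qPoch hq).comp (tendsto_atTop.2 fun b => by
      filter_upwards [eventually_ge_atTop (b : ℤ)] with m hm; omega)).inv₀
      (tprod_one_sub_pow_ne_zero hq)
  refine h1.congr' ?_
  filter_upwards [eventually_ge_atTop 0] with m hm
  simp [qPochInv, not_lt.2 hm]

/-- Uniformity in both N and n provides the majorant for letting N tend to infinity under the sum.
-/
lemma exists_bound_tripleCoeff {q : ℂ} (hq : ‖q‖ < 1) :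
    ∃ C, ∀ N n, ‖tripleCoeff q N n‖ ≤ C := by
  obtain ⟨A, hA⟩ := ((tendsto_qPoch hq).norm).bddAbove_range
  have hinv : Tendsto (fun m : ℕ => ‖(qPoch q m)⁻¹‖) atTop _ :=
    ((tendsto_qPoch hq).inv₀ (tprod_one_sub_pow_ne_zero hq)).norm
  obtain ⟨B, hB⟩ := hinv.bddAbove_range
  have hA' : ∀ m, ‖qPoch q m‖ ≤ A := fun m => hA ⟨m, rfl⟩
  have hB0 : 0 ≤ B := (norm_nonneg _).trans (hB ⟨0, rfl⟩)
  have hB' : ∀ m, ‖qPochInv q m‖ ≤ B := fun m => by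
    unfold qPochInv
    split_ifs
    · simpa using hB0
    · exact hB ⟨_, rfl⟩
  refine ⟨A * B * B, fun N n => ?_⟩
  rw [tripleCoeff, norm_mul, norm_mul]
  have hA0 : 0 ≤ A := (norm_nonneg _).trans (hA' 0)
  gcongr
  exacts [hA' _, hB' _, hB' _]

lemma tendsto_tripleCoeff {q : ℂ} (hq : ‖q‖ < 1) (n : ℤ) :
    Tendsto (fun N => tripleCoeff q N n) atTop (𝓝 (∏' n : ℕ, (1 - q ^ (n + 1)))⁻¹) := by
  have hP := tprod_one_sub_pow_ne_zero hq
  have h1 := (tendsto_qPoch hq).comp (tendsto_id.const_mul_atTop' (two_pos : 0 < 2))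
  have hc : Tendsto (fun N : ℕ => (N : ℤ)) atTop atTop := tendsto_natCast_atTop_atTop
  have h2 := (tendsto_qPochInv hq).comp (tendsto_atTop_add_const_right _ (-n) hc)
  have h3 := (tendsto_qPochInv hq).comp (tendsto_atTop_add_const_right _ n hc)
  have := (h1.mul h2).mul h3
  rw [mul_inv_cancel₀ hP, one_mul] at this
  exact this

lemma jacobiTheta₂_term_eq_zpow (n : ℤ) (z τ : ℂ) :
    jacobiTheta₂_term n z τ = cexp (π * I * τ) ^ (n ^ 2) * cexp (2 * π * I * z) ^ n := by
  rw [jacobiTheta₂_term, ← exp_int_mul, ← exp_int_mul, ← Complex.exp_add]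
  congr 1; push_cast; ring

/-- The Jacobi triple product identity. -/
theorem jacobi_tripleProduct (τ : ℍ) (z : ℂ) : jacobiTheta₂ z τ = theta3 τ z := by
  set s := cexp (π * I * τ) with hs
  set y := cexp (2 * π * I * z) with hy
  have hs0 : s ≠ 0 := exp_ne_zero _
  have hy0 : y ≠ 0 := exp_ne_zero _
  have hs1 : ‖s‖ < 1 := by
    rw [hs, norm_exp, Real.exp_lt_one_iff]
    have := τ.im_pos
    simp
    positivity
  have hq : ‖s ^ 2‖ < 1 := by
    rw [norm_pow]; exact pow_lt_one₀ (norm_nonneg _) hs1 two_ne_zero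
  have hτ : e τ = s ^ 2 := by
    rw [e, hs, ← exp_nat_mul]; congr 1; push_cast; ring
  have hP := tprod_one_sub_pow_ne_zero hq
  have hgeo : ∀ u : ℂ, Summable fun k : ℕ => ‖u * (s * (s ^ 2) ^ k)‖ := fun u => by
    simpa [norm_mul, norm_pow] using
      ((summable_geometric_of_lt_one (norm_nonneg _) hq).mul_left ‖s‖).mul_left ‖u‖
  have hm : ∀ u : ℂ, Multipliable fun k : ℕ => 1 + u * (s * (s ^ 2) ^ k) := fun u =>
    multipliable_one_add_of_summable (hgeo u)
  obtain ⟨C, hC⟩ := exists_bound_tripleCoeff hq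
  have hterm := fun n => jacobiTheta₂_term_eq_zpow n z τ
  have hsum : Summable fun n : ℤ => s ^ (n ^ 2) * y ^ n := by
    simpa only [hterm] using (summable_jacobiTheta₂_term_iff z τ).2 τ.im_pos
  -- The coefficients all tend to the inverse of ∏ (1 - qⁿ), so the finite identities converge to
  -- the theta series divided by that product.
  have hlim := tendsto_tsum_of_dominated_convergence (𝓕 := atTop)
    (f := fun N (n : ℤ) => tripleCoeff (s ^ 2) N n * (s ^ (n ^ 2) * y ^ n))
    (hsum.norm.mul_left C) (fun n => (tendsto_tripleCoeff hq n).mul_const _)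
    (Eventually.of_forall fun N n => by rw [norm_mul]; gcongr; exact hC N n)
  rw [tsum_mul_left] at hlim
  have hlim2 := (((hm y).mul (hm y⁻¹)).hasProd.tendsto_prod_nat)
  have heq := tendsto_nhds_unique hlim
    (hlim2.congr fun N => (hasSum_finite_tripleProduct hs1 hs0 hy0 N).tsum_eq.symm)
  have h1 : jacobiTheta₂ z τ = ∑' n : ℤ, s ^ (n ^ 2) * y ^ n := tsum_congr hterm
  rw [h1, theta3]
  have h2 : ∀ n : ℕ, e ((n + 1 / 2) * τ) = s * (s ^ 2) ^ n := fun n => by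
    rw [e, hs, ← exp_nat_mul, ← exp_nat_mul, ← Complex.exp_add]; congr 1; push_cast; ring
  have h3 : e z = y := rfl
  simp only [h2, h3, hτ]
  have h4 : ∏' n : ℕ, (1 - (s ^ 2) ^ (n + 1)) * (1 + y * (s * (s ^ 2) ^ n)) *
      (1 + y⁻¹ * (s * (s ^ 2) ^ n)) = (∏' n : ℕ, (1 - (s ^ 2) ^ (n + 1))) *
      ∏' n : ℕ, (1 + y * (s * (s ^ 2) ^ n)) * (1 + y⁻¹ * (s * (s ^ 2) ^ n)) := by
    rw [← (ModularForm.multipliable_one_sub_pow hq).tprod_mul ((hm y).mul (hm y⁻¹))]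
    simp only [mul_assoc]
  rw [h4, ← heq, mul_inv_cancel_left₀ hP]

end TripleProduct

/-! ### The exponential `e` and the automorphy factor -/

lemma e_add (x y : ℂ) : e (x + y) = e x * e y := by
  rw [e, e, e, ← Complex.exp_add]; congr 1; ring

lemma e_ne_zero (x : ℂ) : e x ≠ 0 := Complex.exp_ne_zero _

lemma e_zero : e 0 = 1 := by simp [e]

lemma e_neg (x : ℂ) : e (-x) = (e x)⁻¹ := by
  rw [e, e, ← Complex.exp_neg]; congr 1; ring

lemma e_sub (x y : ℂ) : e (x - y) = e x / e y := by
  rw [sub_eq_add_neg, e_add, e_neg, div_eq_mul_inv]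

lemma e_int (n : ℤ) : e n = 1 := by
  rw [e, mul_comm, Complex.exp_int_mul_two_pi_mul_I]

lemma e_nat_mul (n : ℕ) (x : ℂ) : e (n * x) = e x ^ n := by
  rw [e, e, ← Complex.exp_nat_mul]; congr 1; ring

lemma e_int_mul (n : ℤ) (x : ℂ) : e (n * x) = e x ^ n := by
  rw [e, e, ← Complex.exp_int_mul]; congr 1; ring

lemma e_half : e (1 / 2) = -1 := by
  rw [e, ← Complex.exp_pi_mul_I]; congr 1; ring

lemma norm_e (x : ℂ) : ‖e x‖ = Real.exp (-2 * π * x.im) := by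
  rw [e, Complex.norm_exp]; congr 1; simp

lemma norm_e_lt_one {x : ℂ} (hx : 0 < x.im) : ‖e x‖ < 1 := by
  rw [norm_e, Real.exp_lt_one_iff]
  have : 0 < π * x.im := by positivity
  linarith

/-- The automorphy factor `cτ + d`. -/
noncomputable def jfac (γ : SL(2, ℤ)) (τ : ℍ) : ℂ := (γ 1 0 : ℂ) * τ + (γ 1 1 : ℂ)

lemma jfac_ne_zero (γ : SL(2, ℤ)) (τ : ℍ) : jfac γ τ ≠ 0 := by
  rw [jfac, ← ModularGroup.denom_apply]; exact denom_ne_zero _ τ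

lemma coe_smul_eq (γ : SL(2, ℤ)) (τ : ℍ) :
    ((γ • τ : ℍ) : ℂ) = ((γ 0 0 : ℂ) * τ + (γ 0 1 : ℂ)) / jfac γ τ := by
  rw [coe_specialLinearGroup_apply, jfac]; simp

lemma det_eq (γ : SL(2, ℤ)) : (γ 0 0 : ℂ) * (γ 1 1 : ℂ) - (γ 0 1 : ℂ) * (γ 1 0 : ℂ) = 1 := by
  have h := γ.det_coe
  rw [Matrix.det_fin_two] at h
  exact_mod_cast h

lemma jfac_mul (γ γ' : SL(2, ℤ)) (τ : ℍ) : jfac (γ * γ') τ = jfac γ (γ' • τ) * jfac γ' τ := by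
  have h := jfac_ne_zero γ' τ
  have h1 : jfac γ (γ' • τ) = (γ 1 0 : ℂ) * ((γ' • τ : ℍ) : ℂ) + (γ 1 1 : ℂ) := rfl
  rw [h1, coe_smul_eq]
  field_simp
  simp only [jfac, Matrix.SpecialLinearGroup.coe_mul, Matrix.mul_apply, Fin.sum_univ_two]
  push_cast
  ring

lemma jfac_one (τ : ℍ) : jfac 1 τ = 1 := by simp [jfac]

lemma jacobiSlash_eq (w t : ℤ) (φ : ℍ → ℂ → ℂ) (γ : SL(2, ℤ)) (τ : ℍ) (z : ℂ) :
    jacobiSlash w t φ γ τ z = jfac γ τ ^ (-w) *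
      e (-(t * ((γ 1 0 : ℂ) * z ^ 2 / jfac γ τ))) * φ (γ • τ) (z / jfac γ τ) := rfl

lemma jacobiSlash_one (w t : ℤ) (φ : ℍ → ℂ → ℂ) : jacobiSlash w t φ 1 = φ := by
  funext τ z
  simp [jacobiSlash_eq, jfac_one, e_zero]

/-- Beside the cocycle rule for cτ + d, the exponential of z² needs its own additive cocycle rule,
`key`, which rests on det γ' = 1. -/
lemma jacobiSlash_mul (w t : ℤ) (φ : ℍ → ℂ → ℂ) (γ γ' : SL(2, ℤ)) :
    jacobiSlash w t φ (γ * γ') = jacobiSlash w t (jacobiSlash w t φ γ) γ' := by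
  funext τ z
  simp only [jacobiSlash_eq]
  have h := jfac_ne_zero γ' τ
  have h' := jfac_ne_zero γ (γ' • τ)
  have hd := det_eq γ'
  have key : -(t * (((γ * γ') 1 0 : ℂ) * z ^ 2 / jfac (γ * γ') τ)) =
      -(t * ((γ' 1 0 : ℂ) * z ^ 2 / jfac γ' τ)) +
      -(t * ((γ 1 0 : ℂ) * (z / jfac γ' τ) ^ 2 / jfac γ (γ' • τ))) := by
    rw [jfac_mul]
    have h1 : jfac γ (γ' • τ) = (γ 1 0 : ℂ) * ((γ' • τ : ℍ) : ℂ) + (γ 1 1 : ℂ) := rfl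
    have h2 : (((γ * γ') 1 0 : ℤ) : ℂ) =
        (γ 1 0 : ℂ) * (γ' 0 0 : ℂ) + (γ 1 1 : ℂ) * (γ' 1 0 : ℂ) := by
      simp only [Matrix.SpecialLinearGroup.coe_mul, Matrix.mul_apply, Fin.sum_univ_two]
      push_cast; ring
    have h3 : jfac γ (γ' • τ) * jfac γ' τ = (γ 1 0 : ℂ) * ((γ' 0 0 : ℂ) * τ + (γ' 0 1 : ℂ))
        + (γ 1 1 : ℂ) * jfac γ' τ := by
      rw [h1, coe_smul_eq]; field_simp
    have h4 : (((γ * γ') 1 0 : ℤ) : ℂ) * jfac γ' τ =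
        (γ' 1 0 : ℂ) * (jfac γ (γ' • τ) * jfac γ' τ) + (γ 1 0 : ℂ) := by
      rw [h3, h2]
      simp only [jfac]
      linear_combination (γ 1 0 : ℂ) * hd
    field_simp
    linear_combination -t * z ^ 2 * h4
  rw [key, e_add, jfac_mul, mul_zpow, mul_smul, div_div, mul_comm (jfac γ' τ) (jfac γ (γ' • τ))]
  ring

lemma jacobiSlash_eq_of_generators {w t : ℤ} {φ : ℍ → ℂ → ℂ}
    (hS : jacobiSlash w t φ ModularGroup.S = φ) (hT : jacobiSlash w t φ ModularGroup.T = φ)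
    (γ : SL(2, ℤ)) : jacobiSlash w t φ γ = φ := by
  have hγ : γ ∈ Subgroup.closure {ModularGroup.S, ModularGroup.T} := by
    simp [SpecialLinearGroup.SL2Z_generators]
  induction hγ using Subgroup.closure_induction with
  | mem x hx => rcases hx with rfl | rfl <;> assumption
  | one => exact jacobiSlash_one w t φ
  | mul x y _ _ hx hy => rw [jacobiSlash_mul, hx, hy]
  | inv x _ hx =>
    conv_lhs => rw [← hx]
    rw [← jacobiSlash_mul, mul_inv_cancel, jacobiSlash_one]

lemma jfac_S (τ : ℍ) : jfac ModularGroup.S τ = τ := by simp [jfac, ModularGroup.S]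

lemma jfac_T (τ : ℍ) : jfac ModularGroup.T τ = 1 := by simp [jfac, ModularGroup.T]

lemma coe_S_smul (τ : ℍ) : ((ModularGroup.S • τ : ℍ) : ℂ) = -1 / τ := by
  rw [coe_smul_eq, jfac_S]; simp [ModularGroup.S]

lemma coe_T_smul (τ : ℍ) : ((ModularGroup.T • τ : ℍ) : ℂ) = τ + 1 := by
  rw [coe_smul_eq, jfac_T]; simp [ModularGroup.T]

/-! ### The theta functions -/

lemma theta3_eq (τ : ℍ) (z : ℂ) : theta3 τ z = jacobiTheta₂ z τ := (jacobi_tripleProduct τ z).symm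

lemma theta4_eq (τ : ℍ) (z : ℂ) : theta4 τ z = jacobiTheta₂ (z + 1 / 2) τ := by
  rw [jacobi_tripleProduct, theta3, theta4]
  simp only [e_add, e_half, mul_neg, mul_one, neg_mul, inv_neg, sub_eq_add_neg]

/-- Shifting z by τ/2 turns the exponents n + 1/2 of q into n + 1 and n. -/
lemma theta2_eq (τ : ℍ) (z : ℂ) :
    theta2 τ z = e (τ / 8) * e (z / 2) * jacobiTheta₂ (z + τ / 2) τ := by
  rw [jacobi_tripleProduct, theta3, theta2]
  congr 1
  refine tprod_congr fun n => ?_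
  have h1 : e (z + τ / 2) * e ((n + 1 / 2) * τ) = e z * e τ ^ (n + 1) := by
    rw [← e_nat_mul, ← e_add, ← e_add]; congr 1; push_cast; ring
  have h2 : (e (z + τ / 2))⁻¹ * e ((n + 1 / 2) * τ) = (e z)⁻¹ * e τ ^ n := by
    rw [← e_nat_mul, ← e_neg, ← e_neg, ← e_add, ← e_add]; congr 1; ring
  rw [h1, h2]

lemma theta1_eq (τ : ℍ) (z : ℂ) :
    theta1 τ z = -I * e (τ / 8) * e (z / 2) * jacobiTheta₂ (z + τ / 2 + 1 / 2) τ := by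
  rw [jacobi_tripleProduct, theta3, theta1]
  congr 1
  refine tprod_congr fun n => ?_
  have h1 : e (z + τ / 2) * e ((n + 1 / 2) * τ) = e z * e τ ^ (n + 1) := by
    rw [← e_nat_mul, ← e_add, ← e_add]; congr 1; push_cast; ring
  have h2 : (e (z + τ / 2))⁻¹ * e ((n + 1 / 2) * τ) = (e z)⁻¹ * e τ ^ n := by
    rw [← e_nat_mul, ← e_neg, ← e_neg, ← e_add, ← e_add]; congr 1; ring
  rw [e_add _ (1 / 2), e_half]
  simp only [mul_neg, mul_one, neg_mul, inv_neg, h1, h2, sub_eq_add_neg]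

/-- Replacing τ by τ + 1 multiplies the n-th term by (-1)^{n²}, and n² ≡ n modulo 2. -/
lemma jacobiTheta₂_add_right_one (z τ : ℂ) :
    jacobiTheta₂ z (τ + 1) = jacobiTheta₂ (z + 1 / 2) τ := by
  refine tsum_congr fun n => ?_
  obtain ⟨k, hk⟩ : Even (n ^ 2 - n) := by
    rw [show n ^ 2 - n = n * (n - 1) by ring]; exact Int.even_mul_pred_self n
  have hk' : (n : ℂ) ^ 2 = n + 2 * k := by
    have : n ^ 2 = n + 2 * k := by omega
    exact_mod_cast this
  rw [jacobiTheta₂_term, jacobiTheta₂_term, Complex.exp_eq_exp_iff_exists_int]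
  exact ⟨k, by linear_combination π * I * hk'⟩

lemma jacobiTheta₂_sub_half (z τ : ℂ) : jacobiTheta₂ (z - 1 / 2) τ = jacobiTheta₂ (z + 1 / 2) τ := by
  rw [← jacobiTheta₂_add_left (z - 1 / 2)]; congr 1; ring

lemma jacobiTheta₂_elliptic (lam mu : ℤ) (z τ : ℂ) :
    jacobiTheta₂ (z + lam * τ + mu) τ = e (-(lam ^ 2 * τ / 2 + lam * z)) * jacobiTheta₂ z τ := by
  conv_rhs => rw [jacobiTheta₂, ← tsum_mul_left, ← (Equiv.addRight lam).tsum_eq]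
  refine tsum_congr fun n => ?_
  simp only [jacobiTheta₂_term, Equiv.coe_addRight, e]
  rw [← Complex.exp_add, Complex.exp_eq_exp_iff_exists_int]
  exact ⟨n * mu, by push_cast; ring⟩

/-- Only squares of theta functions enter the two Jacobi forms, and squaring removes the branch of
(-iτ)^{1/2}. -/
lemma jacobiTheta₂_sq_S (w : ℂ) (τ : ℍ) : jacobiTheta₂ (w / τ) (-1 / τ) ^ 2 =
    -I * τ * e (w ^ 2 / τ) * jacobiTheta₂ w τ ^ 2 := by
  have h := jacobiTheta₂_functional_equation w τ
  have h0 : (-I * (τ : ℂ)) ≠ 0 := mul_ne_zero (neg_ne_zero.2 I_ne_zero) τ.ne_zero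
  have h1 : ((-I * (τ : ℂ)) ^ (1 / 2 : ℂ)) ^ 2 = -I * τ := by
    have := Complex.cpow_nat_inv_pow (-I * (τ : ℂ)) two_ne_zero
    simpa only [Nat.cast_ofNat, one_div] using this
  have h2 : cexp (-π * I * w ^ 2 / τ) ^ 2 * e (w ^ 2 / τ) = 1 := by
    rw [e, ← Complex.exp_nat_mul, ← Complex.exp_add, ← Complex.exp_zero]; congr 1; push_cast; ring
  rw [h]
  generalize jacobiTheta₂ (w / τ) (-1 / τ) = A
  rw [mul_pow, mul_pow, div_pow, h1]
  calc A ^ 2 = (-I * τ) / (-I * τ) * (cexp (-π * I * w ^ 2 / τ) ^ 2 * e (w ^ 2 / τ)) * A ^ 2 := by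
        rw [h2, div_self h0]; ring
    _ = _ := by ring

lemma theta3_sq_S (τ : ℍ) (z : ℂ) : theta3 (ModularGroup.S • τ) (z / τ) ^ 2 =
    -I * τ * e (z ^ 2 / τ) * theta3 τ z ^ 2 := by
  rw [theta3_eq, theta3_eq, coe_S_smul, jacobiTheta₂_sq_S]

lemma theta4_sq_S (τ : ℍ) (z : ℂ) : theta4 (ModularGroup.S • τ) (z / τ) ^ 2 =
    -I * τ * e (z ^ 2 / τ) * theta2 τ z ^ 2 := by
  have h := τ.ne_zero
  rw [theta4_eq, theta2_eq, coe_S_smul, show z / (τ : ℂ) + 1 / 2 = (z + τ / 2) / τ by field_simp,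
    jacobiTheta₂_sq_S]
  have : e ((z + τ / 2) ^ 2 / τ) = e (z ^ 2 / τ) * (e (τ / 8) * e (z / 2)) ^ 2 := by
    rw [← e_add, ← e_nat_mul, ← e_add]; congr 1; push_cast; field_simp; ring
  rw [this]
  ring

lemma theta2_sq_S (τ : ℍ) (z : ℂ) : theta2 (ModularGroup.S • τ) (z / τ) ^ 2 =
    -I * τ * e (z ^ 2 / τ) * theta4 τ z ^ 2 := by
  have h := τ.ne_zero
  rw [theta4_eq, theta2_eq, coe_S_smul, mul_pow,
    show z / (τ : ℂ) + -1 / τ / 2 = (z - 1 / 2) / τ by field_simp; ring, jacobiTheta₂_sq_S,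
    jacobiTheta₂_sub_half]
  have : (e (-1 / τ / 8) * e (z / τ / 2)) ^ 2 * e ((z - 1 / 2) ^ 2 / τ) = e (z ^ 2 / τ) := by
    rw [← e_add, ← e_nat_mul, ← e_add]; congr 1; push_cast; field_simp; ring
  linear_combination -I * τ * jacobiTheta₂ (z + 1 / 2) τ ^ 2 * this

lemma theta1_sq_S (τ : ℍ) (z : ℂ) : theta1 (ModularGroup.S • τ) (z / τ) ^ 2 =
    I * τ * e (z ^ 2 / τ) * theta1 τ z ^ 2 := by
  have h := τ.ne_zero
  rw [theta1_eq, theta1_eq, coe_S_smul, mul_pow,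
    show z / (τ : ℂ) + -1 / τ / 2 + 1 / 2 = (z + τ / 2 - 1 / 2) / τ by field_simp; ring,
    jacobiTheta₂_sq_S, jacobiTheta₂_sub_half]
  have : (e (-1 / τ / 8) * e (z / τ / 2)) ^ 2 * e ((z + τ / 2 - 1 / 2) ^ 2 / τ) =
      -(e (z ^ 2 / τ) * (e (τ / 8) * e (z / 2)) ^ 2) := by
    have h1 : ∀ x, -e x = e (x - 1 / 2) := fun x => by rw [e_sub, e_half]; ring
    rw [← e_add, ← e_nat_mul, ← e_add, ← e_add, ← e_nat_mul, ← e_add, h1]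
    congr 1; push_cast; field_simp; ring
  linear_combination -I * τ * jacobiTheta₂ (z + τ / 2 + 1 / 2) τ ^ 2 * I ^ 2 * this

lemma theta3_T (τ : ℍ) (z : ℂ) : theta3 (ModularGroup.T • τ) z = theta4 τ z := by
  rw [theta3_eq, theta4_eq, coe_T_smul, jacobiTheta₂_add_right_one]

lemma theta4_T (τ : ℍ) (z : ℂ) : theta4 (ModularGroup.T • τ) z = theta3 τ z := by
  rw [theta3_eq, theta4_eq, coe_T_smul, jacobiTheta₂_add_right_one, ← jacobiTheta₂_add_left z]
  congr 1; ring

lemma theta2_T (τ : ℍ) (z : ℂ) : theta2 (ModularGroup.T • τ) z = e (1 / 8) * theta2 τ z := by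
  rw [theta2_eq, theta2_eq, coe_T_smul, jacobiTheta₂_add_right_one,
    show z + (τ + 1) / 2 + 1 / 2 = z + (τ : ℂ) / 2 + 1 by ring, jacobiTheta₂_add_left, add_div,
    e_add]
  ring

lemma theta1_T (τ : ℍ) (z : ℂ) : theta1 (ModularGroup.T • τ) z = e (1 / 8) * theta1 τ z := by
  rw [theta1_eq, theta1_eq, coe_T_smul, jacobiTheta₂_add_right_one,
    show z + (τ + 1) / 2 + 1 / 2 + 1 / 2 = z + (τ : ℂ) / 2 + 1 / 2 + 1 by ring,
    jacobiTheta₂_add_left, add_div, e_add]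
  ring

/-! ### The Dedekind eta function -/

lemma eta_add_one (τ : ℂ) : ModularForm.eta (τ + 1) = e (1 / 24) * ModularForm.eta τ := by
  have h1 : Function.Periodic.qParam 24 (τ + 1) = e (1 / 24) * Function.Periodic.qParam 24 τ := by
    rw [Function.Periodic.qParam, Function.Periodic.qParam, e, ← Complex.exp_add]
    congr 1; push_cast; ring
  have h2 : ∀ n, ModularForm.eta_q n (τ + 1) = ModularForm.eta_q n τ := fun n => by
    rw [ModularForm.eta_q_eq_pow, ModularForm.eta_q_eq_pow, mul_add, mul_one, Complex.exp_add,
      Complex.exp_two_pi_mul_I, mul_one]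
  simp only [ModularForm.eta, h1, h2, mul_assoc]

lemma sqrt_sq (x : ℂ) : Complex.sqrt x ^ 2 = x := by
  have := Complex.cpow_nat_inv_pow x two_ne_zero
  simpa only [Nat.cast_ofNat, Complex.sqrt] using this

lemma eta_S {τ : ℂ} (hτ : 0 < τ.im) :
    ModularForm.eta (-1 / τ) = (Complex.sqrt I)⁻¹ * (Complex.sqrt τ * ModularForm.eta τ) :=
  ModularForm.eta_comp_eq_csqrt_I_inv hτ

lemma eta_sq_S {τ : ℂ} (hτ : 0 < τ.im) :
    ModularForm.eta (-1 / τ) ^ 2 = -I * τ * ModularForm.eta τ ^ 2 := by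
  rw [eta_S hτ, mul_pow, mul_pow, inv_pow, sqrt_sq, sqrt_sq, inv_I]; ring

lemma natCast_mul_im_pos {k : ℕ} (hk : 0 < k) {w : ℂ} (hw : 0 < w.im) : 0 < ((k : ℂ) * w).im := by
  have : ((k : ℂ) * w).im = k * w.im := by simp
  rw [this]
  positivity

lemma etaAt_ne_zero {k : ℕ} (hk : 0 < k) (τ : ℍ) : etaAt k τ ≠ 0 :=
  ModularForm.eta_ne_zero (natCast_mul_im_pos hk τ.im_pos)

/-! ### The forms `φ_{0,1}` and `φ_{-2,1}` -/

lemma one_add_ne_zero_of_norm_lt {x : ℂ} (hx : ‖x‖ < 1) : 1 + x ≠ 0 := by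
  intro h
  rw [eq_neg_of_add_eq_zero_right h, norm_neg, norm_one] at hx
  exact hx.false

lemma tprod_theta_ne_zero {q : ℂ} (hq : ‖q‖ < 1) {a b : ℂ} (ha : ∀ n : ℕ, 1 + a * q ^ n ≠ 0)
    (hb : ∀ n : ℕ, 1 + b * q ^ n ≠ 0) :
    ∏' n : ℕ, (1 - q ^ (n + 1)) * (1 + a * q ^ n) * (1 + b * q ^ n) ≠ 0 := by
  have hs : ∀ u : ℂ, Summable fun k : ℕ => ‖u * q ^ k‖ := fun u => by
    simpa [norm_mul, norm_pow] using (summable_geometric_of_lt_one (norm_nonneg _) hq).mul_left ‖u‖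
  have hm := fun u => multipliable_one_add_of_summable (hs u)
  have h0 := ModularForm.multipliable_one_sub_pow hq
  rw [(h0.mul (hm a)).tprod_mul (hm b), h0.tprod_mul (hm a)]
  exact mul_ne_zero (mul_ne_zero (tprod_one_sub_pow_ne_zero hq) (tprod_one_add_ne_zero (hs a) ha))
    (tprod_one_add_ne_zero (hs b) hb)

lemma norm_e_coe_lt_one (τ : ℍ) : ‖e τ‖ < 1 := norm_e_lt_one τ.im_pos

lemma norm_e_half_mul_pow_lt (τ : ℍ) (n : ℕ) : ‖e (τ / 2) * e τ ^ n‖ < 1 := by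
  have h1 : ‖e ((τ : ℂ) / 2)‖ < 1 := norm_e_lt_one (by simpa using τ.im_pos)
  rw [norm_mul, norm_pow]
  exact mul_lt_one_of_nonneg_of_lt_one_left (norm_nonneg _) h1
    (pow_le_one₀ (norm_nonneg _) (norm_e_coe_lt_one τ).le)

lemma e_add_half_mul (τ : ℍ) (n : ℕ) : e ((n + 1 / 2) * τ) = e (τ / 2) * e τ ^ n := by
  rw [← e_nat_mul, ← e_add]; congr 1; ring

lemma theta3_zero_ne (τ : ℍ) : theta3 τ 0 ≠ 0 := by
  simp only [theta3, e_zero, inv_one, one_mul, e_add_half_mul]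
  exact tprod_theta_ne_zero (norm_e_coe_lt_one τ)
    (fun n => one_add_ne_zero_of_norm_lt (norm_e_half_mul_pow_lt τ n))
    (fun n => one_add_ne_zero_of_norm_lt (norm_e_half_mul_pow_lt τ n))

lemma theta4_zero_ne (τ : ℍ) : theta4 τ 0 ≠ 0 := by
  have h : ∀ n : ℕ, 1 + (-e (τ / 2)) * e τ ^ n ≠ 0 := fun n =>
    one_add_ne_zero_of_norm_lt (by simpa using norm_e_half_mul_pow_lt τ n)
  have := tprod_theta_ne_zero (norm_e_coe_lt_one τ) h h
  simpa only [theta4, e_zero, inv_one, one_mul, e_add_half_mul, sub_eq_add_neg, neg_mul] using this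

lemma theta2_zero_ne (τ : ℍ) : theta2 τ 0 ≠ 0 := by
  have hq := norm_e_coe_lt_one τ
  have h : ∀ n : ℕ, 1 + e τ * e τ ^ n ≠ 0 := fun n => one_add_ne_zero_of_norm_lt (by
    rw [← pow_succ', norm_pow]
    exact pow_lt_one₀ (norm_nonneg _) hq n.succ_ne_zero)
  have h' : ∀ n : ℕ, 1 + 1 * e τ ^ n ≠ 0 := by
    rintro (_ | n)
    · norm_num
    · rw [one_mul, pow_succ']; exact h n
  have := tprod_theta_ne_zero hq h h'
  rw [theta2]
  refine mul_ne_zero (mul_ne_zero (e_ne_zero _) (e_ne_zero _)) ?_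
  simpa only [e_zero, inv_one, one_mul, ← pow_succ'] using this

/-- Under S the square of θ₃ is kept and those of θ₂ and θ₄ are exchanged, all up to the same factor
-iτ e(z²/τ); dividing by the values at z = 0 leaves e(z²/τ). Under T the functions θ₃ and θ₄ are
exchanged, and the constant acquired by θ₂ cancels. -/
theorem phi01_slash (γ : SL(2, ℤ)) : jacobiSlash 0 1 phi01 γ = phi01 := by
  refine jacobiSlash_eq_of_generators ?_ ?_ γ <;> funext τ z
  · have h2 := theta2_zero_ne τ
    have h3 := theta3_zero_ne τ
    have h4 := theta4_zero_ne τ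
    have hτ := τ.ne_zero
    have k2 := theta2_sq_S τ 0
    have k3 := theta3_sq_S τ 0
    have k4 := theta4_sq_S τ 0
    simp only [zero_div, zero_pow two_ne_zero, e_zero, mul_one] at k2 k3 k4
    rw [jacobiSlash_eq, jfac_S, phi01, phi01, div_pow, div_pow, div_pow, div_pow, div_pow, div_pow,
      theta2_sq_S, theta3_sq_S, theta4_sq_S, k2, k3, k4]
    have he : e (-(((1 : ℤ) : ℂ) * (((ModularGroup.S 1 0 : ℤ) : ℂ) * z ^ 2 / τ))) =
        (e (z ^ 2 / τ))⁻¹ := by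
      rw [← e_neg]; simp [ModularGroup.S]
    have hne := e_ne_zero (z ^ 2 / τ)
    have hI := I_ne_zero
    rw [he, neg_zero, zpow_zero]
    field_simp
    ring
  · rw [jacobiSlash_eq, jfac_T, phi01, phi01]
    have h8 := e_ne_zero (1 / 8)
    simp only [div_one, theta2_T, theta3_T, theta4_T]
    simp only [mul_div_mul_left _ _ h8]
    simp [ModularGroup.T, e_zero]
    ring

/-- Under S the numerator θ₁² acquires iτ e(z²/τ) and the denominator η⁶ acquires iτ³, whence the
weight -2. Under T both acquire e(1/4). -/
theorem phi21_slash (γ : SL(2, ℤ)) : jacobiSlash (-2) 1 phi21 γ = phi21 := by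
  refine jacobiSlash_eq_of_generators ?_ ?_ γ <;> funext τ z
  · have hη : etaAt 1 (ModularGroup.S • τ) ^ 6 = I * τ ^ 3 * etaAt 1 τ ^ 6 := by
      have := eta_sq_S τ.im_pos
      simp only [etaAt, coe_S_smul, Nat.cast_one, one_mul] at this ⊢
      rw [show 6 = 2 * 3 by rfl, pow_mul, pow_mul, this]
      linear_combination (-τ ^ 3 * (ModularForm.eta τ ^ 2) ^ 3 * I) * I_sq
    have hη0 := etaAt_ne_zero one_pos τ
    have hτ := τ.ne_zero
    rw [jacobiSlash_eq, jfac_S, phi21, phi21, theta1_sq_S, hη]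
    have he : e (-(((1 : ℤ) : ℂ) * (((ModularGroup.S 1 0 : ℤ) : ℂ) * z ^ 2 / τ))) =
        (e (z ^ 2 / τ))⁻¹ := by
      rw [← e_neg]; simp [ModularGroup.S]
    have hne := e_ne_zero (z ^ 2 / τ)
    have hI := I_ne_zero
    rw [he, neg_neg]
    field_simp
  · have hη : etaAt 1 (ModularGroup.T • τ) = e (1 / 24) * etaAt 1 τ := by
      simp only [etaAt, coe_T_smul, Nat.cast_one, one_mul, eta_add_one]
    rw [jacobiSlash_eq, jfac_T, phi21, phi21, hη, div_one, theta1_T, mul_pow, mul_pow,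
      ← e_nat_mul, ← e_nat_mul]
    have hh : e (((2 : ℕ) : ℂ) * (1 / 8)) = e (((6 : ℕ) : ℂ) * (1 / 24)) := by
      congr 1; norm_num
    rw [hh, mul_div_mul_left _ _ (e_ne_zero _)]
    simp [ModularGroup.T, e_zero]

/-! ### Elliptic transformation laws -/

lemma theta3_sq_elliptic (lam mu : ℤ) (τ : ℍ) (z : ℂ) :
    theta3 τ (z + lam * τ + mu) ^ 2 = e (-(lam ^ 2 * τ + 2 * lam * z)) * theta3 τ z ^ 2 := by
  rw [theta3_eq, theta3_eq, jacobiTheta₂_elliptic, mul_pow, ← e_nat_mul]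
  congr 2; push_cast; ring

lemma theta4_sq_elliptic (lam mu : ℤ) (τ : ℍ) (z : ℂ) :
    theta4 τ (z + lam * τ + mu) ^ 2 = e (-(lam ^ 2 * τ + 2 * lam * z)) * theta4 τ z ^ 2 := by
  rw [theta4_eq, theta4_eq, show z + lam * τ + mu + 1 / 2 = z + 1 / 2 + lam * (τ : ℂ) + mu by ring,
    jacobiTheta₂_elliptic, mul_pow, ← e_nat_mul]
  rw [show ((2 : ℕ) : ℂ) * -(lam ^ 2 * τ / 2 + lam * (z + 1 / 2)) =
    -(lam ^ 2 * τ + 2 * lam * z) + ((-lam : ℤ) : ℂ) by push_cast; ring, e_add, e_int, mul_one]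

/-- Shared by θ₂ (m = 0) and θ₁ (m = 1): the factor y^{1/2} and the shifted argument produce signs
(-1)^μ and (-1)^{λm}, which squaring removes. -/
lemma e_half_sq_elliptic (lam mu : ℤ) (τ z w : ℂ) (hw : ∃ m : ℤ, w = z + τ / 2 + m / 2) :
    e ((z + lam * τ + mu) / 2) ^ 2 * e (-(lam ^ 2 * τ / 2 + lam * w)) ^ 2 =
      e (-(lam ^ 2 * τ + 2 * lam * z)) * e (z / 2) ^ 2 := by
  obtain ⟨m, rfl⟩ := hw
  rw [← e_nat_mul, ← e_nat_mul, ← e_nat_mul, ← e_add, ← e_add, ← mul_one (e (_ + _ * (z / 2))),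
    ← e_int (mu - lam * m), ← e_add]
  congr 1; push_cast; ring

lemma theta2_sq_elliptic (lam mu : ℤ) (τ : ℍ) (z : ℂ) :
    theta2 τ (z + lam * τ + mu) ^ 2 = e (-(lam ^ 2 * τ + 2 * lam * z)) * theta2 τ z ^ 2 := by
  rw [theta2_eq, theta2_eq,
    show z + lam * τ + mu + τ / 2 = z + τ / 2 + lam * (τ : ℂ) + mu by ring, jacobiTheta₂_elliptic]
  linear_combination e (τ / 8) ^ 2 * jacobiTheta₂ (z + τ / 2) τ ^ 2 *
    e_half_sq_elliptic lam mu τ z (z + τ / 2) ⟨0, by push_cast; ring⟩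

lemma theta1_sq_elliptic (lam mu : ℤ) (τ : ℍ) (z : ℂ) :
    theta1 τ (z + lam * τ + mu) ^ 2 = e (-(lam ^ 2 * τ + 2 * lam * z)) * theta1 τ z ^ 2 := by
  rw [theta1_eq, theta1_eq,
    show z + lam * τ + mu + τ / 2 + 1 / 2 = z + τ / 2 + 1 / 2 + lam * (τ : ℂ) + mu by ring,
    jacobiTheta₂_elliptic]
  linear_combination I ^ 2 * e (τ / 8) ^ 2 * jacobiTheta₂ (z + τ / 2 + 1 / 2) τ ^ 2 *
    e_half_sq_elliptic lam mu τ z (z + τ / 2 + 1 / 2) ⟨1, by push_cast; ring⟩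

lemma phi01_elliptic (lam mu : ℤ) (τ : ℍ) (z : ℂ) :
    phi01 τ z = e (lam ^ 2 * τ + 2 * lam * z) * phi01 τ (z + lam * τ + mu) := by
  simp only [phi01, div_pow, theta2_sq_elliptic, theta3_sq_elliptic, theta4_sq_elliptic, e_neg]
  have := e_ne_zero (lam ^ 2 * τ + 2 * lam * z)
  generalize e (lam ^ 2 * τ + 2 * lam * z) = E at *
  field_simp

lemma phi21_elliptic (lam mu : ℤ) (τ : ℍ) (z : ℂ) :
    phi21 τ z = e (lam ^ 2 * τ + 2 * lam * z) * phi21 τ (z + lam * τ + mu) := by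
  simp only [phi21, theta1_sq_elliptic, e_neg]
  have := e_ne_zero (lam ^ 2 * τ + 2 * lam * z)
  generalize e (lam ^ 2 * τ + 2 * lam * z) = E at *
  field_simp

/-! ### Holomorphy in both variables -/

lemma differentiableOn_jacobiTheta₂ {L : ℂ × ℂ → ℂ} (hL : Differentiable ℂ L) :
    DifferentiableOn ℂ (fun p : ℂ × ℂ => jacobiTheta₂ (L p) p.1) {p | 0 < p.1.im} := fun p hp =>
  ((hasFDerivAt_jacobiTheta₂ (L p) hp).differentiableAt.comp (f := fun p : ℂ × ℂ => (L p, p.1)) p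
    (by fun_prop)).differentiableWithinAt

lemma differentiable_e : Differentiable ℂ e := by
  unfold e; fun_prop

lemma differentiableOn_theta3 {L : ℂ × ℂ → ℂ} (hL : Differentiable ℂ L) :
    DifferentiableOn ℂ (fun p : ℂ × ℂ => theta3 (ofComplex p.1) (L p)) {p | 0 < p.1.im} :=
  (differentiableOn_jacobiTheta₂ hL).congr fun p hp => by
    rw [theta3_eq, ofComplex_apply_of_im_pos hp]

lemma differentiableOn_theta4 {L : ℂ × ℂ → ℂ} (hL : Differentiable ℂ L) :
    DifferentiableOn ℂ (fun p : ℂ × ℂ => theta4 (ofComplex p.1) (L p)) {p | 0 < p.1.im} :=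
  (differentiableOn_jacobiTheta₂ (L := fun p => L p + 1 / 2) (by fun_prop)).congr fun p hp => by
    rw [theta4_eq, ofComplex_apply_of_im_pos hp]

lemma differentiableOn_theta2 {L : ℂ × ℂ → ℂ} (hL : Differentiable ℂ L) :
    DifferentiableOn ℂ (fun p : ℂ × ℂ => theta2 (ofComplex p.1) (L p)) {p | 0 < p.1.im} := by
  have he := differentiable_e
  refine DifferentiableOn.congr (f := fun p : ℂ × ℂ =>
    e (p.1 / 8) * e (L p / 2) * jacobiTheta₂ (L p + p.1 / 2) p.1) ?_ fun p hp => by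
      rw [theta2_eq, ofComplex_apply_of_im_pos hp]
  exact (Differentiable.differentiableOn (by fun_prop)).mul
    (differentiableOn_jacobiTheta₂ (L := fun p => L p + p.1 / 2) (by fun_prop))

lemma differentiableOn_theta1 {L : ℂ × ℂ → ℂ} (hL : Differentiable ℂ L) :
    DifferentiableOn ℂ (fun p : ℂ × ℂ => theta1 (ofComplex p.1) (L p)) {p | 0 < p.1.im} := by
  have he := differentiable_e
  refine DifferentiableOn.congr (f := fun p : ℂ × ℂ =>
    -I * e (p.1 / 8) * e (L p / 2) * jacobiTheta₂ (L p + p.1 / 2 + 1 / 2) p.1) ?_ fun p hp => by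
      rw [theta1_eq, ofComplex_apply_of_im_pos hp]
  exact (Differentiable.differentiableOn (by fun_prop)).mul
    (differentiableOn_jacobiTheta₂ (L := fun p => L p + p.1 / 2 + 1 / 2) (by fun_prop))

lemma differentiableOn_fun_div {E : Type*} [NormedAddCommGroup E] [NormedSpace ℂ E] {f g : E → ℂ}
    {s : Set E} (hf : DifferentiableOn ℂ f s) (hg : DifferentiableOn ℂ g s)
    (hg0 : ∀ x ∈ s, g x ≠ 0) : DifferentiableOn ℂ (fun x => f x / g x) s := by
  simp only [div_eq_mul_inv]
  exact hf.fun_mul (hg.fun_inv hg0)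

lemma differentiableOn_phi01 :
    DifferentiableOn ℂ (fun p : ℂ × ℂ => phi01 (ofComplex p.1) p.2) {p | 0 < p.1.im} := by
  have hz : Differentiable ℂ fun p : ℂ × ℂ => p.2 := by fun_prop
  have h0 : Differentiable ℂ fun _ : ℂ × ℂ => (0 : ℂ) := by fun_prop
  exact (((differentiableOn_fun_div (differentiableOn_theta2 hz) (differentiableOn_theta2 h0)
    fun p _ => theta2_zero_ne _).fun_pow 2).fun_add
    ((differentiableOn_fun_div (differentiableOn_theta3 hz) (differentiableOn_theta3 h0)
    fun p _ => theta3_zero_ne _).fun_pow 2) |>.fun_add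
    ((differentiableOn_fun_div (differentiableOn_theta4 hz) (differentiableOn_theta4 h0)
    fun p _ => theta4_zero_ne _).fun_pow 2)).const_mul 4

lemma differentiableOn_etaAt {k : ℕ} (hk : 0 < k) :
    DifferentiableOn ℂ (fun w : ℂ => etaAt k (ofComplex w)) {w | 0 < w.im} := by
  refine DifferentiableOn.congr (f := fun w : ℂ => ModularForm.eta (k * w)) ?_ fun w hw => by
    rw [etaAt, ofComplex_apply_of_im_pos hw]
  intro w hw
  exact ((ModularForm.differentiableAt_eta_of_mem_upperHalfPlaneSet
    (natCast_mul_im_pos hk hw)).comp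
    (f := fun w : ℂ => (k : ℂ) * w) w (by fun_prop)).differentiableWithinAt

lemma differentiableOn_phi21 :
    DifferentiableOn ℂ (fun p : ℂ × ℂ => phi21 (ofComplex p.1) p.2) {p | 0 < p.1.im} := by
  have hz : Differentiable ℂ fun p : ℂ × ℂ => p.2 := by fun_prop
  have hη : DifferentiableOn ℂ (fun p : ℂ × ℂ => etaAt 1 (ofComplex p.1)) {p | 0 < p.1.im} :=
    (differentiableOn_etaAt one_pos).comp (f := Prod.fst) (by fun_prop) fun p hp => hp
  exact (differentiableOn_fun_div ((differentiableOn_theta1 hz).fun_pow 2) (hη.fun_pow 6)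
    fun p _ => pow_ne_zero _ (etaAt_ne_zero one_pos _)).fun_neg

/-! ### Fourier expansions -/

section Fourier

open Filter Topology

lemma HasWeakFourierExpansion.add {M : ℕ} {φ ψ : ℍ → ℂ → ℂ} (hφ : HasWeakFourierExpansion M φ)
    (hψ : HasWeakFourierExpansion M ψ) : HasWeakFourierExpansion M fun τ z => φ τ z + ψ τ z := by
  obtain ⟨c, hc⟩ := hφ
  obtain ⟨d, hd⟩ := hψ
  refine ⟨fun p => c p + d p, fun τ z => ?_⟩
  simpa only [add_mul] using (hc τ z).add (hd τ z)

lemma HasWeakFourierExpansion.const_mul {M : ℕ} {φ : ℍ → ℂ → ℂ} (a : ℂ)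
    (hφ : HasWeakFourierExpansion M φ) : HasWeakFourierExpansion M fun τ z => a * φ τ z := by
  obtain ⟨c, hc⟩ := hφ
  refine ⟨fun p => a * c p, fun τ z => ?_⟩
  simpa only [mul_assoc] using (hc τ z).mul_left a

lemma hasSum_mul_fiberwise {α β : Type*} {f g : α → ℂ} {a b : ℂ} (hf : HasSum f a)
    (hg : HasSum g b) (s : α × α → β) :
    HasSum (fun p => ∑' x : s ⁻¹' {p}, f x.1.1 * g x.1.2) (a * b) :=
  (hf.mul hg (summable_mul_of_summable_norm hf.summable.norm hg.summable.norm)).tsum_fiberwise s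

lemma fourier_term_mul (M : ℕ) (a b : ℂ) (τ : ℍ) (z : ℂ) (x y : ℕ × ℤ) :
    a * b * (e ((x + y).1 * τ / M) * e ((x + y).2 * z)) =
      a * e (x.1 * τ / M) * e (x.2 * z) * (b * e (y.1 * τ / M) * e (y.2 * z)) := by
  simp only [Prod.fst_add, Prod.snd_add]
  push_cast
  rw [show ((x.1 : ℂ) + y.1) * τ / M = x.1 * τ / M + y.1 * τ / M by ring, add_mul, e_add, e_add]
  ring

/-- Since ℓ runs over ℤ, infinitely many pairs of indices add up to a given (n, ℓ), and a
coefficient of the product is itself an infinite sum. The exponential is constant on such a fibre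
and can be taken out. -/
lemma HasWeakFourierExpansion.mul {M : ℕ} {φ ψ : ℍ → ℂ → ℂ} (hφ : HasWeakFourierExpansion M φ)
    (hψ : HasWeakFourierExpansion M ψ) : HasWeakFourierExpansion M fun τ z => φ τ z * ψ τ z := by
  obtain ⟨c, hc⟩ := hφ
  obtain ⟨d, hd⟩ := hψ
  let s : (ℕ × ℤ) × (ℕ × ℤ) → ℕ × ℤ := fun x => x.1 + x.2
  refine ⟨fun p => ∑' x : s ⁻¹' {p}, c x.1.1 * d x.1.2, fun τ z => ?_⟩
  refine (hasSum_mul_fiberwise (hc τ z) (hd τ z) s).congr_fun fun p => ?_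
  rw [mul_assoc, ← tsum_mul_right]
  refine tsum_congr fun x => ?_
  have hx : x.1.1 + x.1.2 = p := x.2
  have h := fourier_term_mul M (c x.1.1) (d x.1.2) τ z x.1.1 x.1.2
  rw [hx] at h
  exact h

lemma HasWeakFourierExpansion.mul_level {M : ℕ} {φ : ℍ → ℂ → ℂ}
    (hφ : HasWeakFourierExpansion M φ) {k : ℕ} (hk : 0 < k) :
    HasWeakFourierExpansion (M * k) φ := by
  obtain ⟨c, hc⟩ := hφ
  let i : ℕ × ℤ → ℕ × ℤ := fun p => (k * p.1, p.2)
  have hi : Function.Injective i := by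
    rintro ⟨a, b⟩ ⟨a', b'⟩ h
    simp only [i, Prod.mk.injEq] at h
    exact Prod.ext (Nat.eq_of_mul_eq_mul_left hk h.1) h.2
  refine ⟨Function.extend i c 0, fun τ z => ?_⟩
  rw [← hi.hasSum_iff]
  · refine (hc τ z).congr_fun fun p => ?_
    simp only [Function.comp, hi.extend_apply, i]
    have hk' : (k : ℂ) ≠ 0 := by exact_mod_cast hk.ne'
    push_cast
    rw [show (k : ℂ) * p.1 * τ / (M * k) = p.1 * τ / M by field_simp]
  · intro p hp
    rw [Function.extend_apply' _ _ _ (by simpa using hp)]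
    simp

/-- Averaging the expansions at τ and τ + 1 cancels the odd powers of q^{1/2}. -/
lemma HasWeakFourierExpansion.of_T_invariant {φ : ℍ → ℂ → ℂ} (hφ : HasWeakFourierExpansion 2 φ)
    (hT : ∀ τ z, φ (ModularGroup.T • τ) z = φ τ z) : HasWeakFourierExpansion 1 φ := by
  obtain ⟨c, hc⟩ := hφ
  let i : ℕ × ℤ → ℕ × ℤ := fun p => (2 * p.1, p.2)
  have hi : Function.Injective i := by
    rintro ⟨a, b⟩ ⟨a', b'⟩ h
    simp only [i, Prod.mk.injEq] at h
    exact Prod.ext (by omega) h.2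
  refine ⟨fun p => c (i p), fun τ z => ?_⟩
  have h1 := hc (ModularGroup.T • τ) z
  rw [hT, coe_T_smul] at h1
  have h2 := ((hc τ z).add h1).div_const 2
  rw [add_self_div_two] at h2
  rw [← hi.hasSum_iff] at h2
  · refine h2.congr_fun fun p => ?_
    simp only [Function.comp, i]
    push_cast
    rw [show 2 * (p.1 : ℂ) * (τ + 1) / 2 = p.1 * τ / 1 + ((p.1 : ℤ) : ℂ) by push_cast; ring, e_add,
      e_int, show 2 * (p.1 : ℂ) * τ / 2 = p.1 * τ / 1 by ring]
    ring
  · rintro ⟨n, l⟩ hp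
    have hn : ¬ Even n := fun ⟨m, hm⟩ => hp ⟨(m, l), by simp [i]; omega⟩
    obtain ⟨m, rfl⟩ := Nat.not_even_iff_odd.1 hn
    have : e (((2 * m + 1 : ℕ) : ℂ) * (τ + 1) / (2 : ℕ)) =
        -e (((2 * m + 1 : ℕ) : ℂ) * τ / (2 : ℕ)) := by
      rw [show ((2 * m + 1 : ℕ) : ℂ) * (τ + 1) / (2 : ℕ) =
        ((2 * m + 1 : ℕ) : ℂ) * τ / (2 : ℕ) + ((m : ℤ) : ℂ) + 1 / 2 by push_cast; ring, e_add, e_add,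
        e_int, e_half]
      ring
    simp only [this]
    ring

lemma hasWeakFourierExpansion_of_hasSum {M : ℕ} {φ : ℍ → ℂ → ℂ} {ι : Type*} {i : ι → ℕ × ℤ}
    (hi : Function.Injective i) (c : ι → ℂ)
    (h : ∀ (τ : ℍ) (z : ℂ), HasSum (fun j => c j * e ((i j).1 * τ / M) * e ((i j).2 * z)) (φ τ z)) :
    HasWeakFourierExpansion M φ := by
  refine ⟨Function.extend i c 0, fun τ z => ?_⟩
  rw [← hi.hasSum_iff]
  · refine (h τ z).congr_fun fun p => ?_
    simp only [Function.comp, hi.extend_apply]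
  · intro p hp
    rw [Function.extend_apply' _ _ _ (by simpa using hp)]
    simp

lemma hasWeakFourierExpansion_e (M : ℕ) (l : ℤ) :
    HasWeakFourierExpansion M fun _ z => e (l * z) := by
  refine hasWeakFourierExpansion_of_hasSum (i := fun _ : Unit => (0, l))
    (Function.injective_of_subsingleton _) (fun _ => 1) fun τ z => ?_
  simp [e_zero]

/-- A one-periodic up to scaling, holomorphic function on `ℍ` that is bounded at `i∞` has an
expansion in powers of `q^{1/M}`. -/
lemma hasWeakFourierExpansion_of_bounded {M : ℕ} (hM : 0 < M) {f : ℍ → ℂ}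
    (hf : DifferentiableOn ℂ (fun w : ℂ => f (ofComplex w)) {w | 0 < w.im})
    (hper : ∀ τ τ' : ℍ, (τ' : ℂ) = τ + M → f τ' = f τ) (hb : IsBoundedAtImInfty f) :
    HasWeakFourierExpansion M fun τ _ => f τ := by
  have hM' : (0 : ℝ) < M := by exact_mod_cast hM
  have hP : Function.Periodic (f ∘ ofComplex) ((M : ℝ) : ℂ) := by
    intro w
    by_cases hw : 0 < w.im
    · have hw' : 0 < (w + ((M : ℝ) : ℂ)).im := by simpa using hw
      simp only [Function.comp, ofComplex_apply_of_im_pos hw, ofComplex_apply_of_im_pos hw']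
      exact hper _ _ (by simp)
    · have hw' : (w + ((M : ℝ) : ℂ)).im ≤ 0 := by simpa using hw
      simp only [Function.comp, ofComplex_apply_of_im_nonpos (not_lt.1 hw),
        ofComplex_apply_of_im_nonpos hw']
  have hsum := hasSum_qExpansion hM' hP (mdifferentiable_iff.2 hf) hb
  refine hasWeakFourierExpansion_of_hasSum (i := fun n : ℕ => (n, (0 : ℤ)))
    (fun a b h => by simpa using h) (fun n => (qExpansion M f).coeff n) fun τ z => ?_
  refine (hsum τ).congr_fun fun n => ?_
  have : Function.Periodic.qParam (M : ℝ) τ ^ n = e (n * τ / M) := by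
    rw [Function.Periodic.qParam, e, ← Complex.exp_nat_mul]; congr 1; push_cast; ring
  rw [smul_eq_mul, this]
  simp [e_zero]

/-- For Im τ ≥ 1 the series is dominated by its value at τ = i, and only the terms with `k i = 0`
survive in the limit. -/
lemma tendsto_tsum_atImInfty {ι : Type*} (u : ι → ℂ) (k : ι → ℕ)
    (hs : ∀ τ : ℍ, Summable fun i => u i * e (k i * τ / 2)) :
    Tendsto (fun τ : ℍ => ∑' i, u i * e (k i * τ / 2)) atImInfty
      (𝓝 (∑' i, if k i = 0 then u i else 0)) := by
  refine tendsto_tsum_of_dominated_convergence (hs UpperHalfPlane.I).norm (fun i => ?_) ?_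
  · split_ifs with h
    · simp [h, e_zero]
    · rw [← mul_zero (u i)]
      refine Tendsto.const_mul _ ?_
      rw [tendsto_zero_iff_norm_tendsto_zero]
      have hk : (0 : ℝ) < k i := by exact_mod_cast Nat.pos_of_ne_zero h
      have h1 : ∀ τ : ℍ, ‖e (k i * τ / 2)‖ = Real.exp (-((π * k i) * τ.im)) := fun τ => by
        rw [norm_e]; congr 1
        have : ((k i : ℂ) * τ / 2).im = k i * τ.im / 2 := by simp
        rw [this]; ring
      simp only [h1]
      exact Real.tendsto_exp_neg_atTop_nhds_zero.comp
        (tendsto_comap.const_mul_atTop (by positivity))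
  · filter_upwards [(atImInfty_mem _).2 ⟨1, fun τ hτ => hτ⟩] with τ (hτ : 1 ≤ τ.im) i
    rw [norm_mul, norm_mul]
    gcongr
    rw [norm_e, norm_e, Real.exp_le_exp]
    have h1 : ∀ τ : ℍ, ((k i : ℂ) * τ / 2).im = k i * τ.im / 2 := fun τ => by simp
    rw [h1, h1, UpperHalfPlane.I_im]
    have : (k i : ℝ) * 1 ≤ k i * τ.im := by gcongr
    nlinarith [Real.pi_pos]

lemma isBounded_inv_of_tendsto {f : ℍ → ℂ} {a : ℂ} (ha : a ≠ 0) (hf : Tendsto f atImInfty (𝓝 a)) :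
    IsBoundedAtImInfty fun τ => (f τ)⁻¹ :=
  (hf.inv₀ ha).isBigO_one ℝ

lemma hasSum_jacobiTheta₂_e (τ : ℍ) (z : ℂ) :
    HasSum (fun n : ℤ => e ((n.natAbs ^ 2 : ℕ) * τ / 2) * e (n * z)) (jacobiTheta₂ z τ) := by
  refine (hasSum_jacobiTheta₂_term z τ.im_pos).congr_fun fun n => ?_
  rw [← e_add, jacobiTheta₂_term, e]
  congr 1
  have : ((n.natAbs ^ 2 : ℕ) : ℂ) = (n : ℂ) ^ 2 := by
    rw [← Int.cast_natCast]
    push_cast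
    rw [← Int.cast_pow, sq_abs, Int.cast_pow]
  rw [this]; ring

lemma hasSum_jacobiTheta₂_shift (τ : ℍ) (z : ℂ) :
    HasSum (fun n : ℤ => e ((n * (n + 1)).toNat * τ / 2) * e (n * z))
      (jacobiTheta₂ (z + τ / 2) τ) := by
  refine (hasSum_jacobiTheta₂_term (z + τ / 2) τ.im_pos).congr_fun fun n => ?_
  rw [← e_add, jacobiTheta₂_term, e]
  congr 1
  have h0 : 0 ≤ n * (n + 1) := by
    rcases le_or_gt 0 n with h | h
    · positivity
    · nlinarith
  have : (((n * (n + 1)).toNat : ℕ) : ℂ) = (n : ℂ) * (n + 1) := by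
    exact_mod_cast congrArg (Int.cast : ℤ → ℂ) (Int.toNat_of_nonneg h0)
  rw [this]; ring

lemma hasWeakFourierExpansion_jacobiTheta₂ (a : ℂ) :
    HasWeakFourierExpansion 2 fun τ z => jacobiTheta₂ (z + a) τ := by
  refine hasWeakFourierExpansion_of_hasSum (i := fun n : ℤ => (n.natAbs ^ 2, n))
    (fun a b h => (Prod.mk.inj h).2) (fun n => e (n * a)) fun τ z => ?_
  refine (hasSum_jacobiTheta₂_e τ (z + a)).congr_fun fun n => ?_
  rw [mul_add, e_add]; push_cast; ring

lemma hasWeakFourierExpansion_jacobiTheta₂_shift (a : ℂ) :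
    HasWeakFourierExpansion 1 fun τ z => jacobiTheta₂ (z + τ / 2 + a) τ := by
  refine hasWeakFourierExpansion_of_hasSum (i := fun n : ℤ => ((n * (n + 1)).toNat / 2, n))
    (fun a b h => (Prod.mk.inj h).2) (fun n => e (n * a)) fun τ z => ?_
  have := hasSum_jacobiTheta₂_shift τ (z + a)
  rw [show z + a + (τ : ℂ) / 2 = z + τ / 2 + a by ring] at this
  refine this.congr_fun fun n => ?_
  have h2 : (((n * (n + 1)).toNat / 2 : ℕ) : ℂ) = (n * (n + 1)).toNat / 2 := by
    obtain ⟨m, hm⟩ := Int.even_mul_succ_self n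
    have : 2 ∣ (n * (n + 1)).toNat := ⟨m.toNat, by omega⟩
    rw [Nat.cast_div this (by norm_num)]; simp
  rw [mul_add (n : ℂ), e_add]
  simp only [h2]
  push_cast
  rw [show ((n * (n + 1)).toNat : ℂ) / 2 * τ / 1 = (n * (n + 1)).toNat * τ / 2 by ring]
  ring

lemma differentiableOn_jacobiTheta₂_one {L : ℂ → ℂ} (hL : Differentiable ℂ L) :
    DifferentiableOn ℂ (fun w : ℂ => jacobiTheta₂ (L w) (ofComplex w)) {w | 0 < w.im} := by
  refine DifferentiableOn.congr (f := fun w => jacobiTheta₂ (L w) w) ?_ fun w hw => by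
    rw [ofComplex_apply_of_im_pos hw]
  exact (differentiableOn_jacobiTheta₂ (L := fun p => L p.1) (by fun_prop)).comp
    (f := fun w : ℂ => (w, (0 : ℂ))) (by fun_prop) fun w hw => hw

/-- The inverse of a theta constant is treated analytically: no zeros, period two and a nonzero
limit at i∞ make the inverse holomorphic, periodic and bounded. -/
lemma hasWeakFourierExpansion_inv_theta {f : ℍ → ℂ} {L : ℂ → ℂ} (hL : Differentiable ℂ L)
    (hf : ∀ τ : ℍ, f τ = jacobiTheta₂ (L τ) τ) (hf0 : ∀ τ, f τ ≠ 0)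
    (hper : ∀ τ : ℂ, jacobiTheta₂ (L (τ + 2)) (τ + 2) = jacobiTheta₂ (L τ) τ)
    {a : ℂ} (ha : a ≠ 0) (hlim : Tendsto f atImInfty (𝓝 a)) :
    HasWeakFourierExpansion 2 fun τ _ => (f τ)⁻¹ := by
  refine hasWeakFourierExpansion_of_bounded two_pos (f := fun τ => (f τ)⁻¹) ?_ ?_
    (isBounded_inv_of_tendsto ha hlim)
  · refine DifferentiableOn.fun_inv ?_ fun w _ => hf0 _
    refine (differentiableOn_jacobiTheta₂_one hL).congr fun w hw => ?_
    rw [hf, ofComplex_apply_of_im_pos hw]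
  · intro τ τ' h
    have h' : (τ' : ℂ) = τ + 2 := by simpa using h
    rw [hf, hf, h', hper]

lemma hasWeakFourierExpansion_inv_theta3 :
    HasWeakFourierExpansion 2 fun τ _ => (theta3 τ 0)⁻¹ := by
  refine hasWeakFourierExpansion_inv_theta (L := fun _ => 0) (by fun_prop)
    (fun τ => theta3_eq τ 0) theta3_zero_ne (fun τ => jacobiTheta₂_add_right _ _) one_ne_zero ?_
  have hs : ∀ τ : ℍ, HasSum (fun n : ℤ => (1 : ℂ) * e ((n.natAbs ^ 2 : ℕ) * τ / 2)) (theta3 τ 0) :=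
    fun τ => by
      rw [theta3_eq]
      refine (hasSum_jacobiTheta₂_e τ 0).congr_fun fun n => ?_
      simp [e_zero]
  have h := tendsto_tsum_atImInfty (fun _ : ℤ => (1 : ℂ)) (fun n => n.natAbs ^ 2)
    fun τ => (hs τ).summable
  rw [tsum_eq_single 0 (fun n hn => by simp [hn])] at h
  simpa only [fun τ => (hs τ).tsum_eq, Int.natAbs_zero, zero_pow two_ne_zero, if_true] using h

lemma hasWeakFourierExpansion_inv_theta4 :
    HasWeakFourierExpansion 2 fun τ _ => (theta4 τ 0)⁻¹ := by
  refine hasWeakFourierExpansion_inv_theta (L := fun _ => 0 + 1 / 2) (by fun_prop)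
    (fun τ => theta4_eq τ 0) theta4_zero_ne (fun τ => jacobiTheta₂_add_right _ _) one_ne_zero ?_
  have hs : ∀ τ : ℍ, HasSum (fun n : ℤ => e (n * (0 + 1 / 2)) * e ((n.natAbs ^ 2 : ℕ) * τ / 2))
      (theta4 τ 0) := fun τ => by
    rw [theta4_eq]
    refine (hasSum_jacobiTheta₂_e τ (0 + 1 / 2)).congr_fun fun n => ?_
    rw [mul_comm]
  have h := tendsto_tsum_atImInfty (fun n : ℤ => e (n * (0 + 1 / 2))) (fun n => n.natAbs ^ 2)
    fun τ => (hs τ).summable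
  rw [tsum_eq_single 0 (fun n hn => by simp [hn])] at h
  simpa only [fun τ => (hs τ).tsum_eq, Int.natAbs_zero, zero_pow two_ne_zero, if_true,
    Int.cast_zero, zero_mul, e_zero] using h

lemma jacobiTheta₂_half_ne_zero (τ : ℍ) : jacobiTheta₂ (τ / 2) τ ≠ 0 := by
  have := theta2_zero_ne τ
  rw [theta2_eq, zero_add] at this
  exact right_ne_zero_of_mul this

/-- This is θ₂(τ, 0) without its factor q^{1/8}, which cancels in θ₂(τ, z)/θ₂(τ, 0). The terms n = 0
and n = -1 both survive at i∞, so the limit is 2. -/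
lemma hasWeakFourierExpansion_inv_jacobiTheta₂_half :
    HasWeakFourierExpansion 2 fun τ _ => (jacobiTheta₂ (τ / 2) τ)⁻¹ := by
  refine hasWeakFourierExpansion_inv_theta (L := fun w => w / 2) (by fun_prop)
    (fun τ => rfl) jacobiTheta₂_half_ne_zero (fun τ => ?_) (two_ne_zero : (2 : ℂ) ≠ 0) ?_
  · rw [jacobiTheta₂_add_right, add_div, div_self two_ne_zero, jacobiTheta₂_add_left]
  have hs : ∀ τ : ℍ, HasSum (fun n : ℤ => (1 : ℂ) * e ((n * (n + 1)).toNat * τ / 2))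
      (jacobiTheta₂ (τ / 2) τ) := fun τ => by
    have := hasSum_jacobiTheta₂_shift τ 0
    rw [zero_add] at this
    refine this.congr_fun fun n => ?_
    simp [e_zero]
  have h := tendsto_tsum_atImInfty (fun _ : ℤ => (1 : ℂ)) (fun n => (n * (n + 1)).toNat)
    fun τ => (hs τ).summable
  rw [tsum_eq_sum (s := {0, -1}) (fun n hn => by
    simp only [Finset.mem_insert, Finset.mem_singleton, not_or] at hn
    rw [if_neg]
    intro h0
    have h1 : n * (n + 1) ≤ 0 := by omega
    rcases lt_or_gt_of_ne hn.1 with h2 | h2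
    · have : n < -1 := by omega
      nlinarith
    · nlinarith)] at h
  have h2 : (∑ b ∈ ({0, -1} : Finset ℤ), if (b * (b + 1)).toNat = 0 then (1 : ℂ) else 0) = 2 := by
    rw [Finset.sum_pair (by norm_num)]; norm_num
  rw [h2] at h
  simpa only [fun τ => (hs τ).tsum_eq] using h

lemma tendsto_tprod_eta_q :
    Tendsto (fun τ : ℍ => ∏' n, (1 - ModularForm.eta_q n τ)) atImInfty (𝓝 1) := by
  have hc : ContinuousAt (fun q : ℂ => ∏' n : ℕ, (1 - q ^ (n + 1))) 0 :=
    (ModularForm.differentiableOn_tprod_one_sub_pow.differentiableAt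
      (Metric.ball_mem_nhds 0 one_pos)).continuousAt
  have h := hc.tendsto.comp (qParam_tendsto_atImInfty one_pos)
  simp only [ne_eq, Nat.add_eq_zero_iff, one_ne_zero, and_false, not_false_eq_true, zero_pow,
    sub_zero, tprod_one] at h
  exact h

lemma eta_eq (τ : ℂ) :
    ModularForm.eta τ = e (τ / 24) * ∏' n, (1 - ModularForm.eta_q n τ) := by
  rw [ModularForm.eta, Function.Periodic.qParam, e]
  congr 2; push_cast; ring

lemma hasWeakFourierExpansion_inv_eta :
    HasWeakFourierExpansion 1 fun τ _ => e (τ / 24) / etaAt 1 τ := by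
  have hq : ∀ τ : ℍ, e (τ / 24) / etaAt 1 τ = (∏' n, (1 - ModularForm.eta_q n τ))⁻¹ := fun τ => by
    have := e_ne_zero (τ / 24)
    rw [etaAt, Nat.cast_one, one_mul, eta_eq, div_mul_eq_div_div, div_self this, one_div]
  refine hasWeakFourierExpansion_of_bounded one_pos (f := fun τ : ℍ => e (τ / 24) / etaAt 1 τ)
    ?_ ?_ ?_
  · refine differentiableOn_fun_div ?_ (differentiableOn_etaAt one_pos)
      fun w _ => etaAt_ne_zero one_pos _
    have := differentiable_e
    refine DifferentiableOn.congr (f := fun w => e (w / 24)) (by fun_prop) fun w hw => by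
      rw [ofComplex_apply_of_im_pos hw]
  · intro τ τ' h
    rw [etaAt, etaAt, h, Nat.cast_one, one_mul, one_mul, eta_add_one, add_div, e_add, mul_comm,
      mul_div_mul_left _ _ (e_ne_zero _)]
  · simp only [hq]
    exact isBounded_inv_of_tendsto one_ne_zero tendsto_tprod_eta_q

/-- The summands with θ₃ and θ₄ involve q^{1/2}; invariance under T shows that the odd powers
cancel. -/
theorem phi01_hasWeakFourierExpansion : HasWeakFourierExpansion 1 phi01 := by
  refine HasWeakFourierExpansion.of_T_invariant ?_ fun τ z => ?_
  · have h3 := (hasWeakFourierExpansion_jacobiTheta₂ 0).mul hasWeakFourierExpansion_inv_theta3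
    have h4 := (hasWeakFourierExpansion_jacobiTheta₂ (1 / 2)).mul hasWeakFourierExpansion_inv_theta4
    have h2 := ((hasWeakFourierExpansion_jacobiTheta₂_shift 0).mul_level two_pos).mul
      hasWeakFourierExpansion_inv_jacobiTheta₂_half
    have := ((((hasWeakFourierExpansion_e 2 1).mul (h2.mul h2)).add (h3.mul h3)).add
      (h4.mul h4)).const_mul 4
    convert! this using 1
    funext τ z
    rw [phi01, theta2_eq, theta2_eq, theta3_eq τ z, theta4_eq τ z]
    have e1 : e (1 * z) = e (z / 2) ^ 2 := by
      rw [← e_nat_mul]; congr 1; push_cast; ring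
    have e0 := e_ne_zero (τ / 8)
    simp only [zero_div, zero_add, e_zero, add_zero, Int.cast_one, e1]
    have := jacobiTheta₂_half_ne_zero τ
    field_simp
  · have := congrFun (congrFun (phi01_slash ModularGroup.T) τ) z
    rw [jacobiSlash_eq, jfac_T] at this
    simpa [ModularGroup.T, e_zero] using this

/-- The factor q^{1/4} of θ₁² cancels against the one of η⁶, and (y^{1/2})² is an integral power of
y. -/
theorem phi21_hasWeakFourierExpansion : HasWeakFourierExpansion 1 phi21 := by
  have h1 := hasWeakFourierExpansion_jacobiTheta₂_shift (1 / 2)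
  have h2 := hasWeakFourierExpansion_inv_eta
  have h3 := h2.mul (h2.mul h2)
  have := ((hasWeakFourierExpansion_e 1 1).mul (h1.mul h1)).mul (h3.mul h3)
  convert! this using 1
  funext τ z
  rw [phi21, theta1_eq]
  have e1 : e (1 * z) = e (z / 2) ^ 2 := by
    rw [← e_nat_mul]; congr 1; push_cast; ring
  have e2 : e (τ / 8) = e (τ / 24) ^ 3 := by
    rw [← e_nat_mul]; congr 1; push_cast; ring
  have := etaAt_ne_zero one_pos τ
  simp only [Int.cast_one, e1, e2]
  generalize jacobiTheta₂ (z + τ / 2 + 1 / 2) τ = A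
  field_simp
  linear_combination (-e (τ / 24) ^ 6 * e (z / 2) ^ 2 * A ^ 2) * I_sq

end Fourier

/-! ### The multiplier system of the eta function -/

section EtaMultiplier

open scoped NumberTheorySymbols

lemma sqrt_mul_of_arg {x y : ℂ} (hx : x ≠ 0) (hy : y ≠ 0)
    (h : x.arg + y.arg ∈ Set.Ioc (-π) π) :
    Complex.sqrt (x * y) = Complex.sqrt x * Complex.sqrt y := by
  rw [sqrt_eq_exp hx, sqrt_eq_exp hy, sqrt_eq_exp (mul_ne_zero hx hy), Complex.log_mul hx hy h,
    ← Complex.exp_add]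
  congr 1; ring

lemma arg_bounds {x : ℂ} (hx : 0 < x.re) : -(π / 2) < x.arg ∧ x.arg < π / 2 :=
  abs_lt.1 (Complex.abs_arg_lt_pi_div_two_iff.2 (Or.inl hx))

lemma ne_zero_of_re_pos {x : ℂ} (hx : 0 < x.re) : x ≠ 0 := by
  rintro rfl; simp at hx

/-- The arguments of two numbers with positive real part add up to less than π in absolute value.
This is the reason for writing the law of η with √(-i(cτ+d)), whose radicand lies in the right half
plane when c > 0. -/
lemma sqrt_mul_of_re_pos {x y : ℂ} (hx : 0 < x.re) (hy : 0 < y.re) :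
    Complex.sqrt (x * y) = Complex.sqrt x * Complex.sqrt y := by
  have h1 := arg_bounds hx
  have h2 := arg_bounds hy
  exact sqrt_mul_of_arg (ne_zero_of_re_pos hx) (ne_zero_of_re_pos hy)
    ⟨by linarith [h1.1, h2.1], by linarith [h1.2, h2.2]⟩

lemma sqrt_I_eq : Complex.sqrt I = e (1 / 8) := by
  rw [sqrt_eq_exp I_ne_zero, Complex.log_I, e]; congr 1; ring

lemma sqrt_neg_I_eq : Complex.sqrt (-I) = e (-(1 / 8)) := by
  rw [sqrt_eq_exp (neg_ne_zero.2 I_ne_zero), Complex.log_neg_I, e]; congr 1; ring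

lemma sqrt_I_mul {x : ℂ} (hx : 0 < x.re) :
    Complex.sqrt (I * x) = e (1 / 8) * Complex.sqrt x := by
  have h1 := arg_bounds hx
  rw [sqrt_mul_of_arg I_ne_zero (ne_zero_of_re_pos hx), sqrt_I_eq]
  rw [Complex.arg_I]
  have := Real.pi_pos
  constructor <;> linarith [h1.1, h1.2]

lemma sqrt_neg_I_mul {x : ℂ} (hx : 0 < x.re) :
    Complex.sqrt (-I * x) = e (-(1 / 8)) * Complex.sqrt x := by
  have h1 := arg_bounds hx
  rw [sqrt_mul_of_arg (neg_ne_zero.2 I_ne_zero) (ne_zero_of_re_pos hx), sqrt_neg_I_eq]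
  rw [Complex.arg_neg_I]
  have := Real.pi_pos
  constructor <;> linarith [h1.1, h1.2]

lemma neg_I_mul_re (x : ℂ) : (-I * x).re = x.im := by simp

lemma eta_S_sqrt {τ : ℂ} (hτ : 0 < τ.im) :
    ModularForm.eta (-1 / τ) = Complex.sqrt (-I * τ) * ModularForm.eta τ := by
  have h : Complex.sqrt τ = e (1 / 8) * Complex.sqrt (-I * τ) := by
    rw [← sqrt_I_mul (by rwa [neg_I_mul_re])]
    congr 1
    linear_combination τ * I_sq
  rw [eta_S hτ, h, sqrt_I_eq]
  have := e_ne_zero (1 / 8)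
  field_simp

lemma eta_add_nat (τ : ℂ) (m : ℕ) :
    ModularForm.eta (τ + m) = e (m / 24) * ModularForm.eta τ := by
  induction m with
  | zero => simp [e_zero]
  | succ m ih =>
    push_cast
    rw [← add_assoc, eta_add_one, ih, add_div, e_add]; ring

lemma eta_add_int (τ : ℂ) (m : ℤ) :
    ModularForm.eta (τ + m) = e (m / 24) * ModularForm.eta τ := by
  obtain ⟨n, rfl | rfl⟩ := m.eq_nat_or_neg
  · rw [Int.cast_natCast]; exact eta_add_nat τ n
  · have h := eta_add_nat (τ - n) n
    rw [sub_add_cancel] at h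
    push_cast
    rw [← sub_eq_add_neg, h, neg_div, e_neg, inv_mul_cancel_left₀ (e_ne_zero _)]

/-- The `x`-th power of the standard primitive 24-th root of unity. -/
noncomputable def zeta24 (x : ℤ) : ℂ := e (x / 24)

lemma zeta24_add (x y : ℤ) : zeta24 (x + y) = zeta24 x * zeta24 y := by
  rw [zeta24, zeta24, zeta24, ← e_add]; congr 1; push_cast; ring

lemma zeta24_congr {x y : ℤ} (h : (24 : ℤ) ∣ x - y) : zeta24 x = zeta24 y := by
  obtain ⟨k, hk⟩ := h
  have : (x : ℂ) / 24 = y / 24 + (k : ℤ) := by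
    have : (x : ℂ) - y = 24 * k := by exact_mod_cast hk
    linear_combination this / 24
  rw [zeta24, this, e_add, e_int, mul_one, zeta24]

lemma zeta24_three : zeta24 3 = e (1 / 8) := by
  rw [zeta24]; congr 1; norm_num

lemma zeta24_neg_three : zeta24 (-3) = e (-(1 / 8)) := by
  rw [zeta24]; congr 1; norm_num

lemma neg_one_pow_eq_zeta24 (n : ℕ) : (-1 : ℂ) ^ n = zeta24 (12 * n) := by
  rw [← e_half, ← e_nat_mul, zeta24]; congr 1; push_cast; ring

/-- The transformation law of `η` with multiplier `v`, for the matrix `(a b; c d)`. -/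
def EtaLaw (a b c d : ℤ) (v : ℂ) : Prop :=
  ∀ τ : ℂ, 0 < τ.im → ModularForm.eta ((a * τ + b) / (c * τ + d)) =
    v * Complex.sqrt (-I * (c * τ + d)) * ModularForm.eta τ

lemma ne_zero_of_im_pos {τ : ℂ} (hτ : 0 < τ.im) : τ ≠ 0 := by
  rintro rfl; simp at hτ

lemma intCast_mul_add_im (c d : ℤ) (τ : ℂ) : ((c : ℂ) * τ + d).im = c * τ.im := by
  simp

lemma neg_one_div_im_pos {τ : ℂ} (hτ : 0 < τ.im) : 0 < (-1 / τ).im := by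
  rw [neg_div, one_div, Complex.neg_im, Complex.inv_im, neg_div, neg_neg]
  exact div_pos hτ (Complex.normSq_pos.2 (ne_zero_of_im_pos hτ))

lemma intCast_mul_add_ne_zero {c d : ℤ} (hc : 0 < c) {τ : ℂ} (hτ : 0 < τ.im) :
    (c : ℂ) * τ + d ≠ 0 := by
  apply ne_zero_of_im_pos
  rw [intCast_mul_add_im]
  have : (0 : ℝ) < c := by exact_mod_cast hc
  positivity

lemma EtaLaw.add_mul {a b c d : ℤ} {v : ℂ} (h : EtaLaw a b c d v) (m : ℤ) :
    EtaLaw a (b + m * a) c (d + m * c) (v * zeta24 m) := by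
  intro τ hτ
  have h1 := h (τ + m) (by simpa using hτ)
  rw [eta_add_int] at h1
  have e1 : (a : ℂ) * (τ + m) + b = a * τ + (b + m * a : ℤ) := by push_cast; ring
  have e2 : (c : ℂ) * (τ + m) + d = c * τ + (d + m * c : ℤ) := by push_cast; ring
  rw [e1, e2] at h1
  rw [h1, zeta24]; ring

/-- Composition with S on the right; `d > 0` keeps the new lower left entry positive. The root of
unity comes from (-i(c·Sτ + d))(-iτ) = -i · (-i(dτ - c)). -/
lemma EtaLaw.mul_S {a b c d : ℤ} {v : ℂ} (h : EtaLaw a b c d v) (hc : 0 < c) (hd : 0 < d) :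
    EtaLaw b (-a) d (-c) (v * zeta24 (-3)) := by
  intro τ hτ
  have hτ0 := ne_zero_of_im_pos hτ
  have hτ' := neg_one_div_im_pos hτ
  have hc' : (0 : ℝ) < c := by exact_mod_cast hc
  have hd' : (0 : ℝ) < d := by exact_mod_cast hd
  have h1 := h _ hτ'
  rw [eta_S_sqrt hτ] at h1
  have hn := intCast_mul_add_ne_zero (d := d) hc hτ'
  have hn2 := intCast_mul_add_ne_zero (d := -c) hd hτ
  have e1 : ((a : ℂ) * (-1 / τ) + b) / (c * (-1 / τ) + d) = (b * τ + (-a : ℤ)) / (d * τ + (-c : ℤ)) := by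
    rw [div_eq_div_iff hn hn2]; push_cast; field_simp; ring
  have e2 : Complex.sqrt (-I * (c * (-1 / τ) + d)) * Complex.sqrt (-I * τ) =
      zeta24 (-3) * Complex.sqrt (-I * (d * τ + (-c : ℤ))) := by
    rw [zeta24_neg_three, ← sqrt_mul_of_re_pos, ← sqrt_neg_I_mul]
    · congr 1; push_cast; field_simp; ring
    · rw [neg_I_mul_re, intCast_mul_add_im]; positivity
    · rw [neg_I_mul_re, intCast_mul_add_im]; positivity
    · rwa [neg_I_mul_re]
  rw [e1] at h1
  rw [h1]
  linear_combination v * ModularForm.eta τ * e2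

/-- For `d < 0` the resulting matrix is negated to make its lower left entry positive, which
replaces the factor -i under the root by i. -/
lemma EtaLaw.mul_S_inv {a b c d : ℤ} {v : ℂ} (h : EtaLaw a b c d v) (hc : 0 < c) (hd : d < 0) :
    EtaLaw (-b) a (-d) c (v * zeta24 3) := by
  intro τ hτ
  have hτ0 := ne_zero_of_im_pos hτ
  have hτ' := neg_one_div_im_pos hτ
  have hc' : (0 : ℝ) < c := by exact_mod_cast hc
  have hd' : (0 : ℝ) < (-d : ℤ) := by exact_mod_cast (neg_pos.2 hd)
  have h1 := h _ hτ'
  rw [eta_S_sqrt hτ] at h1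
  have hn := intCast_mul_add_ne_zero (d := d) hc hτ'
  have hn2 := intCast_mul_add_ne_zero (d := c) (neg_pos.2 hd) hτ
  have e1 : ((a : ℂ) * (-1 / τ) + b) / (c * (-1 / τ) + d) = ((-b : ℤ) * τ + a) / ((-d : ℤ) * τ + c) := by
    rw [div_eq_div_iff hn hn2]; push_cast; field_simp; ring
  have e2 : Complex.sqrt (-I * (c * (-1 / τ) + d)) * Complex.sqrt (-I * τ) =
      zeta24 3 * Complex.sqrt (-I * ((-d : ℤ) * τ + c)) := by
    rw [zeta24_three, ← sqrt_mul_of_re_pos, ← sqrt_I_mul]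
    · congr 1; push_cast; field_simp; ring
    · rw [neg_I_mul_re, intCast_mul_add_im]; positivity
    · rw [neg_I_mul_re, intCast_mul_add_im]; positivity
    · rwa [neg_I_mul_re]
  rw [e1] at h1
  rw [h1]
  linear_combination v * ModularForm.eta τ * e2

/-- This makes `etaExp` behave correctly modulo 24 when τ is translated by an integer. -/
lemma dvd_odd_cube_sub {c : ℤ} (hc : Odd c) : (24 : ℤ) ∣ c * (c ^ 2 - 1) := by
  obtain ⟨k, rfl⟩ := hc
  have h : (2 * k + 1) * ((2 * k + 1) ^ 2 - 1) = 4 * (k * (k + 1) * (2 * k + 1)) := by ring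
  have h6 : ∀ x : ZMod 6, x * (x + 1) * (2 * x + 1) = 0 := by decide
  have : ((6 : ℕ) : ℤ) ∣ k * (k + 1) * (2 * k + 1) := by
    rw [← ZMod.intCast_zmod_eq_zero_iff_dvd]
    push_cast
    exact h6 k
  obtain ⟨m, hm⟩ := this
  exact ⟨m, by rw [h, hm]; push_cast; ring⟩

lemma jacobiSym_neg_eq {a : ℤ} {c k : ℕ} (hc : c = 2 * k + 1) :
    J(-a | c) = (-1) ^ k * J(a | c) := by
  rw [jacobiSym.neg _ ⟨k, hc⟩, ZMod.χ₄_eq_neg_one_pow (by omega), show c / 2 = k by omega]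

/-- The exponent of the eta multiplier for odd `c`. -/
def etaExp (a b c d : ℤ) : ℤ := (a + d) * c - b * d * (c ^ 2 - 1) - 3 * c + 3

/-- Euclidean descent on c. A power of T replaces d by an odd number between -c and c, and S then
trades c for |d|. The Jacobi symbols are matched by quadratic reciprocity, whose signs are 24th
roots of unity with exponents divisible by 12. For c = 1 the matrix is a translation, S, and a
translation. -/
theorem etaLaw_of_odd (c : ℕ) (hc : Odd c) : ∀ a b d : ℤ, a * d - b * c = 1 →
    EtaLaw a b c d ((J(d | c) : ℤ) * zeta24 (etaExp a b c d)) := by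
  induction c using Nat.strong_induction_on with
  | _ c ih =>
  intro a b d hdet
  rcases Nat.lt_or_ge 1 c with hc1 | hc1
  · have hco := hc
    obtain ⟨k, hk⟩ := hc
    have hcpos : (0 : ℤ) < c := by omega
    have hkc : (c : ℤ) = 2 * k + 1 := by omega
    have key : ∀ b d : ℤ, a * d - b * c = 1 → Odd d → d < c → -(c : ℤ) < d →
        EtaLaw a b c d ((J(d | c) : ℤ) * zeta24 (etaExp a b c d)) := by
      intro b d hdet hd h1 h2
      rcases lt_trichotomy d 0 with h0 | h0 | h0
      · obtain ⟨n, rfl⟩ : ∃ n : ℕ, d = -n := ⟨d.natAbs, by omega⟩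
        have hn : Odd n := by
          rw [Int.odd_iff] at hd
          rw [Nat.odd_iff]; omega
        have h := ih n (by omega) hn (-b) a c (by linear_combination hdet)
        have h' := h.mul_S (by omega) hcpos
        simp only [neg_neg] at h'
        convert! h' using 1
        obtain ⟨l, hl⟩ := hn
        have hln : (n : ℤ) = 2 * l + 1 := by omega
        have hr : J((n : ℤ) | c) = (-1) ^ (n / 2 * (c / 2)) * J((c : ℤ) | n) :=
          jacobiSym.quadratic_reciprocity ⟨l, hl⟩ hco
        rw [jacobiSym_neg_eq hk, hr, show n / 2 = l by omega, show c / 2 = k by omega]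
        push_cast
        rw [neg_one_pow_eq_zeta24, neg_one_pow_eq_zeta24]
        have : zeta24 (12 * k) * zeta24 (12 * (l * k : ℕ)) * zeta24 (etaExp a b c (-n)) =
            zeta24 (etaExp (-b) a n c) * zeta24 (-3) := by
          rw [← zeta24_add, ← zeta24_add, ← zeta24_add]
          congr 1
          simp only [etaExp]
          push_cast
          linear_combination -(c : ℤ) * n * hdet - 3 * ((n : ℤ) + 1) * hkc - 6 * (k : ℤ) * hln
        linear_combination (J((c : ℤ) | n) : ℂ) * this
      · subst h0; simp at hd
      · obtain ⟨n, rfl⟩ : ∃ n : ℕ, d = n := ⟨d.natAbs, by omega⟩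
        have hn : Odd n := by exact_mod_cast hd
        have h := ih n (by omega) hn b (-a) (-c) (by linear_combination hdet)
        have h' := h.mul_S_inv (by omega) (by omega)
        simp only [neg_neg] at h'
        convert! h' using 1
        obtain ⟨l, hl⟩ := hn
        have hln : (n : ℤ) = 2 * l + 1 := by omega
        have hr : J((n : ℤ) | c) = (-1) ^ (n / 2 * (c / 2)) * J((c : ℤ) | n) :=
          jacobiSym.quadratic_reciprocity ⟨l, hl⟩ hco
        rw [jacobiSym_neg_eq hl, hr, show n / 2 = l by omega, show c / 2 = k by omega]
        push_cast
        rw [neg_one_pow_eq_zeta24, neg_one_pow_eq_zeta24]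
        have : zeta24 (12 * (l * k : ℕ)) * zeta24 (etaExp a b c n) =
            zeta24 (12 * l) * zeta24 (etaExp b (-a) n (-c)) * zeta24 3 := by
          rw [← zeta24_add, ← zeta24_add, ← zeta24_add]
          refine zeta24_congr ⟨(l * k : ℤ), ?_⟩
          simp only [etaExp]
          push_cast
          linear_combination (c : ℤ) * n * hdet + 3 * ((n : ℤ) - 1) * hkc
            + 6 * ((k : ℤ) + 1) * hln
        linear_combination (J((c : ℤ) | n) : ℂ) * this
    -- The representative is the residue of d modulo c if that is odd, and otherwise the residue
    -- minus c, which is odd because c is. It differs from -c since c > 1 is coprime to d.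
    obtain ⟨m, hm1, hm2, hm3⟩ : ∃ m : ℤ, Odd (d + m * c) ∧ d + m * c < c ∧
        -(c : ℤ) < d + m * c := by
      have h1 := Int.emod_nonneg d hcpos.ne'
      have h2 := Int.emod_lt_of_pos d hcpos
      have h3 := Int.emod_add_mul_ediv d c
      rcases Int.even_or_odd (d % c) with h | h
      · refine ⟨-(d / c) - 1, ?_⟩
        have : d + (-(d / c) - 1) * c = d % c - c := by linear_combination -h3
        rw [this]
        exact ⟨h.sub_odd (by exact_mod_cast hco), by omega, by
          have : d % c ≠ 0 := by
            intro h0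
            have hd : (c : ℤ) ∣ 1 := by
              rw [← hdet]
              exact dvd_sub (Dvd.dvd.mul_left (Int.dvd_of_emod_eq_zero h0) a) (dvd_mul_left _ _)
            have := Int.le_of_dvd one_pos hd
            omega
          omega⟩
      · refine ⟨-(d / c), ?_⟩
        have : d + (-(d / c)) * c = d % c := by linear_combination -h3
        rw [this]
        exact ⟨h, h2, by omega⟩
    have h := (key (b + m * a) (d + m * c) (by linear_combination hdet) hm1 hm2 hm3).add_mul (-m)
    rw [show b + m * a + -m * a = b by ring, show d + m * c + -m * c = d by ring] at h
    convert! h using 1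
    have hJ : J(d + m * c | c) = J(d | c) := by
      rw [jacobiSym.mod_left (d + m * c), Int.add_mul_emod_self_right, ← jacobiSym.mod_left]
    rw [hJ, mul_assoc, ← zeta24_add]
    congr 1
    apply zeta24_congr
    obtain ⟨r, hr⟩ := dvd_odd_cube_sub (c := (c : ℤ)) (by exact_mod_cast hco)
    refine ⟨m * (2 * b + m * a) * r, ?_⟩
    simp only [etaExp]
    linear_combination m * (2 * b + m * a) * hr + ((c : ℤ) ^ 2 - 1) * m * hdet
  · have : c = 1 := by have := hc.pos; omega
    subst this
    intro τ hτ
    have hb : b = a * d - 1 := by push_cast at hdet; linarith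
    have hn := intCast_mul_add_ne_zero (c := 1) (d := d) one_pos hτ
    have e1 : ((a : ℂ) * τ + b) / (((1 : ℕ) : ℤ) * τ + d) = -1 / (τ + d) + a := by
      rw [hb]; push_cast at hn ⊢; rw [one_mul] at hn ⊢; field_simp; ring
    rw [e1, eta_add_int, eta_S_sqrt (by simpa using hτ), eta_add_int, jacobiSym.one_right,
      etaExp, show (a + d) * ((1 : ℕ) : ℤ) - b * d * (((1 : ℕ) : ℤ) ^ 2 - 1) - 3 * ((1 : ℕ) : ℤ) + 3
        = a + d by push_cast; ring, zeta24_add, zeta24, zeta24]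
    push_cast
    rw [one_mul, one_mul]
    ring

/-- The multiplier of the eta function for `c > 0` and odd `d > 0`. -/
theorem etaLaw_of_pos {a b : ℤ} {c d : ℕ} (hc : 0 < c) (hd : Odd d) (hdet : a * d - b * c = 1) :
    EtaLaw a b c d ((J((c : ℤ) | d) : ℤ) *
      zeta24 (a * c - 2 * c * d - b * d * c ^ 2 + b * d + 3 * d)) := by
  -- The entry c may be even, but d is odd, so the law is taken for the matrix with lower row (d,
  -- -c) and moved by S.
  have h := etaLaw_of_odd d hd b (-a) (-c) (by linear_combination hdet)
  have h' := h.mul_S_inv (by exact_mod_cast hd.pos) (by omega)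
  simp only [neg_neg] at h'
  convert! h' using 1
  obtain ⟨l, hl⟩ := hd
  have hl' : (d : ℤ) = 2 * l + 1 := by omega
  rw [jacobiSym_neg_eq hl]
  push_cast
  rw [neg_one_pow_eq_zeta24]
  have : zeta24 (a * c - 2 * c * d - b * d * c ^ 2 + b * d + 3 * d) =
      zeta24 (12 * l) * zeta24 (etaExp b (-a) d (-c)) * zeta24 3 := by
    rw [← zeta24_add, ← zeta24_add]
    congr 1
    simp only [etaExp]
    linear_combination (c : ℤ) * d * hdet + 6 * hl'
  linear_combination (J((c : ℤ) | d) : ℂ) * this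

end EtaMultiplier

/-! ### Eta quotients: the transformation law -/

section EtaQuotients

open scoped NumberTheorySymbols

/-- The eta quotient `∏ η(kw)^r` over the pairs `(k, r)` of a list. -/
noncomputable def etaQuot (l : List (ℕ × ℤ)) (w : ℂ) : ℂ :=
  (l.map fun p => ModularForm.eta (p.1 * w) ^ p.2).prod

/-- The sum of the exponents, twice the weight of the eta quotient. -/
def expSum (l : List (ℕ × ℤ)) : ℤ := (l.map Prod.snd).sum

/-- `∑ r k`, which is `24` times the order of the eta quotient at `∞`. -/
def expOrder (l : List (ℕ × ℤ)) : ℤ := (l.map fun p => p.2 * (p.1 : ℤ)).sum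

/-- `∑ r n / k`, which is `24` times the order of the eta quotient of level `n` at `0`. -/
def expCoOrder (n : ℕ) (l : List (ℕ × ℤ)) : ℤ := (l.map fun p => p.2 * ((n / p.1 : ℕ) : ℤ)).sum

/-- `∏ k ^ |r|`. -/
def expProd (l : List (ℕ × ℤ)) : ℕ := (l.map fun p => p.1 ^ p.2.natAbs).prod

lemma zeta24_zero : zeta24 0 = 1 := by simp [zeta24, e_zero]

lemma zeta24_zpow (x r : ℤ) : zeta24 x ^ r = zeta24 (r * x) := by
  rw [zeta24, ← e_int_mul, zeta24]; congr 1; push_cast; ring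

lemma etaQuot_cons (p : ℕ × ℤ) (l : List (ℕ × ℤ)) (w : ℂ) :
    etaQuot (p :: l) w = ModularForm.eta (p.1 * w) ^ p.2 * etaQuot l w := by simp [etaQuot]

lemma expSum_cons (p : ℕ × ℤ) (l : List (ℕ × ℤ)) : expSum (p :: l) = p.2 + expSum l := by
  simp [expSum]

lemma expOrder_cons (p : ℕ × ℤ) (l : List (ℕ × ℤ)) :
    expOrder (p :: l) = p.2 * p.1 + expOrder l := by simp [expOrder]

lemma expCoOrder_cons (n : ℕ) (p : ℕ × ℤ) (l : List (ℕ × ℤ)) :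
    expCoOrder n (p :: l) = p.2 * ((n / p.1 : ℕ) : ℤ) + expCoOrder n l := by simp [expCoOrder]

lemma expProd_cons (p : ℕ × ℤ) (l : List (ℕ × ℤ)) :
    expProd (p :: l) = p.1 ^ p.2.natAbs * expProd l := by simp [expProd]

lemma etaQuot_add_int (l : List (ℕ × ℤ)) (w : ℂ) (t : ℤ) :
    etaQuot l (w + t) = zeta24 (t * expOrder l) * etaQuot l w := by
  induction l with
  | nil => simp [etaQuot, expOrder, zeta24_zero]
  | cons p l ih =>
    rw [etaQuot_cons, etaQuot_cons, ih, expOrder_cons, mul_add t, zeta24_add]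
    have : (p.1 : ℂ) * (w + t) = p.1 * w + ((p.1 * t : ℤ) : ℂ) := by push_cast; ring
    rw [this, eta_add_int, mul_zpow]
    have h2 : e (((p.1 * t : ℤ) : ℂ) / 24) ^ p.2 = zeta24 (t * (p.2 * p.1)) := by
      rw [← zeta24, zeta24_zpow]; congr 1; ring
    rw [h2]; ring

/-- Applied to Jacobi symbols: only the parity of an exponent matters, so `expProd` can use |r| and
stay a natural number. -/
lemma zpow_eq_pow_natAbs_of_sq_eq_one {x : ℂ} (hx : x ^ 2 = 1) (r : ℤ) : x ^ r = x ^ r.natAbs := by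
  have hinv : x⁻¹ = x := by
    have h0 : x ≠ 0 := by rintro rfl; simp at hx
    field_simp; exact hx.symm
  obtain ⟨n, rfl | rfl⟩ := r.eq_nat_or_neg
  · simp
  · rw [zpow_neg, zpow_natCast, ← inv_pow, hinv, Int.natAbs_neg, Int.natAbs_natCast]

lemma jacobiSym_sq_eq_one {a : ℤ} {d : ℕ} (h : IsCoprime a d) : ((J(a | d) : ℤ) : ℂ) ^ 2 = 1 := by
  have := jacobiSym.sq_one (a := a) (b := d) (Int.isCoprime_iff_gcd_eq_one.1 h)
  exact_mod_cast this

/-- For k ∣ n and γ = (a, b; nm, d) one has kγw = γ'(kw) with γ' = (a, kb; nm/k, d), so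
`etaLaw_of_pos` applies to each factor. As (nm/k | d) = (nm | d)(k | d), the first symbol gets the
exponent `expSum` and the others collect into `expProd`. -/
lemma etaQuot_multiplier {n m d : ℕ} {a b : ℤ} (hm : 0 < m) (hn : 0 < n)
    (hd : Odd d) (hdet : a * d - b * (n * m : ℕ) = 1) (l : List (ℕ × ℤ))
    (hl : ∀ p ∈ l, p.1 ∣ n) {w : ℂ} (hw : 0 < w.im) :
    etaQuot l ((a * w + b) / ((n * m : ℕ) * w + d)) =
      (((J(((n * m : ℕ) : ℤ) | d) : ℤ) : ℂ) * Complex.sqrt (-I * ((n * m : ℕ) * w + d))) ^ expSum l *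
        ((J((expProd l : ℤ) | d) : ℤ) : ℂ) *
        zeta24 (m * (a - 2 * d - b * d * m * n) * expCoOrder n l + b * d * expOrder l
          + 3 * d * expSum l) * etaQuot l w := by
  induction l with
  | nil => simp [etaQuot, expSum, expProd, expCoOrder, expOrder, zeta24_zero]
  | cons p l ih =>
    obtain ⟨k, r⟩ := p
    have ih := ih fun p hp => hl p (List.mem_cons_of_mem _ hp)
    obtain ⟨t, ht⟩ : k ∣ n := hl (k, r) (by simp)
    have hk : 0 < k := Nat.pos_of_ne_zero (by rintro rfl; omega)
    have htp : 0 < t := Nat.pos_of_ne_zero (by rintro rfl; omega)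
    have hdiv : n / k = t := by rw [ht, Nat.mul_div_cancel_left _ hk]
    rw [etaQuot_cons, etaQuot_cons, ih, expSum_cons, expOrder_cons, expCoOrder_cons,
      expProd_cons]
    simp only
    rw [hdiv]
    have hdet' : a * d - (k * b) * (m * t : ℕ) = 1 := by
      rw [← hdet, ht]; push_cast; ring
    have hlaw := etaLaw_of_pos (Nat.mul_pos hm htp) hd hdet' (k * w) (by
      simpa [hk] using hw)
    have hkC : (k : ℂ) ≠ 0 := by exact_mod_cast hk.ne'
    have e1 : ((a : ℂ) * (k * w) + (k * b : ℤ)) / (((m * t : ℕ) : ℤ) * (k * w) + (d : ℤ)) =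
        k * ((a * w + b) / ((n * m : ℕ) * w + d)) := by
      rw [ht]; push_cast; ring
    have e2 : (((m * t : ℕ) : ℤ) : ℂ) * (k * w) + (d : ℤ) = (n * m : ℕ) * w + d := by
      rw [ht]; push_cast; ring
    rw [e1, e2] at hlaw
    have hck : IsCoprime (k : ℤ) d := ⟨-b * t * m, a, by rw [← hdet, ht]; push_cast; ring⟩
    have hJk := jacobiSym_sq_eq_one hck
    have hJ : ((J(((m * t : ℕ) : ℤ) | d) : ℤ) : ℂ) =
        ((J(((n * m : ℕ) : ℤ) | d) : ℤ) : ℂ) * ((J((k : ℤ) | d) : ℤ) : ℂ) := by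
      have : ((n * m : ℕ) : ℤ) = (k : ℤ) * ((m * t : ℕ) : ℤ) := by rw [ht]; push_cast; ring
      rw [this, jacobiSym.mul_left]
      push_cast
      linear_combination (-(J((m * t : ℤ) | d) : ℂ)) * hJk
    have hX : (m * (a - 2 * d - b * d * m * n) * (r * (t : ℤ) + expCoOrder n l)
          + b * d * (r * k + expOrder l) + 3 * d * (r + expSum l) : ℤ) =
        r * (a * ((m * t : ℕ) : ℤ) - 2 * ((m * t : ℕ) : ℤ) * d
          - (k * b) * d * ((m * t : ℕ) : ℤ) ^ 2 + (k * b) * d + 3 * d) +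
        (m * (a - 2 * d - b * d * m * n) * expCoOrder n l + b * d * expOrder l
          + 3 * d * expSum l) := by
      rw [ht]; push_cast; ring
    have hx0 : ((n * m : ℕ) : ℂ) * w + d ≠ 0 := by
      have := intCast_mul_add_ne_zero (c := ((n * m : ℕ) : ℤ)) (d := d)
        (by exact_mod_cast Nat.mul_pos hn hm) hw
      exact_mod_cast this
    have hcn : IsCoprime ((n * m : ℕ) : ℤ) d := ⟨-b, a, by rw [← hdet]; ring⟩
    have hJn : ((J(((n * m : ℕ) : ℤ) | d) : ℤ) : ℂ) ≠ 0 := by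
      intro h0; have := jacobiSym_sq_eq_one hcn; rw [h0] at this; simp at this
    have hS : Complex.sqrt (-I * ((n * m : ℕ) * w + d)) ≠ 0 := by
      intro h0
      have := sqrt_sq (-I * ((n * m : ℕ) * w + d))
      rw [h0] at this
      exact mul_ne_zero (neg_ne_zero.2 I_ne_zero) hx0 (by rw [← this]; simp)
    rw [hX, zeta24_add (r * _), ← zeta24_zpow _ r, zpow_add₀ (mul_ne_zero hJn hS), hlaw, hJ]
    have hprod : ((J(((k ^ r.natAbs * expProd l : ℕ) : ℤ) | d) : ℤ) : ℂ) =
        ((J((k : ℤ) | d) : ℤ) : ℂ) ^ r * ((J((expProd l : ℤ) | d) : ℤ) : ℂ) := by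
      rw [zpow_eq_pow_natAbs_of_sq_eq_one hJk]
      push_cast
      rw [jacobiSym.mul_left, jacobiSym.pow_left]; push_cast; ring
    rw [hprod]
    simp only [mul_zpow]
    ring

/-- The numerical conditions under which an eta quotient transforms under `Γ₀(n)` with weight `2j`
and multiplier `e(cd/(nh))`. -/
structure EtaQuotData (n h : ℕ) (j : ℤ) (l : List (ℕ × ℤ)) : Prop where
  pos : 0 < n
  dvd : ∀ p ∈ l, p.1 ∣ n
  sum : expSum l = 4 * j
  h_dvd : h ∣ n
  h_dvd' : h ∣ 24
  order : (24 : ℤ) ∣ expOrder l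
  coOrder : (24 : ℤ) ∣ expCoOrder n l + (24 / h : ℕ)
  three : 3 ∣ n ∨ (3 : ℤ) ∣ expCoOrder n l
  square : ∃ s, expProd l = s ^ 2

lemma EtaQuotData.add_int {n h : ℕ} {j : ℤ} {l : List (ℕ × ℤ)} (H : EtaQuotData n h j l)
    (w : ℂ) (t : ℤ) : etaQuot l (w + t) = etaQuot l w := by
  rw [etaQuot_add_int, zeta24_congr (y := 0) (by simpa using H.order.mul_left t), zeta24_zero,
    one_mul]

lemma isCoprime_expProd {n : ℕ} {d : ℤ} (hnd : IsCoprime (n : ℤ) d) (l : List (ℕ × ℤ))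
    (hl : ∀ p ∈ l, p.1 ∣ n) : IsCoprime (expProd l : ℤ) d := by
  induction l with
  | nil => simpa [expProd] using isCoprime_one_left
  | cons p l ih =>
    rw [expProd_cons]
    push_cast
    refine IsCoprime.mul_left (IsCoprime.pow_left ?_)
      (ih fun p hp => hl p (List.mem_cons_of_mem _ hp))
    exact hnd.of_isCoprime_of_dvd_left (by exact_mod_cast hl p (by simp))

/-- The factor 8 divides 1 - d² for odd d, and 3 divides it unless 3 ∣ d, in which case x must
supply it. This is the role of the field `three` of `EtaQuotData`: if 3 ∣ n, then d is prime to 3.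
-/
lemma dvd_one_sub_sq {d : ℤ} (hd : Odd d) (x : ℤ) (h : IsCoprime 3 d ∨ (3 : ℤ) ∣ x) :
    (24 : ℤ) ∣ (1 - d ^ 2) * x := by
  have h8 : (8 : ℤ) ∣ 1 - d ^ 2 := by
    obtain ⟨k, rfl⟩ := hd
    obtain ⟨m, hm⟩ := (Int.even_mul_succ_self k)
    exact ⟨-m, by linear_combination -4 * hm⟩
  have h3 : (3 : ℤ) ∣ (1 - d ^ 2) * x := by
    rcases h with h | h
    · have hd3 : ¬ (3 : ℤ) ∣ d := by
        intro h'
        have := h.isUnit_of_dvd' dvd_rfl h'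
        rw [Int.isUnit_iff] at this; omega
      refine Dvd.dvd.mul_right ?_ x
      have : d % 3 = 1 ∨ d % 3 = 2 := by omega
      rcases this with h | h
      · exact ⟨-(d / 3) * (3 * (d / 3) + 2), by
          have := Int.emod_add_mul_ediv d 3
          rw [h] at this
          linear_combination (d + 1 + 3 * (d / 3)) * this⟩
      · exact ⟨-((d / 3) * (3 * (d / 3) + 4) + 1), by
          have := Int.emod_add_mul_ediv d 3
          rw [h] at this
          linear_combination (d + 2 + 3 * (d / 3)) * this⟩
    · exact h.mul_left _
  have : IsCoprime (3 : ℤ) 8 := ⟨3, -1, by norm_num⟩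
  exact this.mul_dvd h3 (h8.mul_right x)

lemma e_congr_int {x y : ℂ} (k : ℤ) (h : x = y + k) : e x = e y := by
  rw [h, e_add, e_int, mul_one]

/-- One Jacobi symbol occurs to a power divisible by 4 and the other has a square on top, so both
disappear. By the determinant, a - 2d - bdmn = a(1 - d²) - d; hence modulo 24 the exponent is 12jd -
md Σ rn/k, and the condition `coOrder` turns it into 12jd + 24md/h. The sign from 12jd cancels the
one from √(-i(cw+d))^{4j}. -/
theorem EtaQuotData.law_of_pos {n h : ℕ} {j : ℤ} {l : List (ℕ × ℤ)} (H : EtaQuotData n h j l)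
    {m d : ℕ} {a b : ℤ} (hm : 0 < m) (hd : Odd d) (hdet : a * d - b * (n * m : ℕ) = 1)
    {w : ℂ} (hw : 0 < w.im) :
    etaQuot l ((a * w + b) / ((n * m : ℕ) * w + d)) =
      e ((n * m : ℕ) * d / (n * h)) * ((n * m : ℕ) * w + d) ^ (2 * j) * etaQuot l w := by
  rw [etaQuot_multiplier hm H.pos hd hdet l H.dvd hw]
  congr 1
  have hcn : IsCoprime ((n * m : ℕ) : ℤ) d := ⟨-b, a, by rw [← hdet]; ring⟩
  have hn : IsCoprime (n : ℤ) d := hcn.of_isCoprime_of_dvd_left ⟨m, by push_cast; ring⟩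
  have hJP : ((J((expProd l : ℤ) | d) : ℤ) : ℂ) = 1 := by
    have hc := isCoprime_expProd hn l H.dvd
    obtain ⟨s, hs⟩ := H.square
    rw [hs] at hc ⊢
    push_cast at hc ⊢
    rw [jacobiSym.pow_left]
    push_cast
    refine jacobiSym_sq_eq_one ?_
    exact (IsCoprime.pow_left_iff (by norm_num)).1 hc
  have hJ4 : (((J(((n * m : ℕ) : ℤ) | d) : ℤ) : ℂ) *
      Complex.sqrt (-I * ((n * m : ℕ) * w + d))) ^ expSum l =
        (-1) ^ j * ((n * m : ℕ) * w + d) ^ (2 * j) := by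
    rw [H.sum, zpow_mul, show (4 : ℤ) = ((4 : ℕ) : ℤ) by rfl, zpow_natCast, zpow_mul,
      show (2 : ℤ) = ((2 : ℕ) : ℤ) by rfl, zpow_natCast, ← mul_zpow]
    congr 1
    have h1 := jacobiSym_sq_eq_one hcn
    have h2 := sqrt_sq (-I * ((n * m : ℕ) * w + d))
    calc _ = (((J(((n * m : ℕ) : ℤ) | d) : ℤ) : ℂ) ^ 2) ^ 2 *
        (Complex.sqrt (-I * ((n * m : ℕ) * w + d)) ^ 2) ^ 2 := by ring
      _ = _ := by rw [h1, h2]; linear_combination (((n * m : ℕ) : ℂ) * w + d) ^ 2 * I_sq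
  obtain ⟨s, hs⟩ := H.h_dvd'
  have hh : 0 < h := Nat.pos_of_ne_zero (by rintro rfl; omega)
  have hs' : 24 / h = s := by rw [hs, Nat.mul_div_cancel_left _ hh]
  have hz : zeta24 (m * (a - 2 * d - b * d * m * n) * expCoOrder n l + b * d * expOrder l
          + 3 * d * expSum l) = (-1) ^ j * e ((n * m : ℕ) * d / (n * h)) := by
    have e1 : (-1 : ℂ) ^ j = zeta24 (j * (12 * d)) := by
      rw [← zeta24_zpow, ← neg_one_pow_eq_zeta24, hd.neg_one_pow]
    have e2 : e ((n * m : ℕ) * d / (n * h)) = zeta24 (m * d * s) := by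
      rw [zeta24]; congr 1
      have hnC : (n : ℂ) ≠ 0 := by exact_mod_cast H.pos.ne'
      have hhC : (h : ℂ) ≠ 0 := by exact_mod_cast hh.ne'
      have hsC : (24 : ℂ) = h * s := by exact_mod_cast hs
      have hsC0 : (s : ℂ) ≠ 0 := by
        rintro h0; rw [h0] at hsC; norm_num at hsC
      push_cast
      rw [hsC]; field_simp
    rw [e1, e2, ← zeta24_add]
    apply zeta24_congr
    have c1 := H.coOrder
    rw [hs'] at c1
    have c2 : (24 : ℤ) ∣ (1 - (d : ℤ) ^ 2) * expCoOrder n l := by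
      refine dvd_one_sub_sq (by exact_mod_cast hd) _ (H.three.imp (fun h3 => ?_) id)
      exact hn.of_isCoprime_of_dvd_left (by exact_mod_cast h3)
    have key : (m * (a - 2 * d - b * d * m * n) * expCoOrder n l + b * d * expOrder l
          + 3 * d * expSum l - (j * (12 * d) + m * d * s) : ℤ) =
        m * a * ((1 - (d : ℤ) ^ 2) * expCoOrder n l) - m * d * (expCoOrder n l + s)
          + b * d * expOrder l := by
      rw [H.sum]
      push_cast at hdet
      linear_combination (m * d * expCoOrder n l : ℤ) * hdet
    rw [key]
    exact dvd_add (dvd_sub (c2.mul_left _) (c1.mul_left _)) (H.order.mul_left _)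
  rw [hJP, hJ4, hz]
  have : ((-1 : ℂ) ^ j) * (-1) ^ j = 1 := by
    rw [← mul_zpow]; norm_num
  linear_combination (e ((n * m : ℕ) * d / (n * h)) * ((n * m : ℕ) * w + d) ^ (2 * j)) * this

lemma exists_shift_odd {c d : ℤ} (hc : 0 < c) (h : Odd c ∨ Odd d) :
    ∃ t : ℤ, 0 < d + t * c ∧ Odd (d + t * c) := by
  have hpos : ∀ t : ℤ, |d| + 1 ≤ t → 0 < d + t * c := fun t ht => by
    have := neg_abs_le d
    nlinarith [abs_nonneg d]
  by_cases ho : Odd (d + (|d| + 1) * c)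
  · exact ⟨_, hpos _ le_rfl, ho⟩
  · by_cases hc' : Odd c
    · refine ⟨|d| + 1 + 1, hpos _ (by omega), ?_⟩
      rw [add_mul (|d| + 1), one_mul, ← add_assoc]
      exact (Int.not_odd_iff_even.1 ho).add_odd hc'
    · exact absurd ((h.resolve_left hc').add_even
        ((Int.not_odd_iff_even.1 hc').mul_left _)) ho

lemma odd_or_odd_of_det {a b c d : ℤ} (hdet : a * d - b * c = 1) : Odd c ∨ Odd d := by
  by_contra! h
  obtain ⟨⟨x, hx⟩, y, hy⟩ := And.intro (Int.not_odd_iff_even.1 h.1) (Int.not_odd_iff_even.1 h.2)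
  have : 2 * (a * y - b * x) = 1 := by rw [← hdet, hx, hy]; ring
  omega

theorem EtaQuotData.law_of_pos' {n h : ℕ} {j : ℤ} {l : List (ℕ × ℤ)} (H : EtaQuotData n h j l)
    {a b c d : ℤ} (hc : 0 < c) (hdet : a * d - b * c = 1) (hn : (n : ℤ) ∣ c)
    {w : ℂ} (hw : 0 < w.im) :
    etaQuot l ((a * w + b) / (c * w + d)) =
      e (c * d / (n * h)) * (c * w + d) ^ (2 * j) * etaQuot l w := by
  obtain ⟨t, ht, hodd⟩ := exists_shift_odd hc (odd_or_odd_of_det hdet)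
  obtain ⟨m, rfl⟩ := hn
  have hn0 : (0 : ℤ) < n := by exact_mod_cast H.pos
  have hm : 0 < m := pos_of_mul_pos_right hc hn0.le
  lift m to ℕ using hm.le
  obtain ⟨D, hD⟩ := Int.eq_ofNat_of_zero_le ht.le
  have hDodd : Odd D := by rw [hD] at hodd; exact_mod_cast hodd
  have hdet' : a * D - (b + t * a) * (n * m : ℕ) = 1 := by
    rw [← hD, ← hdet]; push_cast; ring
  have key := H.law_of_pos (by exact_mod_cast hm) hDodd hdet' (w := w - t) (by simpa using hw)
  have hDC : (D : ℂ) = d + t * (n * m) := by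
    have : (D : ℤ) = d + t * (n * m) := hD.symm
    exact_mod_cast this
  have hs : etaQuot l (w - t) = etaQuot l w := by
    have := H.add_int (w - t) t
    rwa [sub_add_cancel, eq_comm] at this
  have e1 : (a : ℂ) * (w - t) + (b + t * a : ℤ) = a * w + b := by push_cast; ring
  have e2 : ((n * m : ℕ) : ℂ) * (w - t) + D = ((n : ℤ) * (m : ℤ) : ℤ) * w + d := by
    rw [hDC]; push_cast; ring
  rw [hs, e1, e2] at key
  rw [key]
  congr 2
  obtain ⟨u, hu⟩ := H.h_dvd
  -- Replacing d by d + tc changes cd/(nh) by tc²/(nh) = t m² n/h, an integer because h ∣ n.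
  apply e_congr_int (t * u * m ^ 2)
  have hnC : (n : ℂ) ≠ 0 := by exact_mod_cast H.pos.ne'
  have hhC : (h : ℂ) ≠ 0 := by
    rintro h0; apply hnC; rw [hu]; push_cast; rw [h0, zero_mul]
  have huC : (n : ℂ) = h * u := by exact_mod_cast hu
  rw [hDC]
  push_cast
  field_simp
  rw [huC]; ring

theorem EtaQuotData.law {n h : ℕ} {j : ℤ} {l : List (ℕ × ℤ)} (H : EtaQuotData n h j l)
    {a b c d : ℤ} (hdet : a * d - b * c = 1) (hn : (n : ℤ) ∣ c) {w : ℂ} (hw : 0 < w.im) :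
    etaQuot l ((a * w + b) / (c * w + d)) =
      e (c * d / (n * h)) * (c * w + d) ^ (2 * j) * etaQuot l w := by
  rcases lt_trichotomy c 0 with hc | rfl | hc
  · have key := H.law_of_pos' (a := -a) (b := -b) (c := -c) (d := -d) (by omega)
      (by rw [← hdet]; ring) (by simpa using hn) hw
    push_cast at key
    rw [show (-(a : ℂ) * w + -b) = -(a * w + b) by ring,
      show (-(c : ℂ) * w + -d) = -(c * w + d) by ring, neg_div_neg_eq, neg_mul_neg,
      Even.neg_zpow (even_two_mul j)] at key
    exact key
  · rw [mul_zero, sub_zero] at hdet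
    have hs := H.add_int w (b * d)
    have hd2 : (d : ℂ) ^ 2 = 1 := by
      rcases Int.eq_one_or_neg_one_of_mul_eq_one (by rwa [mul_comm] at hdet) with h | h <;>
        simp [h]
    have hd0 : (d : ℂ) ≠ 0 := by rintro h0; rw [h0] at hd2; simp at hd2
    have hadC : (a : ℂ) * d = 1 := by exact_mod_cast hdet
    have e1 : ((a : ℂ) * w + b) / ((0 : ℤ) * w + d) = w + (b * d : ℤ) := by
      push_cast
      rw [zero_mul, zero_add, div_eq_iff hd0]
      linear_combination (-b - w * a : ℂ) * hd2 + w * d * hadC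
    rw [e1, hs]
    have : ((d : ℂ)) ^ (2 * j) = 1 := by
      rw [zpow_mul, show (2 : ℤ) = ((2 : ℕ) : ℤ) by rfl, zpow_natCast, hd2, one_zpow]
    simp [e_zero, this]
  · exact H.law_of_pos' hc hdet hn hw

end EtaQuotients

/-! ### Behaviour at the cusps -/

section Cusps

open Filter Topology

lemma det_eq_int (γ : SL(2, ℤ)) : γ 0 0 * γ 1 1 - γ 0 1 * γ 1 0 = 1 := by
  exact_mod_cast det_eq γ

/-- The point `(Aτ + B) / D` of the upper half plane. -/
noncomputable def affineMap (A D : ℕ) (B : ℤ) (hA : 0 < A) (hD : 0 < D) (τ : ℍ) : ℍ :=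
  ⟨(A * τ + B) / D, by
    have h1 : (((A : ℂ) * τ + B) / D).im = A * τ.im / D := by
      rw [Complex.div_natCast_im]; simp
    have := τ.im_pos
    rw [h1]; positivity⟩

lemma coe_affineMap {A D : ℕ} {B : ℤ} (hA : 0 < A) (hD : 0 < D) (τ : ℍ) :
    ((affineMap A D B hA hD τ : ℍ) : ℂ) = (A * τ + B) / D := rfl

lemma im_affineMap {A D : ℕ} {B : ℤ} (hA : 0 < A) (hD : 0 < D) (τ : ℍ) :
    (affineMap A D B hA hD τ).im = A * τ.im / D := by
  rw [← coe_im, coe_affineMap, Complex.div_natCast_im]; simp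

lemma tendsto_affineMap {A D : ℕ} {B : ℤ} (hA : 0 < A) (hD : 0 < D) :
    Tendsto (affineMap A D B hA hD) atImInfty atImInfty := by
  rw [atImInfty, tendsto_comap_iff]
  have hA' : (0 : ℝ) < A := by exact_mod_cast hA
  have hD' : (0 : ℝ) < D := by exact_mod_cast hD
  have : (UpperHalfPlane.im ∘ affineMap A D B hA hD) = fun τ : ℍ => (A / D : ℝ) * τ.im := by
    funext τ
    rw [Function.comp_apply, im_affineMap]; ring
  rw [this]
  exact tendsto_comap.const_mul_atTop (div_pos hA' hD')

/-- The upper triangular form of `(k 0; 0 1) γ` up to `SL₂(ℤ)` on the left. -/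
theorem exists_upper_triangular (γ : SL(2, ℤ)) {k : ℕ} (hk : 0 < k) :
    ∃ (γ' : SL(2, ℤ)) (D : ℕ) (B : ℤ) (hA : 0 < Int.gcd k (γ 1 0)) (hD : 0 < D),
      Int.gcd k (γ 1 0) * D = k ∧ γ 1 0 = Int.gcd k (γ 1 0) * γ' 1 0 ∧
      ∀ τ : ℍ, (k : ℂ) * (γ • τ : ℍ) = (γ' • affineMap _ D B hA hD τ : ℍ) ∧
        jfac γ' (affineMap _ D B hA hD τ) = jfac γ τ / D := by
  set a := γ 0 0 with ha
  set b := γ 0 1 with hb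
  set c := γ 1 0 with hc
  set d := γ 1 1 with hd
  have hdet : a * d - b * c = 1 := det_eq_int γ
  set A := Int.gcd k c with hAdef
  have hA : 0 < A := Int.gcd_pos_of_ne_zero_left _ (by exact_mod_cast hk.ne')
  obtain ⟨D, hD⟩ : A ∣ k := by exact_mod_cast Int.gcd_dvd_left (k : ℤ) c
  obtain ⟨r, hr⟩ : (A : ℤ) ∣ c := Int.gcd_dvd_right (k : ℤ) c
  have hD0 : 0 < D := Nat.pos_of_ne_zero (by rintro rfl; omega)
  have hDr : IsCoprime (D : ℤ) r := by
    obtain ⟨x, y, hxy⟩ : ∃ x y, (A : ℤ) = k * x + c * y :=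
      ⟨_, _, Int.gcd_eq_gcd_ab k c⟩
    refine ⟨x, y, ?_⟩
    have hA' : (A : ℤ) ≠ 0 := by exact_mod_cast hA.ne'
    apply mul_left_cancel₀ hA'
    rw [mul_one]
    conv_rhs => rw [hxy, hr, hD]
    push_cast; ring
  have har : IsCoprime a r := ⟨d, -b * A, by rw [← hdet, hr]; ring⟩
  -- The first column of (k 0; 0 1)γ is (ka, c) = A(Da, r) with Da and r coprime. Completing (Da, r)
  -- to a matrix γ' of determinant one, γ'⁻¹ brings (ka, kb; c, d) to the form (A, B; 0, D) with B =
  -- skb + q'd.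
  obtain ⟨s, q', hsq⟩ := hDr.mul_left har
  let γ' : SL(2, ℤ) := ⟨!![D * a, -q'; r, s], by rw [Matrix.det_fin_two]; simp; linarith⟩
  refine ⟨γ', D, s * k * b + q' * d, hA, hD0, hD.symm, hr, fun τ => ?_⟩
  have hDC : (D : ℂ) ≠ 0 := by exact_mod_cast hD0.ne'
  have hAC : (A : ℂ) ≠ 0 := by exact_mod_cast hA.ne'
  have hkC : (k : ℂ) = A * D := by rw [hD]; push_cast; ring
  have hcC : (c : ℂ) = A * r := by rw [hr]; push_cast; ring
  have hsqC : (s : ℂ) * (D * a) + q' * r = 1 := by exact_mod_cast hsq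
  have hdetC : (a : ℂ) * d - b * c = 1 := by exact_mod_cast hdet
  have hj : jfac γ' (affineMap A D (s * k * b + q' * d) hA hD0 τ) = jfac γ τ / D := by
    have : jfac γ' (affineMap A D (s * k * b + q' * d) hA hD0 τ) =
      (r : ℂ) * ((A * τ + ((s * k * b + q' * d : ℤ) : ℂ)) / D) + s := rfl
    rw [this]
    have h2 : jfac γ τ = (c : ℂ) * τ + d := rfl
    rw [h2]
    push_cast
    field_simp
    rw [hkC]
    rw [hcC] at hdetC ⊢
    linear_combination (d : ℂ) * hsqC - (s : ℂ) * D * hdetC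
  refine ⟨?_, hj⟩
  rw [coe_smul_eq, coe_smul_eq, hj, coe_affineMap]
  have hj0 := jfac_ne_zero γ τ
  have h3 : ((γ' 0 0 : ℤ) : ℂ) = D * a := by simp [γ']
  have h4 : ((γ' 0 1 : ℤ) : ℂ) = -q' := by simp [γ']
  rw [h3, h4, ← ha, ← hb]
  push_cast
  field_simp
  rw [hkC]
  rw [hcC] at hdetC
  linear_combination (-A * D * b : ℂ) * hsqC - q' * D * hdetC

lemma eta_pow_smul (γ : SL(2, ℤ)) (τ : ℍ) :
    ModularForm.eta (γ • τ : ℍ) ^ 24 = jfac γ τ ^ 12 * ModularForm.eta τ ^ 24 := by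
  have h := congrFun (SlashInvariantForm.slash_action_generators_SL2Z
    ModularForm.discriminant_S_invariant ModularForm.discriminant_T_invariant γ) τ
  rw [ModularForm.SL_slash_apply, ModularGroup.denom_apply] at h
  have hj := jfac_ne_zero γ τ
  change ModularForm.eta (γ • τ : ℍ) ^ 24 * jfac γ τ ^ (-12 : ℤ) = ModularForm.eta τ ^ 24 at h
  rw [← h]
  rw [show (-12 : ℤ) = -((12 : ℕ) : ℤ) by rfl, zpow_neg, zpow_natCast]
  field_simp

lemma tendsto_norm_eta :
    Tendsto (fun τ : ℍ => ‖ModularForm.eta τ‖ ^ 24 * Real.exp (2 * π * τ.im)) atImInfty (𝓝 1) := by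
  have h := (tendsto_tprod_eta_q.norm).pow 24
  rw [norm_one, one_pow] at h
  refine h.congr fun τ => ?_
  rw [eta_eq, norm_mul, mul_pow, norm_e]
  have : (τ / 24 : ℂ).im = τ.im / 24 := by
    rw [show (24 : ℂ) = ((24 : ℕ) : ℂ) by norm_num, Complex.div_natCast_im]; simp
  rw [this, ← Real.exp_nat_mul, mul_assoc, mul_comm, mul_assoc, ← Real.exp_add]
  have : 2 * π * τ.im + ((24 : ℕ) : ℝ) * (-2 * π * (τ.im / 24)) = 0 := by push_cast; ring
  rw [this, Real.exp_zero, mul_one]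

/-- The 24th power of η has no multiplier, and in absolute value it decays like exp(-2π Im τ). At
(Aτ + B)/D with A = gcd(k, c) and AD = k this gives the rate A/D = A²/k. -/
lemma tendsto_norm_eta_smul (γ : SL(2, ℤ)) {k : ℕ} (hk : 0 < k) :
    ∃ C : ℝ, C ≠ 0 ∧ Tendsto (fun τ : ℍ => ‖ModularForm.eta (k * (γ • τ : ℍ))‖ ^ 24 *
      (‖jfac γ τ‖ ^ 12)⁻¹ * Real.exp (2 * π * ((Int.gcd k (γ 1 0) : ℝ) ^ 2 / k) * τ.im))
      atImInfty (𝓝 C) := by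
  obtain ⟨γ', D, B, hA, hD, hAD, -, h⟩ := exists_upper_triangular γ hk
  have hD' : (0 : ℝ) < D := by exact_mod_cast hD
  have hA' : (0 : ℝ) < Int.gcd k (γ 1 0) := by exact_mod_cast hA
  refine ⟨((D : ℝ) ^ 12)⁻¹ * 1, by positivity, ?_⟩
  refine ((tendsto_norm_eta.comp (tendsto_affineMap (B := B) hA hD)).const_mul _).congr fun τ => ?_
  have hj : ‖jfac γ τ‖ ≠ 0 := norm_ne_zero_iff.2 (jfac_ne_zero γ τ)
  rw [Function.comp_apply, (h τ).1, ← norm_pow, ← norm_pow, eta_pow_smul, (h τ).2, norm_mul,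
    im_affineMap]
  rw [norm_pow (jfac γ τ / _), norm_div, Complex.norm_natCast, norm_pow]
  have hkR : (k : ℝ) = Int.gcd k (γ 1 0) * D := by exact_mod_cast hAD.symm
  have he : 2 * π * ((Int.gcd k (γ 1 0) : ℝ) ^ 2 / k) * τ.im =
      2 * π * ((Int.gcd k (γ 1 0) : ℝ) * τ.im / D) := by
    conv_lhs => rw [hkR]
    field_simp
  rw [he]
  field_simp

/-- The order of the eta quotient at the cusp `γ∞`, for `c` the lower left entry of `γ`. -/
noncomputable def cuspOrder (l : List (ℕ × ℤ)) (c : ℤ) : ℝ :=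
  (l.map fun p => (p.2 : ℝ) * ((Int.gcd p.1 c : ℝ) ^ 2 / p.1)).sum

lemma tendsto_norm_etaQuot (γ : SL(2, ℤ)) (l : List (ℕ × ℤ)) (hl : ∀ p ∈ l, 0 < p.1) :
    ∃ C : ℝ, Tendsto (fun τ : ℍ => ‖etaQuot l (γ • τ : ℍ)‖ ^ 24 *
      ((‖jfac γ τ‖ ^ 12)⁻¹) ^ expSum l * Real.exp (2 * π * cuspOrder l (γ 1 0) * τ.im))
      atImInfty (𝓝 C) := by
  induction l with
  | nil => exact ⟨1, by simp [etaQuot, expSum, cuspOrder]⟩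
  | cons p l ih =>
    obtain ⟨C, hC⟩ := ih fun p hp => hl p (List.mem_cons_of_mem _ hp)
    obtain ⟨C', hC0, hC'⟩ := tendsto_norm_eta_smul γ (hl p (by simp))
    refine ⟨C' ^ p.2 * C, ((hC'.zpow₀ p.2 (Or.inl hC0)).mul hC).congr fun τ => ?_⟩
    have hj : ‖jfac γ τ‖ ≠ 0 := norm_ne_zero_iff.2 (jfac_ne_zero γ τ)
    have hj' : (‖jfac γ τ‖ ^ 12)⁻¹ ≠ 0 := inv_ne_zero (pow_ne_zero _ hj)
    rw [etaQuot_cons, expSum_cons, norm_mul, norm_zpow, mul_pow, zpow_add₀ hj', mul_zpow,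
      mul_zpow]
    have hexp : Real.exp (2 * π * cuspOrder (p :: l) (γ 1 0) * τ.im) =
        Real.exp (2 * π * ((Int.gcd p.1 (γ 1 0) : ℝ) ^ 2 / p.1) * τ.im) ^ p.2 *
        Real.exp (2 * π * cuspOrder l (γ 1 0) * τ.im) := by
      rw [← Real.rpow_intCast, ← Real.exp_mul, ← Real.exp_add]
      congr 1
      simp only [cuspOrder, List.map_cons, List.sum_cons]
      ring
    have hcomm : ∀ x : ℝ, (x ^ p.2) ^ 24 = (x ^ 24) ^ p.2 := fun x => by
      rw [← zpow_natCast, ← zpow_natCast, ← zpow_mul, ← zpow_mul, mul_comm]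
    rw [hexp, hcomm]
    ring

/-- The limit in `tendsto_norm_etaQuot` bounds the 24th power of the norm, since the exponential
factor is at least 1 when the order is nonnegative. -/
theorem isBoundedAtImInfty_etaQuot (γ : SL(2, ℤ)) {l : List (ℕ × ℤ)} (hl : ∀ p ∈ l, 0 < p.1)
    {j : ℤ} (hj : expSum l = 4 * j) (ho : 0 ≤ cuspOrder l (γ 1 0)) :
    IsBoundedAtImInfty fun τ : ℍ => (jfac γ τ ^ (2 * j))⁻¹ * etaQuot l (γ • τ : ℍ) := by
  obtain ⟨C, hC⟩ := tendsto_norm_etaQuot γ l hl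
  have hev := hC.eventually (gt_mem_nhds (lt_add_one C))
  rw [IsBoundedAtImInfty, BoundedAtFilter, Asymptotics.isBigO_iff]
  refine ⟨max 1 (C + 1), ?_⟩
  filter_upwards [hev] with τ hτ
  rw [Pi.one_apply, norm_one, mul_one]
  have h24 : ‖(jfac γ τ ^ (2 * j))⁻¹ * etaQuot l (γ • τ : ℍ)‖ ^ 24 ≤ C + 1 := by
    refine le_trans ?_ hτ.le
    have e1 : ((‖jfac γ τ‖ ^ 12)⁻¹) ^ expSum l = (‖jfac γ τ ^ (2 * j)‖⁻¹) ^ 24 := by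
      rw [hj, norm_zpow, ← zpow_natCast, ← zpow_natCast, ← zpow_neg, ← zpow_neg, ← zpow_mul,
        ← zpow_mul]
      congr 1; push_cast; ring
    rw [norm_mul, mul_pow, norm_inv, e1, mul_comm]
    refine le_mul_of_one_le_right (by positivity) (Real.one_le_exp ?_)
    have := τ.im_pos
    have := Real.pi_pos
    positivity
  by_contra! hlt
  have h1 : 1 < ‖(jfac γ τ ^ (2 * j))⁻¹ * etaQuot l (γ • τ : ℍ)‖ := (le_max_left _ _).trans_lt hlt
  have h2 := (le_max_right _ _).trans_lt hlt
  have h3 := le_self_pow₀ h1.le (n := 24) (by norm_num)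
  linarith

/-- For k ∣ n the number gcd(k, c) depends only on gcd(n, c), so the divisors of n cover all cusps.
Multiplication by n clears the denominators and leaves integers to check. -/
lemma cuspOrder_nonneg {n : ℕ} (hn : 0 < n) {l : List (ℕ × ℤ)} (hl : ∀ p ∈ l, p.1 ∣ n)
    (h : ∀ t ∈ n.divisors,
      0 ≤ (l.map fun p => p.2 * (((Nat.gcd p.1 t) ^ 2 * (n / p.1) : ℕ) : ℤ)).sum) (c : ℤ) :
    0 ≤ cuspOrder l c := by
  have h1 := h (Nat.gcd n c.natAbs) (Nat.mem_divisors.2 ⟨Nat.gcd_dvd_left _ _, hn.ne'⟩)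
  have h2 : (n : ℝ) * cuspOrder l c = (((l.map fun p => p.2 *
      (((Nat.gcd p.1 (Nat.gcd n c.natAbs)) ^ 2 * (n / p.1) : ℕ) : ℤ)).sum : ℤ) : ℝ) := by
    clear h h1
    induction l with
    | nil => simp [cuspOrder]
    | cons p l ih =>
      have ih := ih fun p hp => hl p (List.mem_cons_of_mem _ hp)
      simp only [cuspOrder, List.map_cons, List.sum_cons] at ih ⊢
      rw [mul_add, ih, Int.cast_add]
      congr 1
      obtain ⟨t, ht⟩ := hl p (by simp)
      have hp : 0 < p.1 := Nat.pos_of_ne_zero (by rintro h; rw [h] at ht; omega)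
      have hg : Nat.gcd p.1 (Nat.gcd n c.natAbs) = Int.gcd p.1 c := by
        rw [← Nat.gcd_assoc, Nat.gcd_eq_left ⟨t, ht⟩, Int.gcd, Int.natAbs_natCast]
      rw [hg]
      have : n / p.1 = t := by rw [ht, Nat.mul_div_cancel_left _ hp]
      rw [this, ht]
      have : (p.1 : ℝ) ≠ 0 := by exact_mod_cast hp.ne'
      push_cast
      field_simp
  have h3 : (0 : ℝ) ≤ n * cuspOrder l c := by rw [h2]; exact_mod_cast h1
  have hn' : (0 : ℝ) < n := by exact_mod_cast hn
  exact nonneg_of_mul_nonneg_right h3 hn'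

end Cusps

/-! ### Weight two forms with multiplier -/

/-- `f` is a modular form of weight two for `Γ₀(n)` with multiplier `e(cd/(nh))`. -/
structure IsTwistedForm (n h : ℕ) (f : ℍ → ℂ) : Prop where
  holo : DifferentiableOn ℂ (fun w => f (ofComplex w)) {w | 0 < w.im}
  law : ∀ γ ∈ CongruenceSubgroup.Gamma0 n, ∀ τ : ℍ,
    f (γ • τ) = e ((γ 1 0 : ℂ) * (γ 1 1 : ℂ) / (n * h)) * jfac γ τ ^ 2 * f τ
  bdd : ∀ γ : SL(2, ℤ), IsBoundedAtImInfty fun τ => (jfac γ τ ^ 2)⁻¹ * f (γ • τ)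

namespace IsTwistedForm

variable {n h : ℕ} {f g : ℍ → ℂ}

lemma zero : IsTwistedForm n h 0 where
  holo := differentiableOn_const 0
  law := by simp
  bdd γ := by
    simpa using! (Filter.zero_zeroAtFilter atImInfty : Filter.ZeroAtFilter _
      (0 : ℍ → ℂ)).boundedAtFilter

lemma add (hf : IsTwistedForm n h f) (hg : IsTwistedForm n h g) :
    IsTwistedForm n h fun τ => f τ + g τ where
  holo := hf.holo.fun_add hg.holo
  law γ hγ τ := by rw [hf.law γ hγ, hg.law γ hγ]; ring
  bdd γ := by
    simp only [mul_add]
    exact (hf.bdd γ).add (hg.bdd γ)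

lemma const_mul (a : ℂ) (hf : IsTwistedForm n h f) : IsTwistedForm n h fun τ => a * f τ where
  holo := hf.holo.const_mul a
  law γ hγ τ := by rw [hf.law γ hγ]; ring
  bdd γ := by
    have := (hf.bdd γ).const_mul_left a
    refine this.congr_left fun τ => ?_
    ring

lemma congr (hf : IsTwistedForm n h f) (hfg : ∀ τ, g τ = f τ) : IsTwistedForm n h g := by
  rwa [show g = f from funext hfg]

end IsTwistedForm

lemma mem_Gamma0_iff {n : ℕ} {γ : SL(2, ℤ)} :
    γ ∈ CongruenceSubgroup.Gamma0 n ↔ (n : ℤ) ∣ γ 1 0 := by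
  rw [CongruenceSubgroup.Gamma0_mem, ZMod.intCast_zmod_eq_zero_iff_dvd]

lemma differentiableOn_etaQuot {l : List (ℕ × ℤ)} (hl : ∀ p ∈ l, 0 < p.1) :
    DifferentiableOn ℂ (etaQuot l) {w | 0 < w.im} := by
  induction l with
  | nil =>
    have : etaQuot [] = fun _ => 1 := by funext w; simp [etaQuot]
    rw [this]; exact differentiableOn_const 1
  | cons p l ih =>
    have hp := hl p (by simp)
    have : etaQuot (p :: l) = fun w => ModularForm.eta (p.1 * w) ^ p.2 * etaQuot l w :=
      funext (etaQuot_cons p l)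
    rw [this]
    refine DifferentiableOn.fun_mul ?_ (ih fun p hp => hl p (List.mem_cons_of_mem _ hp))
    intro w hw
    have hw' := natCast_mul_im_pos hp hw
    refine DifferentiableAt.differentiableWithinAt ?_
    have hd : DifferentiableAt ℂ (fun w => ModularForm.eta (p.1 * w)) w :=
      (ModularForm.differentiableAt_eta_of_mem_upperHalfPlaneSet hw').comp w
      (differentiableAt_id.const_mul _)
    exact hd.zpow (Or.inl (ModularForm.eta_ne_zero hw'))

theorem EtaQuotData.isTwistedForm {n h : ℕ} {l : List (ℕ × ℤ)} (H : EtaQuotData n h 1 l)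
    (ho : ∀ t ∈ n.divisors,
      0 ≤ (l.map fun p => p.2 * (((Nat.gcd p.1 t) ^ 2 * (n / p.1) : ℕ) : ℤ)).sum) :
    IsTwistedForm n h fun τ => etaQuot l τ := by
  have hl : ∀ p ∈ l, 0 < p.1 := fun p hp => Nat.pos_of_dvd_of_pos (H.dvd p hp) H.pos
  refine ⟨?_, fun γ hγ τ => ?_, fun γ => ?_⟩
  · refine (differentiableOn_etaQuot hl).congr fun w hw => ?_
    rw [ofComplex_apply_of_im_pos hw]
  · have := H.law (det_eq_int γ) (mem_Gamma0_iff.1 hγ) τ.im_pos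
    rw [show (2 * (1 : ℤ)) = ((2 : ℕ) : ℤ) by norm_num, zpow_natCast] at this
    rw [coe_smul_eq]
    exact this
  · have := isBoundedAtImInfty_etaQuot γ hl H.sum (cuspOrder_nonneg H.pos H.dvd ho _)
    rwa [show (2 * (1 : ℤ)) = ((2 : ℕ) : ℤ) by norm_num] at this

/-! ### The forms `Λ_N` -/

open EisensteinSeries in
lemma E2_smul (γ : SL(2, ℤ)) (τ : ℍ) :
    E2 (γ • τ) = jfac γ τ ^ 2 * E2 τ - 6 * I / π * (γ 1 0 : ℂ) * jfac γ τ := by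
  have h := congrFun (E2_slash_action γ) τ
  rw [ModularForm.SL_slash_apply, Pi.sub_apply, Pi.smul_apply, smul_eq_mul, D2,
    ModularGroup.denom_apply, riemannZeta_two] at h
  have hj := jfac_ne_zero γ τ
  change E2 (γ • τ) * jfac γ τ ^ (-2 : ℤ) = E2 τ - _ * (_ / jfac γ τ) at h
  rw [show (-2 : ℤ) = -((2 : ℕ) : ℤ) by rfl, zpow_neg, zpow_natCast, mul_inv_eq_iff_eq_mul₀
    (pow_ne_zero _ hj)] at h
  rw [h]
  have hpi : (π : ℂ) ≠ 0 := by exact_mod_cast Real.pi_ne_zero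
  field_simp

open EisensteinSeries in
lemma Lam_eq {N : ℕ} (hN : 0 < N) (τ τ' : ℍ) (h : (τ' : ℂ) = N * τ) :
    Lam N τ = N / 24 * (N * E2 τ' - E2 τ) := by
  have hpos := natCast_mul_im_pos hN τ.im_pos
  have hd := ModularForm.differentiableAt_eta_of_mem_upperHalfPlaneSet hpos
  have hd1 := ModularForm.differentiableAt_eta_of_mem_upperHalfPlaneSet τ.im_pos
  have hmul : DifferentiableAt ℂ (fun w : ℂ => (N : ℂ) * w) (τ : ℂ) :=
    differentiableAt_id.const_mul _
  have h1 : logDeriv (fun w : ℂ => ModularForm.eta (N * w)) (τ : ℂ) =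
      N * logDeriv ModularForm.eta (N * τ) := by
    have := logDeriv_comp (f := ModularForm.eta) (g := fun w : ℂ => (N : ℂ) * w) (x := (τ : ℂ))
      hd hmul
    rw [Function.comp_def] at this
    rw [this]
    have hder : deriv (fun w : ℂ => (N : ℂ) * w) (τ : ℂ) = N := by
      rw [deriv_const_mul _ differentiableAt_fun_id]; simp
    rw [hder, mul_comm]
  rw [Lam, logDeriv_div (f := fun w : ℂ => ModularForm.eta (N * w)) (τ : ℂ)
    (ModularForm.eta_ne_zero hpos) (ModularForm.eta_ne_zero τ.im_pos) (hd.comp (τ : ℂ) hmul) hd1,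
    h1, ← h, ModularForm.logDeriv_eta_eq_E2, ModularForm.logDeriv_eta_eq_E2]
  have hpi : (π : ℂ) ≠ 0 := by exact_mod_cast Real.pi_ne_zero
  have := I_ne_zero
  field_simp
  ring

open EisensteinSeries in
lemma E2_add_int (τ τ' : ℍ) (m : ℤ) (h : (τ' : ℂ) = τ + m) : E2 τ' = E2 τ := by
  have h2 := E2_smul (ModularGroup.T ^ m) τ
  have hT := ModularGroup.coe_T_zpow m
  have h10 : (ModularGroup.T ^ m) 1 0 = 0 := by rw [hT]; simp
  have h11 : (ModularGroup.T ^ m) 1 1 = 1 := by rw [hT]; simp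
  have h00 : (ModularGroup.T ^ m) 0 0 = 1 := by rw [hT]; simp
  have h01 : (ModularGroup.T ^ m) 0 1 = m := by rw [hT]; simp
  have hj : jfac (ModularGroup.T ^ m) τ = 1 := by rw [jfac, h10, h11]; simp
  have hτ : τ' = ModularGroup.T ^ m • τ := by
    apply UpperHalfPlane.ext
    rw [coe_smul_eq, hj, h00, h01, h]; simp
  rw [hτ, h2, hj, h10]; simp

-- The terms of N E₂(Nγτ) and E₂(γτ) that are linear in cτ + d coincide, because c = gcd(N, c) · c'
-- and gcd(N, c) · D = N. What is left is visibly bounded at i∞.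
open EisensteinSeries in
lemma Lam_smul {N : ℕ} (hN : 0 < N) (γ : SL(2, ℤ)) :
    ∃ (D : ℕ) (B : ℤ) (hA : 0 < Int.gcd N (γ 1 0)) (hD : 0 < D), Int.gcd N (γ 1 0) * D = N ∧
      ∀ τ : ℍ, Lam N (γ • τ) = jfac γ τ ^ 2 *
        (N / 24 * (N / D ^ 2 * E2 (affineMap _ D B hA hD τ) - E2 τ)) := by
  obtain ⟨γ', D, B, hA, hD, hAD, hc, h⟩ := exists_upper_triangular γ hN
  refine ⟨D, B, hA, hD, hAD, fun τ => ?_⟩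
  rw [Lam_eq hN _ _ (h τ).1.symm, E2_smul, E2_smul, (h τ).2]
  have hDC : (D : ℂ) ≠ 0 := by exact_mod_cast hD.ne'
  have hAC : (Int.gcd N (γ 1 0) : ℂ) * D = N := by exact_mod_cast hAD
  have hcC : ((γ 1 0 : ℤ) : ℂ) = Int.gcd N (γ 1 0) * (γ' 1 0 : ℤ) := by exact_mod_cast hc
  have hpi : (π : ℂ) ≠ 0 := by exact_mod_cast Real.pi_ne_zero
  have h1 : (N : ℂ) * (6 * I / π * (γ' 1 0 : ℤ) * (jfac γ τ / D)) =
      6 * I / π * (γ 1 0 : ℤ) * jfac γ τ := by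
    rw [hcC, ← hAC]; field_simp
  rw [mul_sub (N : ℂ), h1]
  field_simp
  ring

lemma e_div_of_dvd {n : ℕ} {c : ℤ} (d : ℤ) (hn : 0 < n) (h : (n : ℤ) ∣ c) :
    e ((c : ℂ) * (d : ℂ) / n) = 1 := by
  obtain ⟨m, rfl⟩ := h
  have hnC : (n : ℂ) ≠ 0 := by exact_mod_cast hn.ne'
  rw [← e_int (m * d)]
  congr 1
  push_cast
  field_simp

-- On Γ₀(n) with N ∣ n one has gcd(N, c) = N and D = 1, so `Lam_smul` returns Λ_N up to an integral
-- translation in E₂. For h = 1 the multiplier e(cd/n) is trivial on Γ₀(n).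
open EisensteinSeries in
theorem isTwistedForm_Lam {n N : ℕ} (hn : 0 < n) (hNn : N ∣ n) : IsTwistedForm n 1 (Lam N) := by
  have hN : 0 < N := Nat.pos_of_dvd_of_pos hNn hn
  refine ⟨?_, fun γ hγ τ => ?_, fun γ => ?_⟩
  · have hE := UpperHalfPlane.mdifferentiable_iff.1 E2_mdifferentiable
    have h1 : DifferentiableOn ℂ (fun w : ℂ => E2 (ofComplex (N * w))) {w | 0 < w.im} :=
      hE.comp (differentiableOn_id.const_mul (N : ℂ)) fun w hw => natCast_mul_im_pos hN hw
    refine (((h1.const_mul (N : ℂ)).fun_sub hE).const_mul (N / 24 : ℂ)).congr fun w hw => ?_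
    rw [Lam_eq hN (ofComplex w) (ofComplex (N * w))]
    · rfl
    · rw [ofComplex_apply_of_im_pos hw, ofComplex_apply_of_im_pos (natCast_mul_im_pos hN hw)]
  · obtain ⟨D, B, hA, hD, hAD, h⟩ := Lam_smul hN γ
    have hdvd := mem_Gamma0_iff.1 hγ
    have hg : Int.gcd N (γ 1 0) = N := by
      refine Nat.dvd_antisymm (by exact_mod_cast Int.gcd_dvd_left (N : ℤ) (γ 1 0)) ?_
      exact Int.dvd_gcd (dvd_refl _) ((Int.natCast_dvd_natCast.2 hNn).trans hdvd)
    have hD1 : D = 1 := by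
      rw [hg] at hAD; exact Nat.eq_of_mul_eq_mul_left hN (by rw [hAD, mul_one])
    subst hD1
    let τ' : ℍ := ⟨N * τ, natCast_mul_im_pos hN τ.im_pos⟩
    rw [h τ, Lam_eq hN τ τ' rfl, E2_add_int τ' _ B (by
      rw [coe_affineMap, hg]; simp [τ'])]
    rw [Nat.cast_one, mul_one, e_div_of_dvd _ hn hdvd]
    simp
  · obtain ⟨D, B, hA, hD, hAD, h⟩ := Lam_smul hN γ
    have hb : IsBoundedAtImInfty fun τ : ℍ =>
        (N / 24 * (N / D ^ 2 * E2 (affineMap _ D B hA hD τ) - E2 τ) : ℂ) := by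
      have h1 := (isBoundedAtImInfty_E2.comp_tendsto
        (tendsto_affineMap (B := B) hA hD)).const_mul_left (N / D ^ 2 : ℂ)
      exact (h1.sub isBoundedAtImInfty_E2).const_mul_left (N / 24 : ℂ)
    refine hb.congr_left fun τ => ?_
    rw [h, inv_mul_cancel_left₀ (pow_ne_zero _ (jfac_ne_zero γ τ))]

/-! ### The Euler product -/

section Euler

open Filter Topology

/-- The Euler product `∏ (1 - x ^ n)`. -/
noncomputable def eulerProd (x : ℂ) : ℂ := ∏' n : ℕ, (1 - x ^ (n + 1))

/-- The odd part `∏ (1 - x ^ (2n+1))` of the Euler product. -/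
noncomputable def eulerOdd (x : ℂ) : ℂ := ∏' n : ℕ, (1 - x ^ (2 * n + 1))

lemma multipliable_eulerOdd {x : ℂ} (hx : ‖x‖ < 1) :
    Multipliable fun n : ℕ => 1 - x ^ (2 * n + 1) := by
  have h : Summable fun n : ℕ => ‖-x ^ (2 * n + 1)‖ := by
    simp only [norm_neg, norm_pow]
    exact (summable_geometric_of_lt_one (norm_nonneg x) hx).comp_injective
      (i := fun n => 2 * n + 1) fun a b hab => by simpa using hab
  simpa [sub_eq_add_neg] using multipliable_one_add_of_summable h

lemma eulerProd_eq_odd_mul {x : ℂ} (hx : ‖x‖ < 1) :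
    eulerProd x = eulerOdd x * eulerProd (x ^ 2) := by
  have hx2 : ‖x ^ 2‖ < 1 := by rw [norm_pow]; exact pow_lt_one₀ (norm_nonneg _) hx two_ne_zero
  have h2 : ∀ n : ℕ, 1 - x ^ (2 * n + 1 + 1) = 1 - (x ^ 2) ^ (n + 1) := fun n => by
    rw [← pow_mul]; ring
  have h := tprod_even_mul_odd (f := fun n : ℕ => 1 - x ^ (n + 1)) (multipliable_eulerOdd hx)
    (by simpa only [h2] using ModularForm.multipliable_one_sub_pow hx2)
  rw [eulerProd, ← h, eulerOdd, eulerProd]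
  simp only [h2]

lemma eulerOdd_mul_neg {x : ℂ} (hx : ‖x‖ < 1) : eulerOdd x * eulerOdd (-x) = eulerOdd (x ^ 2) := by
  rw [eulerOdd, eulerOdd, eulerOdd, ← (multipliable_eulerOdd hx).tprod_mul
    (multipliable_eulerOdd (by rwa [norm_neg]))]
  refine tprod_congr fun n => ?_
  rw [(odd_two_mul_add_one n).neg_pow, ← pow_mul, mul_comm 2, pow_mul]
  ring

/-- Splitting off the odd exponents gives E(x) = O(x) E(x²), and O(x) O(-x) = O(x²) with O(x²) E(x⁴)
= E(x²). -/
lemma eulerProd_mul_neg {x : ℂ} (hx : ‖x‖ < 1) :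
    eulerProd x * eulerProd (-x) * eulerProd (x ^ 4) = eulerProd (x ^ 2) ^ 3 := by
  have hx2 : ‖x ^ 2‖ < 1 := by rw [norm_pow]; exact pow_lt_one₀ (norm_nonneg _) hx two_ne_zero
  have h3 := eulerProd_eq_odd_mul hx2
  rw [← pow_mul] at h3
  rw [eulerProd_eq_odd_mul hx, eulerProd_eq_odd_mul (x := -x) (by rwa [norm_neg]), neg_sq]
  linear_combination (eulerProd (x ^ 2) ^ 2 * eulerProd (x ^ 4)) * eulerOdd_mul_neg hx
    - eulerProd (x ^ 2) ^ 2 * h3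

lemma eulerProd_ne_zero {x : ℂ} (hx : ‖x‖ < 1) : eulerProd x ≠ 0 := tprod_one_sub_pow_ne_zero hx

lemma differentiableAt_eulerProd {x : ℂ} (hx : ‖x‖ < 1) : DifferentiableAt ℂ eulerProd x :=
  ModularForm.differentiableOn_tprod_one_sub_pow.differentiableAt
    (Metric.isOpen_ball.mem_nhds (by simpa using hx))

lemma eulerProd_zero : eulerProd 0 = 1 := by simp [eulerProd]

/-- Only the factor 1 - x has a nonzero logarithmic derivative at 0. -/
lemma hasDerivAt_eulerProd_zero : HasDerivAt eulerProd (-1) 0 := by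
  have hd := (differentiableAt_eulerProd (x := 0) (by simp)).hasDerivAt
  have hlog : ∀ n : ℕ, logDeriv (fun x : ℂ => 1 - x ^ (n + 1)) 0 = if n = 0 then -1 else 0 := by
    intro n
    have : deriv (fun x : ℂ => 1 - x ^ (n + 1)) 0 = -((n + 1 : ℕ) * 0 ^ n) := by
      rw [((hasDerivAt_pow (n + 1) (0 : ℂ)).const_sub 1).deriv]
      simp
    rw [logDeriv_apply, this]
    rcases n with _ | n <;> simp
  have h := logDeriv_tprod_eq_tsum (f := fun (n : ℕ) (x : ℂ) => 1 - x ^ (n + 1))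
    Metric.isOpen_ball (Metric.mem_ball_self (x := (0 : ℂ)) one_pos) (by simp)
    (fun n => by fun_prop)
    (by simp only [hlog]; exact (hasSum_ite_eq 0 (-1 : ℂ)).summable)
    ModularForm.multipliableLocallyUniformlyOn_one_sub_pow (by simp)
  simp only [hlog, tsum_ite_eq] at h
  have h2 : logDeriv eulerProd 0 = -1 := h
  rw [logDeriv_apply, eulerProd_zero, div_one] at h2
  rwa [h2] at hd

lemma eta_eq_eulerProd (w : ℂ) : ModularForm.eta w = e (w / 24) * eulerProd (e w) := by
  rw [eta_eq, eulerProd]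
  simp only [ModularForm.eta_q_eq_pow]
  rfl

end Euler

/-! ### The weight one form `η(w) η(23w)` -/

section LevelTwentyThree

open Filter Topology

/-- `η(w) η(23w)`. -/
noncomputable def eta23 (w : ℂ) : ℂ := ModularForm.eta w * ModularForm.eta (23 * w)

/-- The power series of `η(w) η(23w)`, divided by its variable. -/
noncomputable def euler23 (x : ℂ) : ℂ := eulerProd x * eulerProd (x ^ 23)

lemma norm_pow_lt_one {x : ℂ} (hx : ‖x‖ < 1) {n : ℕ} (hn : n ≠ 0) : ‖x ^ n‖ < 1 := by
  rw [norm_pow]; exact pow_lt_one₀ (norm_nonneg _) hx hn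

lemma eta23_eq (w : ℂ) : eta23 w = e w * euler23 (e w) := by
  have h1 : e (23 * w) = e w ^ 23 := by
    rw [← e_nat_mul]; push_cast; rfl
  have h2 : e (w / 24) * e (23 * w / 24) = e w := by rw [← e_add]; congr 1; ring
  rw [eta23, eta_eq_eulerProd, eta_eq_eulerProd, h1, euler23, ← h2]; ring

lemma euler23_ne_zero {x : ℂ} (hx : ‖x‖ < 1) : euler23 x ≠ 0 :=
  mul_ne_zero (eulerProd_ne_zero hx) (eulerProd_ne_zero (norm_pow_lt_one hx (by norm_num)))

lemma eta23_ne_zero {w : ℂ} (hw : 0 < w.im) : eta23 w ≠ 0 := by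
  rw [eta23_eq]
  exact mul_ne_zero (e_ne_zero _) (euler23_ne_zero (norm_e_lt_one hw))

lemma euler23_mul_neg {x : ℂ} (hx : ‖x‖ < 1) :
    euler23 x * euler23 (-x) * euler23 (x ^ 4) = euler23 (x ^ 2) ^ 3 := by
  have h1 := eulerProd_mul_neg hx
  have h2 := eulerProd_mul_neg (norm_pow_lt_one hx (n := 23) (by norm_num))
  have e1 : (-x) ^ 23 = -(x ^ 23) := by ring
  have e2 : (x ^ 4) ^ 23 = (x ^ 23) ^ 4 := by ring
  have e3 : (x ^ 2) ^ 23 = (x ^ 23) ^ 2 := by ring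
  simp only [euler23, e1, e2, e3]
  calc _ = (eulerProd x * eulerProd (-x) * eulerProd (x ^ 4)) *
      (eulerProd (x ^ 23) * eulerProd (-(x ^ 23)) * eulerProd ((x ^ 23) ^ 4)) := by ring
    _ = _ := by rw [h1, h2]; ring

lemma hasDerivAt_euler23 : HasDerivAt euler23 (-1) 0 := by
  have h1 : HasDerivAt (fun x : ℂ => eulerProd (x ^ 23)) (-1 * ((23 : ℕ) * 0 ^ 22)) 0 := by
    have := hasDerivAt_pow 23 (0 : ℂ)
    refine HasDerivAt.comp (h₂ := eulerProd) 0 ?_ this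
    simpa using hasDerivAt_eulerProd_zero
  have := hasDerivAt_eulerProd_zero.mul h1
  simpa [eulerProd_zero] using! this

lemma euler23_zero : euler23 0 = 1 := by simp [euler23, eulerProd_zero]

lemma eta23_add_one (w : ℂ) : eta23 (w + 1) = eta23 w := by
  have : e (w + 1) = e w := e_congr_int 1 (by simp)
  rw [eta23_eq, eta23_eq, this]

/-- The inversion exchanges the two factors, and the two square roots combine to √23 · (-iw), so no
branch remains. -/
lemma eta23_fricke {w : ℂ} (hw : 0 < w.im) :
    eta23 (-1 / (23 * w)) = Complex.sqrt 23 * (-I * w) * eta23 w := by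
  have hw23 : 0 < ((23 : ℂ) * w).im := by
    have := natCast_mul_im_pos (k := 23) (by norm_num) hw
    simpa using this
  have h0 := ne_zero_of_im_pos hw
  have e1 : 23 * (-1 / (23 * w)) = -1 / w := by field_simp
  have e2 : -I * (23 * w) = 23 * (-I * w) := by ring
  rw [eta23, eta23, e1, eta_S_sqrt hw, eta_S_sqrt hw23, e2,
    sqrt_mul_of_re_pos (by norm_num) (by rwa [neg_I_mul_re])]
  linear_combination (Complex.sqrt 23 * ModularForm.eta (23 * w) * ModularForm.eta w) *
    sqrt_sq (-I * w)

/-- The quotient `η(2w) η(46w) / (η(w) η(23w))` and its two conjugates over `Γ₀(23)`. -/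
noncomputable def conj23 : Fin 3 → ℂ → ℂ :=
  ![fun w => eta23 (2 * w) / eta23 w, fun w => eta23 (w / 2) / (2 * eta23 w),
    fun w => eta23 ((w + 1) / 2) / (2 * eta23 w)]

lemma conj23_zero (w : ℂ) : conj23 0 w = eta23 (2 * w) / eta23 w := rfl

lemma conj23_one (w : ℂ) : conj23 1 w = eta23 (w / 2) / (2 * eta23 w) := rfl

lemma conj23_two (w : ℂ) : conj23 2 w = eta23 ((w + 1) / 2) / (2 * eta23 w) := rfl

lemma two_mul_im_pos {w : ℂ} (hw : 0 < w.im) : 0 < ((2 : ℂ) * w).im := by simpa using hw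

lemma half_im_pos {w : ℂ} (hw : 0 < w.im) : 0 < (w / 2).im := by simpa using hw

lemma fricke_im_pos {w : ℂ} (hw : 0 < w.im) : 0 < (-1 / (23 * w)).im := by
  apply neg_one_div_im_pos
  have := natCast_mul_im_pos (k := 23) (by norm_num) hw
  simpa using this

lemma conj23_eq {w : ℂ} :
    conj23 0 w = e (w / 2) ^ 2 * euler23 (e (w / 2) ^ 4) / euler23 (e (w / 2) ^ 2) ∧
    conj23 1 w = euler23 (e (w / 2)) / (2 * (e (w / 2) * euler23 (e (w / 2) ^ 2))) ∧
    conj23 2 w = -euler23 (-e (w / 2)) / (2 * (e (w / 2) * euler23 (e (w / 2) ^ 2))) := by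
  set s := e (w / 2) with hs
  have hs0 : s ≠ 0 := e_ne_zero _
  have e1 : e w = s ^ 2 := by rw [hs, ← e_nat_mul]; congr 1; push_cast; ring
  have e2 : e (2 * w) = s ^ 4 := by rw [hs, ← e_nat_mul]; congr 1; push_cast; ring
  have e3 : e ((w + 1) / 2) = -s := by rw [add_div, e_add, e_half]; ring
  refine ⟨?_, ?_, ?_⟩
  · rw [conj23_zero, eta23_eq, eta23_eq, e1, e2]
    field_simp
  · rw [conj23_one, eta23_eq, eta23_eq, e1, ← hs]
    field_simp
  · rw [conj23_two, eta23_eq, eta23_eq, e1, e3]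
    field_simp

lemma conj23_ne_zero {w : ℂ} (hw : 0 < w.im) (i : Fin 3) : conj23 i w ≠ 0 := by
  have h1 := eta23_ne_zero hw
  have h2 := eta23_ne_zero (two_mul_im_pos hw)
  have h3 := eta23_ne_zero (half_im_pos hw)
  have h4 : eta23 ((w + 1) / 2) ≠ 0 := eta23_ne_zero (half_im_pos (by simpa using hw))
  fin_cases i
  · exact div_ne_zero h2 h1
  · exact div_ne_zero h3 (mul_ne_zero two_ne_zero h1)
  · exact div_ne_zero h4 (mul_ne_zero two_ne_zero h1)

/-- In the variable e(w/2) this is `euler23_mul_neg`. -/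
lemma conj23_mul {w : ℂ} (hw : 0 < w.im) : conj23 0 w * conj23 1 w * conj23 2 w = -1 / 4 := by
  obtain ⟨h0, h1, h2⟩ := conj23_eq (w := w)
  have hs := norm_e_lt_one (half_im_pos hw)
  rw [h0, h1, h2]
  have hG := euler23_ne_zero (norm_pow_lt_one hs two_ne_zero)
  have hs0 := e_ne_zero (w / 2)
  field_simp
  linear_combination -4 * euler23_mul_neg hs

/-- The third conjugate inherits its transformation laws from the other two through the product. -/
lemma conj23_two_eq {w : ℂ} (hw : 0 < w.im) :
    conj23 2 w = -1 / 4 / (conj23 0 w * conj23 1 w) := by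
  rw [eq_div_iff (mul_ne_zero (conj23_ne_zero hw 0) (conj23_ne_zero hw 1)), ← conj23_mul hw]; ring

lemma conj23_add_one (w : ℂ) : conj23 0 (w + 1) = conj23 0 w ∧ conj23 1 (w + 1) = conj23 2 w ∧
    conj23 2 (w + 1) = conj23 1 w := by
  simp only [conj23_zero, conj23_one, conj23_two]
  refine ⟨?_, ?_, ?_⟩
  · rw [show 2 * (w + 1) = 2 * w + 1 + 1 by ring]; simp only [eta23_add_one]
  · simp only [eta23_add_one]
  · rw [show (w + 1 + 1) / 2 = w / 2 + 1 by ring]; simp only [eta23_add_one]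

lemma sqrt_ne_zero {x : ℂ} (hx : x ≠ 0) : Complex.sqrt x ≠ 0 := by
  intro h
  have := sqrt_sq x
  rw [h] at this
  exact hx (by rw [← this]; simp)

lemma conj23_zero_fricke {w : ℂ} (hw : 0 < w.im) : conj23 0 (-1 / (23 * w)) = conj23 1 w := by
  have h0 := ne_zero_of_im_pos hw
  have e1 : 2 * (-1 / (23 * w)) = -1 / (23 * (w / 2)) := by field_simp
  have h23 : Complex.sqrt 23 ≠ 0 := sqrt_ne_zero (by norm_num)
  have hI := I_ne_zero
  have h1 := eta23_ne_zero hw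
  rw [conj23_zero, conj23_one, e1, eta23_fricke hw, eta23_fricke (half_im_pos hw)]
  field_simp

lemma fricke_fricke {w : ℂ} (hw : 0 < w.im) : -1 / (23 * (-1 / (23 * w))) = w := by
  have h0 := ne_zero_of_im_pos hw
  field_simp

/-- Translation and Fricke involution act on the three conjugates as two different transpositions,
so symmetric functions of them are invariant under both. -/
lemma conj23_fricke {w : ℂ} (hw : 0 < w.im) : conj23 0 (-1 / (23 * w)) = conj23 1 w ∧
    conj23 1 (-1 / (23 * w)) = conj23 0 w ∧ conj23 2 (-1 / (23 * w)) = conj23 2 w := by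
  have h0 := conj23_zero_fricke hw
  have h1 : conj23 1 (-1 / (23 * w)) = conj23 0 w := by
    rw [← conj23_zero_fricke (fricke_im_pos hw), fricke_fricke hw]
  refine ⟨h0, h1, ?_⟩
  rw [conj23_two_eq hw, conj23_two_eq (fricke_im_pos hw), h0, h1, mul_comm]

lemma etaQuotData_conj23 : EtaQuotData 46 1 0 [(2, 1), (46, 1), (1, -1), (23, -1)] where
  pos := by norm_num
  dvd := by decide
  sum := by decide
  h_dvd := by decide
  h_dvd' := by decide
  order := by decide
  coOrder := by decide
  three := by decide
  square := ⟨46, by decide⟩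

lemma mobius_im_pos {a b c d : ℤ} (hdet : a * d - b * c = 1) {w : ℂ} (hw : 0 < w.im) :
    0 < ((a * w + b) / (c * w + d) : ℂ).im := by
  let γ : SL(2, ℤ) := ⟨!![a, b; c, d], by rw [Matrix.det_fin_two]; simpa using hdet⟩
  have h := coe_smul_eq γ ⟨w, hw⟩
  have h2 : ((γ 0 0 : ℤ) : ℂ) = a ∧ ((γ 0 1 : ℤ) : ℂ) = b ∧ ((γ 1 0 : ℤ) : ℂ) = c ∧
      ((γ 1 1 : ℤ) : ℂ) = d := by simp [γ]
  rw [jfac, h2.1, h2.2.1, h2.2.2.1, h2.2.2.2] at h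
  change _ = ((a : ℂ) * w + b) / (c * w + d) at h
  rw [← h]
  exact (γ • (⟨w, hw⟩ : ℍ)).im_pos

lemma mobius_denom_ne_zero {a b c d : ℤ} (hdet : a * d - b * c = 1) {w : ℂ} (hw : 0 < w.im) :
    (c : ℂ) * w + d ≠ 0 := by
  intro h
  have := mobius_im_pos hdet hw
  rw [h] at this
  simp at this

lemma conj23_zero_mobius {a b c d : ℤ} (hdet : a * d - b * c = 1) (hc : 46 ∣ c) {w : ℂ}
    (hw : 0 < w.im) : conj23 0 ((a * w + b) / (c * w + d)) = conj23 0 w := by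
  have h := etaQuotData_conj23.law hdet (by exact_mod_cast hc) hw
  have hq : ∀ w, conj23 0 w = etaQuot [(2, 1), (46, 1), (1, -1), (23, -1)] w := fun w => by
    have : (23 : ℂ) * (2 * w) = 46 * w := by ring
    simp [etaQuot, conj23_zero, eta23, this, div_eq_mul_inv]
    ring
  rw [hq, h, ← hq]
  have := e_div_of_dvd (n := 46) d (by norm_num) (c := c) (by exact_mod_cast hc)
  rw [Nat.cast_one, mul_one, this]
  simp

/-- Conjugation by the Fricke involution carries the first conjugate to the second and turns the
matrix into (d, -c/23; -23b, a). Evenness of b puts this into Γ₀(46). -/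
lemma conj23_mobius {a b c d : ℤ} (hdet : a * d - b * c = 1) (hc : 46 ∣ c) (hb : 2 ∣ b) {w : ℂ}
    (hw : 0 < w.im) (i : Fin 3) : conj23 i ((a * w + b) / (c * w + d)) = conj23 i w := by
  have h0 := conj23_zero_mobius hdet hc hw
  have h1 : conj23 1 ((a * w + b) / (c * w + d)) = conj23 1 w := by
    obtain ⟨c', rfl⟩ : (23 : ℤ) ∣ c := (by norm_num : (23 : ℤ) ∣ 46).trans hc
    have hm := mobius_im_pos hdet hw
    have hden := mobius_denom_ne_zero hdet hw
    have hn : (a : ℂ) * w + b ≠ 0 := by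
      intro h; rw [h] at hm; simp at hm
    have hw0 := ne_zero_of_im_pos hw
    have hdet' : d * a - (-c') * (-23 * b) = 1 := by rw [← hdet]; ring
    have key := conj23_zero_mobius hdet' (by
      obtain ⟨k, rfl⟩ := hb; exact ⟨-k, by ring⟩) (fricke_im_pos hw)
    rw [(conj23_fricke hw).1] at key
    rw [← key, ← (conj23_fricke hm).1]
    congr 1
    push_cast at hden ⊢
    have e1 : -23 * (b : ℂ) * (-1 / (23 * w)) + a = (a * w + b) / w := by field_simp; ring
    have e2 : (d : ℂ) * (-1 / (23 * w)) + -c' = -(23 * c' * w + d) / (23 * w) := by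
      field_simp; ring
    rw [e1, e2]
    field_simp
  fin_cases i
  · exact h0
  · exact h1
  · change conj23 2 _ = conj23 2 _
    rw [conj23_two_eq hw, conj23_two_eq (mobius_im_pos hdet hw), h0, h1]

/-- A function on the upper half plane that is invariant under the translation by one, the Fricke
involution of level `23` and the matrices of `Γ₀(46)` with even `b` is invariant under `Γ₀(23)`. -/
lemma invariant_Gamma0_23 {f : ℂ → ℂ} (hT : ∀ w : ℂ, 0 < w.im → f (w + 1) = f w)
    (hW : ∀ w : ℂ, 0 < w.im → f (-1 / (23 * w)) = f w)
    (h46 : ∀ a b c d : ℤ, a * d - b * c = 1 → 46 ∣ c → 2 ∣ b → ∀ w : ℂ, 0 < w.im →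
      f ((a * w + b) / (c * w + d)) = f w)
    {a b c d : ℤ} (hdet : a * d - b * c = 1) (hc : 23 ∣ c) {w : ℂ} (hw : 0 < w.im) :
    f ((a * w + b) / (c * w + d)) = f w := by
  have hw1 : ∀ {w : ℂ}, 0 < w.im → 0 < (w + 1).im := fun h => by simpa using h
  -- When c is even, a is odd; if b is odd too, composing with a translation replaces it by the even
  -- number b - a.
  have even_c : ∀ a b c d : ℤ, a * d - b * c = 1 → 46 ∣ c → ∀ w : ℂ, 0 < w.im →
      f ((a * w + b) / (c * w + d)) = f w := by
    intro a b c d hdet hc w hw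
    by_cases hb : 2 ∣ b
    · exact h46 a b c d hdet hc hb w hw
    · have hb' : 2 ∣ b - a := by
        obtain ⟨k, rfl⟩ := hc
        have ha : ¬ 2 ∣ a := by
          rintro ⟨m, rfl⟩
          have : 2 * (m * d - b * (23 * k)) = 1 := by rw [← hdet]; ring
          omega
        omega
      have := h46 a (b - a) c (d - c) (by rw [← hdet]; ring) hc hb' (w + 1) (hw1 hw)
      rw [hT w hw] at this
      rw [← this]
      congr 1
      push_cast
      ring
  -- The matrix (1 0; 23 1) acts as the inverse translation conjugated by the Fricke involution.
  have hδ : ∀ w : ℂ, 0 < w.im → f (w / (23 * w + 1)) = f w := by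
    intro w hw
    have hw0 := ne_zero_of_im_pos hw
    have hu : 0 < (-1 / (23 * w) - 1).im := by simpa using fricke_im_pos hw
    have hu0 := ne_zero_of_im_pos hu
    have e1 : -1 / (23 * (-1 / (23 * w) - 1)) = w / (23 * w + 1) := by
      have hne : 23 * w + 1 ≠ 0 := by
        intro h; apply hu0; field_simp; linear_combination -h
      have e2 : -1 / (23 * w) - 1 = -(23 * w + 1) / (23 * w) := by field_simp; ring
      rw [e2]; field_simp
    have h2 := hT _ hu
    rw [sub_add_cancel] at h2
    rw [← e1, hW _ hu, ← h2, hW w hw]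
  -- For odd c and d, multiplication on the right by (1 0; 23 1) makes the lower left entry c + 23d
  -- even.
  have odd_d : ∀ a b c d : ℤ, a * d - b * c = 1 → 23 ∣ c → Odd d → ∀ w : ℂ, 0 < w.im →
      f ((a * w + b) / (c * w + d)) = f w := by
    intro a b c d hdet hc hd w hw
    by_cases hc2 : 2 ∣ c
    · exact even_c a b c d hdet (by omega) w hw
    · have hdet' : (1 : ℤ) * 1 - 0 * (-23) = 1 := by norm_num
      have hu := mobius_im_pos hdet' hw
      have hden := mobius_denom_ne_zero hdet' hw
      push_cast at hu hden
      rw [one_mul, add_zero] at hu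
      obtain ⟨x, hx⟩ : ∃ x, x = -23 * w + 1 := ⟨_, rfl⟩
      rw [← hx] at hu hden
      have e1 : w / x / (23 * (w / x) + 1) = w := by
        have : 23 * (w / x) + 1 = 1 / x := by field_simp; rw [hx]; ring
        rw [this]; field_simp
      have h1 := hδ _ hu
      rw [e1] at h1
      have hd' : (46 : ℤ) ∣ c + 23 * d := by
        obtain ⟨k, rfl⟩ := hd; omega
      have hdet2 : (a + 23 * b) * d - b * (c + 23 * d) = 1 := by rw [← hdet]; ring
      have h2 := even_c (a + 23 * b) b (c + 23 * d) d hdet2 hd' _ hu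
      rw [h1, ← h2]
      congr 1
      push_cast
      have e3 : ((a : ℂ) + 23 * b) * (w / x) + b = (a * w + b) / x := by
        field_simp; rw [hx]; ring
      have e4 : ((c : ℂ) + 23 * d) * (w / x) + d = (c * w + d) / x := by
        field_simp; rw [hx]; ring
      rw [e3, e4, div_div_div_cancel_right₀ hden]
  by_cases hd : Odd d
  · exact odd_d a b c d hdet hc hd w hw
  -- Here c is odd and d is even, and a translation makes d - c odd.
  · have hco : Odd c := (odd_or_odd_of_det hdet).resolve_right hd
    have := odd_d a (b - a) c (d - c) (by rw [← hdet]; ring) hc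
      ((Int.not_odd_iff_even.1 hd).sub_odd hco) (w + 1) (hw1 hw)
    rw [hT w hw] at this
    rw [← this]
    congr 1
    push_cast
    ring

/-- A holomorphic function that is invariant under `Γ₀(n)` and bounded at all cusps is constant. -/
theorem eq_const_of_invariant {n : ℕ} [NeZero n] {f : ℍ → ℂ}
    (hf : DifferentiableOn ℂ (fun w => f (ofComplex w)) {w | 0 < w.im})
    (hinv : ∀ γ ∈ CongruenceSubgroup.Gamma0 n, ∀ τ, f (γ • τ) = f τ)
    (hbdd : ∀ γ : SL(2, ℤ), IsBoundedAtImInfty fun τ => f (γ • τ)) : ∃ a, ∀ τ, f τ = a := by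
  let F : ModularForm (CongruenceSubgroup.Gamma0 n) 0 :=
    { toFun := f
      slash_action_eq' := by
        rintro _ ⟨γ, hγ, rfl⟩
        funext τ
        have h := ModularForm.SL_slash_apply (f := f) (k := 0) γ τ
        rw [neg_zero, zpow_zero, mul_one, hinv γ hγ] at h
        exact h
      holo' := by
        rw [UpperHalfPlane.mdifferentiable_iff]
        exact hf
      bdd_at_cusps' := by
        intro c hc
        rw [Subgroup.IsArithmetic.isCusp_iff_isCusp_SL2Z] at hc
        rw [OnePoint.isBoundedAt_iff_forall_SL2Z hc]
        intro γ _
        refine (hbdd γ).congr_left fun τ => ?_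
        rw [ModularForm.SL_slash_apply, neg_zero, zpow_zero, mul_one] }
  obtain ⟨a, ha⟩ := ModularForm.eq_const_of_weight_zero F
  exact ⟨a, fun τ => congrFun ha τ⟩

lemma conj23_sum_mobius {a b c d : ℤ} (hdet : a * d - b * c = 1) (hc : 23 ∣ c) {w : ℂ}
    (hw : 0 < w.im) : conj23 0 ((a * w + b) / (c * w + d)) + conj23 1 ((a * w + b) / (c * w + d)) +
      conj23 2 ((a * w + b) / (c * w + d)) = conj23 0 w + conj23 1 w + conj23 2 w := by
  refine invariant_Gamma0_23 (f := fun w => conj23 0 w + conj23 1 w + conj23 2 w) ?_ ?_ ?_ hdet hc hw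
  · intro w _
    obtain ⟨h0, h1, h2⟩ := conj23_add_one w
    rw [h0, h1, h2]; ring
  · intro w hw
    obtain ⟨h0, h1, h2⟩ := conj23_fricke hw
    rw [h0, h1, h2]; ring
  · intro a b c d hdet hc hb w hw
    simp only [conj23_mobius hdet hc hb hw]

lemma conj23_pairs_mobius {a b c d : ℤ} (hdet : a * d - b * c = 1) (hc : 23 ∣ c) {w : ℂ}
    (hw : 0 < w.im) :
    conj23 0 ((a * w + b) / (c * w + d)) * conj23 1 ((a * w + b) / (c * w + d)) +
      conj23 0 ((a * w + b) / (c * w + d)) * conj23 2 ((a * w + b) / (c * w + d)) +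
      conj23 1 ((a * w + b) / (c * w + d)) * conj23 2 ((a * w + b) / (c * w + d)) =
    conj23 0 w * conj23 1 w + conj23 0 w * conj23 2 w + conj23 1 w * conj23 2 w := by
  refine invariant_Gamma0_23 (f := fun w => conj23 0 w * conj23 1 w + conj23 0 w * conj23 2 w +
    conj23 1 w * conj23 2 w) ?_ ?_ ?_ hdet hc hw
  · intro w _
    obtain ⟨h0, h1, h2⟩ := conj23_add_one w
    rw [h0, h1, h2]; ring
  · intro w hw
    obtain ⟨h0, h1, h2⟩ := conj23_fricke hw
    rw [h0, h1, h2]; ring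
  · intro a b c d hdet hc hb w hw
    simp only [conj23_mobius hdet hc hb hw]

lemma tendsto_e_half : Tendsto (fun τ : ℍ => e ((τ : ℂ) / 2)) atImInfty (𝓝[≠] 0) := by
  refine tendsto_nhdsWithin_iff.2 ⟨?_, Eventually.of_forall fun τ => e_ne_zero _⟩
  rw [tendsto_zero_iff_norm_tendsto_zero]
  have h : ∀ τ : ℍ, ‖e ((τ : ℂ) / 2)‖ = Real.exp (-(π * τ.im)) := fun τ => by
    rw [norm_e]
    congr 1
    have : ((τ : ℂ) / 2).im = τ.im / 2 := by simp
    rw [this]; ring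
  simp only [h]
  exact Real.tendsto_exp_neg_atTop_nhds_zero.comp (tendsto_comap.const_mul_atTop Real.pi_pos)

/-- With s = q^{1/2} and G = `euler23`, the last two conjugates add up to (G(s) - G(-s))/(2s G(s²)).
Their poles in s cancel, and the difference quotient tends to 2G'(0) = -2; the first conjugate tends
to 0. -/
lemma tendsto_conj23_sum :
    Tendsto (fun τ : ℍ => conj23 0 τ + conj23 1 τ + conj23 2 τ) atImInfty (𝓝 (-1)) := by
  have hd := hasDerivAt_euler23
  have hcont : ∀ n : ℕ, n ≠ 0 → Tendsto (fun s : ℂ => euler23 (s ^ n)) (𝓝[≠] 0) (𝓝 1) := by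
    intro n hn
    have h1 : ContinuousAt euler23 ((0 : ℂ) ^ n) := by rw [zero_pow hn]; exact hd.continuousAt
    have h2 : ContinuousAt (fun s : ℂ => euler23 (s ^ n)) 0 :=
      ContinuousAt.comp (f := fun s : ℂ => s ^ n) h1 (continuous_pow n).continuousAt
    have h3 := h2.tendsto
    rw [zero_pow hn, euler23_zero] at h3
    exact h3.mono_left nhdsWithin_le_nhds
  have hs : Tendsto (fun s : ℂ => s ^ 2) (𝓝[≠] 0) (𝓝 0) := by
    have := (continuous_pow (M := ℂ) 2).tendsto 0
    rw [zero_pow two_ne_zero] at this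
    exact this.mono_left nhdsWithin_le_nhds
  have hodd : HasDerivAt (fun s => euler23 s - euler23 (-s)) (-2) 0 := by
    have h1 : HasDerivAt (fun s => euler23 (-s)) (-1 * (-1)) 0 := by
      refine HasDerivAt.comp (h₂ := euler23) 0 ?_ (hasDerivAt_neg 0)
      simpa using hd
    convert! hd.sub h1 using 1
    norm_num
  have hslope := hodd.tendsto_slope_zero
  simp only [zero_add, neg_zero, sub_self, sub_zero, smul_eq_mul] at hslope
  have key := (((hs.mul (hcont 4 (by norm_num))).div (hcont 2 (by norm_num)) one_ne_zero).add
    (hslope.div ((hcont 2 (by norm_num)).const_mul 2) (by norm_num))).comp tendsto_e_half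
  have e0 : (0 * 1 / 1 + -2 / (2 * 1) : ℂ) = -1 := by norm_num
  rw [e0] at key
  refine key.congr fun τ => ?_
  obtain ⟨h0, h1, h2⟩ := conj23_eq (w := τ)
  have hG := euler23_ne_zero (norm_pow_lt_one (norm_e_lt_one (half_im_pos τ.im_pos)) two_ne_zero)
  have hs0 := e_ne_zero ((τ : ℂ) / 2)
  rw [h0, h1, h2]
  simp only [Function.comp_apply, Pi.div_apply]
  field_simp
  ring

lemma differentiableOn_eta23 : DifferentiableOn ℂ eta23 {w | 0 < w.im} := by
  intro w hw
  have hw' : 0 < ((23 : ℂ) * w).im := by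
    have := natCast_mul_im_pos (k := 23) (by norm_num) hw
    simpa using this
  have h1 := ModularForm.differentiableAt_eta_of_mem_upperHalfPlaneSet hw
  have h2 := (ModularForm.differentiableAt_eta_of_mem_upperHalfPlaneSet hw').comp w
    (differentiableAt_id.const_mul (23 : ℂ))
  exact (h1.mul h2).differentiableWithinAt

lemma differentiableOn_conj23 (i : Fin 3) : DifferentiableOn ℂ (conj23 i) {w | 0 < w.im} := by
  have h0 := differentiableOn_eta23
  have h1 : DifferentiableOn ℂ (fun w : ℂ => eta23 (2 * w)) {w | 0 < w.im} :=
    h0.comp (differentiableOn_id.const_mul (2 : ℂ)) fun w hw => two_mul_im_pos hw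
  have h2 : DifferentiableOn ℂ (fun w : ℂ => eta23 (w / 2)) {w | 0 < w.im} :=
    h0.comp (differentiableOn_id.div_const (2 : ℂ)) fun w hw => half_im_pos hw
  have h3 : DifferentiableOn ℂ (fun w : ℂ => eta23 ((w + 1) / 2)) {w | 0 < w.im} :=
    h0.comp ((differentiableOn_id.add_const (1 : ℂ)).div_const (2 : ℂ))
      fun w hw => half_im_pos (by simpa using hw)
  fin_cases i
  · exact differentiableOn_fun_div h1 h0 fun w hw => eta23_ne_zero hw
  · exact differentiableOn_fun_div h2 (h0.const_mul 2) fun w hw =>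
      mul_ne_zero two_ne_zero (eta23_ne_zero hw)
  · exact differentiableOn_fun_div h3 (h0.const_mul 2) fun w hw =>
      mul_ne_zero two_ne_zero (eta23_ne_zero hw)

lemma conj23_sum_smul {γ : SL(2, ℤ)} (hγ : γ ∈ CongruenceSubgroup.Gamma0 23) (τ : ℍ) :
    conj23 0 (γ • τ : ℍ) + conj23 1 (γ • τ : ℍ) + conj23 2 (γ • τ : ℍ) =
      conj23 0 τ + conj23 1 τ + conj23 2 τ := by
  rw [coe_smul_eq]
  exact conj23_sum_mobius (det_eq_int γ) (mem_Gamma0_iff.1 hγ) τ.im_pos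

/-- The group Γ₀(23) has two cusps, exchanged by the Fricke involution, and the sum is invariant
under that involution. -/
lemma bounded_conj23_sum (γ : SL(2, ℤ)) : IsBoundedAtImInfty fun τ : ℍ =>
    conj23 0 (γ • τ : ℍ) + conj23 1 (γ • τ : ℍ) + conj23 2 (γ • τ : ℍ) := by
  have hb : IsBoundedAtImInfty fun τ : ℍ => conj23 0 τ + conj23 1 τ + conj23 2 τ :=
    tendsto_conj23_sum.isBigO_one ℝ
  by_cases hγ : γ ∈ CongruenceSubgroup.Gamma0 23
  · exact hb.congr_left fun τ => (conj23_sum_smul hγ τ).symm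
  · have hc : ¬ (23 : ℤ) ∣ γ 1 0 := fun h => hγ (mem_Gamma0_iff.2 h)
    have hcop : IsCoprime (23 : ℤ) (γ 1 0) :=
      (Int.prime_iff_natAbs_prime.2 (by norm_num)).coprime_iff_not_dvd.2 hc
    obtain ⟨u, v, huv⟩ := hcop
    -- With 23 ∣ d - jc one has γ = δ S Tʲ for some δ in Γ₀(23), and S(τ + j) is the Fricke image of
    -- (τ + j)/23.
    have hdvd : (23 : ℤ) ∣ γ 1 1 - (v * γ 1 1) * γ 1 0 :=
      ⟨u * γ 1 1, by linear_combination (γ 1 1) * (-huv)⟩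
    set j := v * γ 1 1 with hj
    set a := γ 0 0 with ha
    set b := γ 0 1 with hb'
    set c := γ 1 0 with hc'
    set d := γ 1 1 with hd'
    have hdet : a * d - b * c = 1 := det_eq_int γ
    have hpos : (0 : ℕ) < 23 := by norm_num
    refine (hb.comp_tendsto (tendsto_affineMap (A := 1) (D := 23) (B := j) one_pos hpos)).congr_left
      fun τ => ?_
    have him : 0 < ((τ : ℂ) + j).im := by simpa using τ.im_pos
    have hτ0 := ne_zero_of_im_pos him
    have hS := neg_one_div_im_pos him
    have hdet' : (-b + j * a) * c - a * (-(d - j * c)) = 1 := by rw [← hdet]; ring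
    have key := conj23_sum_mobius hdet' (dvd_neg.2 hdvd) hS
    have e1 : (((-b + j * a : ℤ) : ℂ) * (-1 / (τ + j)) + a) /
        (((-(d - j * c) : ℤ) : ℂ) * (-1 / (τ + j)) + c) = (γ • τ : ℍ) := by
      rw [coe_smul_eq, jfac, ← ha, ← hb', ← hc', ← hd']
      push_cast
      have e2 : (-(b : ℂ) + j * a) * (-1 / (τ + j)) + a = (a * τ + b) / (τ + j) := by
        field_simp; ring
      have e3 : -((d : ℂ) - j * c) * (-1 / (τ + j)) + c = (c * τ + d) / (τ + j) := by
        field_simp; ring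
      rw [e2, e3, div_div_div_cancel_right₀ hτ0]
    rw [e1] at key
    rw [key]
    have e4 : (-1 : ℂ) / (τ + j) = -1 / (23 * (affineMap 1 23 j one_pos hpos τ : ℍ)) := by
      rw [coe_affineMap]; push_cast; field_simp
    obtain ⟨h0, h1, h2⟩ := conj23_fricke (affineMap 1 23 j one_pos hpos τ).im_pos
    rw [e4, h0, h1, h2, Function.comp_apply]
    ring

/-- An invariant holomorphic function bounded at all cusps is constant, and its value is read off at
i∞. -/
theorem conj23_sum (τ : ℍ) : conj23 0 τ + conj23 1 τ + conj23 2 τ = -1 := by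
  have hholo : DifferentiableOn ℂ (fun w : ℂ => conj23 0 (ofComplex w) + conj23 1 (ofComplex w) +
      conj23 2 (ofComplex w)) {w | 0 < w.im} := by
    refine (((differentiableOn_conj23 0).fun_add (differentiableOn_conj23 1)).fun_add
      (differentiableOn_conj23 2)).congr fun w hw => ?_
    rw [ofComplex_apply_of_im_pos hw]
  obtain ⟨a, ha⟩ := eq_const_of_invariant (n := 23)
    (f := fun τ : ℍ => conj23 0 τ + conj23 1 τ + conj23 2 τ) hholo
    (fun γ hγ τ => conj23_sum_smul hγ τ) bounded_conj23_sum
  have h1 : Tendsto (fun τ : ℍ => conj23 0 τ + conj23 1 τ + conj23 2 τ) atImInfty (𝓝 a) := by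
    simp only [ha]; exact tendsto_const_nhds
  rw [ha τ]
  exact tendsto_nhds_unique h1 tendsto_conj23_sum

end LevelTwentyThree

/-! ### The forms `T̃_g` -/

lemma eta23_coe (τ : ℍ) : eta23 τ = etaAt 1 τ * etaAt 23 τ := by simp [eta23, etaAt]

lemma eta23_two_mul_coe (τ : ℍ) : eta23 (2 * τ) = etaAt 2 τ * etaAt 46 τ := by
  have : (23 : ℂ) * (2 * τ) = 46 * τ := by ring
  simp [eta23, etaAt, this]

/-- With t = η₂η₄₆/(η₁η₂₃) the form is η₁²η₂₃² (1/t + 4t + 4t²). Sum -1 and product -1/4 of the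
conjugates give their second symmetric function as -t - t² - 1/(4t). -/
lemma f232_eq (τ : ℍ) : f232 τ = -4 * (etaAt 1 τ ^ 2 * etaAt 23 τ ^ 2) *
    (conj23 0 τ * conj23 1 τ + conj23 0 τ * conj23 2 τ + conj23 1 τ * conj23 2 τ) := by
  have hs := conj23_sum τ
  have hp := conj23_mul τ.im_pos
  have h0 : conj23 0 τ = etaAt 2 τ * etaAt 46 τ / (etaAt 1 τ * etaAt 23 τ) := by
    rw [conj23_zero, eta23_coe, eta23_two_mul_coe]
  have hne := conj23_ne_zero τ.im_pos 0
  have h12 : conj23 1 τ * conj23 2 τ = -1 / 4 / conj23 0 τ := by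
    rw [eq_div_iff hne, ← hp]; ring
  have h1 : conj23 1 τ + conj23 2 τ = -1 - conj23 0 τ := by linear_combination hs
  rw [← mul_add, h1, h12, h0, f232]
  have e1 := etaAt_ne_zero one_pos τ
  have e2 := etaAt_ne_zero (k := 2) (by norm_num) τ
  have e3 := etaAt_ne_zero (k := 23) (by norm_num) τ
  have e4 := etaAt_ne_zero (k := 46) (by norm_num) τ
  field_simp
  ring

/-- The numerical part of `EtaQuotData`, and the condition at the cusps, in decidable form. -/
def EtaQuotCheck (n h s : ℕ) (l : List (ℕ × ℤ)) : Prop :=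
  0 < n ∧ (∀ p ∈ l, p.1 ∣ n) ∧ expSum l = 4 * 1 ∧ h ∣ n ∧ h ∣ 24 ∧ (24 : ℤ) ∣ expOrder l ∧
    (24 : ℤ) ∣ expCoOrder n l + (24 / h : ℕ) ∧ (3 ∣ n ∨ (3 : ℤ) ∣ expCoOrder n l) ∧
    expProd l = s ^ 2 ∧ ∀ t ∈ n.divisors,
      0 ≤ (l.map fun p => p.2 * (((Nat.gcd p.1 t) ^ 2 * (n / p.1) : ℕ) : ℤ)).sum

instance (n h s : ℕ) (l : List (ℕ × ℤ)) : Decidable (EtaQuotCheck n h s l) := by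
  unfold EtaQuotCheck; infer_instance

lemma EtaQuotCheck.isTwistedForm {n h s : ℕ} {l : List (ℕ × ℤ)} (H : EtaQuotCheck n h s l) :
    IsTwistedForm n h fun τ => (l.map fun p => etaAt p.1 τ ^ p.2).prod := by
  obtain ⟨h1, h2, h3, h4, h5, h6, h7, h8, h9, h10⟩ := H
  exact EtaQuotData.isTwistedForm ⟨h1, h2, h3, h4, h5, h6, h7, h8, s, h9⟩ h10

lemma isTwistedForm_cusp23 : IsTwistedForm 23 1 fun τ => etaAt 1 τ ^ 2 * etaAt 23 τ ^ 2 :=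
  (EtaQuotCheck.isTwistedForm (s := 23) (l := [(1, 2), (23, 2)]) (by decide +kernel)).congr
    fun τ => by simp [zpow_ofNat]

/-- The eta quotients provide level 46 only. Holomorphy and boundedness under all of SL₂(ℤ) do not
refer to the level and carry over; the law on Γ₀(23) is that of η₁²η₂₃² times an invariant function.
-/
theorem isTwistedForm_f232 : IsTwistedForm 23 1 f232 := by
  have h46 : IsTwistedForm 46 1 f232 := by
    have h1 := EtaQuotCheck.isTwistedForm (n := 46) (h := 1) (s := 1058)
      (l := [(1, 3), (23, 3), (2, -1), (46, -1)]) (by decide +kernel)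
    have h2 := EtaQuotCheck.isTwistedForm (n := 46) (h := 1) (s := 46)
      (l := [(1, 1), (2, 1), (23, 1), (46, 1)]) (by decide +kernel)
    have h3 := EtaQuotCheck.isTwistedForm (n := 46) (h := 1) (s := 92)
      (l := [(2, 2), (46, 2)]) (by decide +kernel)
    refine ((h1.add (h2.const_mul 4)).add (h3.const_mul 4)).congr fun τ => ?_
    simp only [f232, List.map_cons, List.map_nil, List.prod_cons, List.prod_nil, zpow_neg,
      zpow_ofNat, mul_one, div_eq_mul_inv, mul_inv]
    ring
  refine ⟨h46.holo, fun γ hγ τ => ?_, h46.bdd⟩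
  rw [f232_eq, f232_eq, isTwistedForm_cusp23.law γ hγ]
  have := conj23_pairs_mobius (det_eq_int γ) (mem_Gamma0_iff.1 hγ) τ.im_pos
  rw [coe_smul_eq]
  have hj : jfac γ τ = (γ 1 0 : ℂ) * τ + (γ 1 1 : ℂ) := rfl
  rw [← hj] at this
  rw [this]
  ring

lemma IsTwistedForm.ite {n h : ℕ} {c : Prop} [Decidable c] {f g : ℍ → ℂ}
    (hf : c → IsTwistedForm n h f) (hg : IsTwistedForm n h g) :
    IsTwistedForm n h fun τ => if c then f τ else g τ := by
  by_cases hc : c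
  · simpa [hc] using hf hc
  · simpa [hc] using hg

lemma IsTwistedForm.sub {n h : ℕ} {f g : ℍ → ℂ} (hf : IsTwistedForm n h f)
    (hg : IsTwistedForm n h g) : IsTwistedForm n h fun τ => f τ - g τ :=
  (hf.add (hg.const_mul (-1))).congr fun τ => by ring

lemma longest_shortest_eq {g : Equiv.Perm (Fin 24)} {S : Multiset ℕ} (hS : cycleShape g = S)
    {n h : ℕ} (hn : S.sup = n) (hh : h ∈ S) (hle : ∀ i ∈ S, h ≤ i) :
    longest g = n ∧ shortest g = h := by
  refine ⟨by rw [longest, hS, hn], ?_⟩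
  rw [shortest, hS]
  exact IsLeast.csInf_eq ⟨hh, fun i hi => hle i hi⟩

lemma isTwistedForm_of_shape {g : Equiv.Perm (Fin 24)} {f : ℍ → ℂ} {s : List (ℕ × ℕ)} {n h : ℕ}
    (hf : IsTwistedForm n h f) (hS : cycleShape g = shape s)
    (hnum : (shape s).sup = n ∧ h ∈ shape s ∧ ∀ i ∈ shape s, h ≤ i) :
    IsTwistedForm (longest g) (shortest g) f := by
  obtain ⟨h1, h2⟩ := longest_shortest_eq hS hnum.1 hnum.2.1 hnum.2.2
  rwa [h1, h2]

/-- In each case n and h are the largest and smallest cycle length of the shape, and `s` is the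
square root of `expProd` required by the eta quotient. The forms Λ_N occur only with h = 1. -/
theorem isTwistedForm_tildeT (g : Equiv.Perm (Fin 24)) :
    IsTwistedForm (longest g) (shortest g) (tildeT g) := by
  have hL : ∀ {n N : ℕ}, 0 < n ∧ N ∣ n → IsTwistedForm n 1 (Lam N) := fun h =>
    isTwistedForm_Lam h.1 h.2
  refine IsTwistedForm.congr ?_ fun τ => rfl
  refine .ite (fun hS => isTwistedForm_of_shape (n := 1) (h := 1) (.congr
    IsTwistedForm.zero fun τ => ?_) hS (by decide +kernel)) ?_
  -- The comparison with the formula in `tildeT` is put off, here and in each later case, and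
  -- settled for all cases at the end.
  rotate_left
  refine .ite (fun hS => isTwistedForm_of_shape (n := 2) (h := 1) (.congr
    ((hL (N := 2) (by decide)).const_mul 16) fun τ => ?_) hS (by decide +kernel)) ?_
  rotate_left
  refine .ite (fun hS => isTwistedForm_of_shape (n := 2) (h := 2) (.congr
    ((EtaQuotCheck.isTwistedForm (n := 2) (h := 2) (s := 4)
      (l := [(1, 8), (2, -4)]) (by decide +kernel)).const_mul 2) fun τ => ?_) hS (by decide +kernel)) ?_
  rotate_left
  refine .ite (fun hS => isTwistedForm_of_shape (n := 3) (h := 1) (.congr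
    ((hL (N := 3) (by decide)).const_mul 6) fun τ => ?_) hS (by decide +kernel)) ?_
  rotate_left
  refine .ite (fun hS => isTwistedForm_of_shape (n := 3) (h := 3) (.congr
    ((EtaQuotCheck.isTwistedForm (n := 3) (h := 3) (s := 3)
      (l := [(1, 6), (3, -2)]) (by decide +kernel)).const_mul 2) fun τ => ?_) hS (by decide +kernel)) ?_
  rotate_left
  refine .ite (fun hS => isTwistedForm_of_shape (n := 4) (h := 2) (.congr
    ((EtaQuotCheck.isTwistedForm (n := 4) (h := 2) (s := 256)
      (l := [(2, 8), (4, -4)]) (by decide +kernel)).const_mul 2) fun τ => ?_) hS (by decide +kernel)) ?_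
  rotate_left
  refine .ite (fun hS => isTwistedForm_of_shape (n := 4) (h := 1) (.congr
    (((hL (N := 4) (by decide)).sub (hL (N := 2) (by decide))).const_mul 4) fun τ => ?_) hS (by decide +kernel)) ?_
  rotate_left
  refine .ite (fun hS => isTwistedForm_of_shape (n := 4) (h := 4) (.congr
    ((EtaQuotCheck.isTwistedForm (n := 4) (h := 4) (s := 8)
      (l := [(1, 4), (2, 2), (4, -2)]) (by decide +kernel)).const_mul 2) fun τ => ?_) hS (by decide +kernel)) ?_
  rotate_left
  refine .ite (fun hS => isTwistedForm_of_shape (n := 5) (h := 1) (.congr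
    ((hL (N := 5) (by decide)).const_mul 2) fun τ => ?_) hS (by decide +kernel)) ?_
  rotate_left
  refine .ite (fun hS => isTwistedForm_of_shape (n := 6) (h := 1) (.congr
    ((((hL (N := 6) (by decide)).sub (hL (N := 2) (by decide))).sub (hL (N := 3) (by decide))).const_mul 2) fun τ => ?_) hS (by decide +kernel)) ?_
  rotate_left
  refine .ite (fun hS => isTwistedForm_of_shape (n := 6) (h := 6) (.congr
    ((EtaQuotCheck.isTwistedForm (n := 6) (h := 6) (s := 36)
      (l := [(1, 2), (2, 2), (3, 2), (6, -2)]) (by decide +kernel)).const_mul 2) fun τ => ?_) hS (by decide +kernel)) ?_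
  rotate_left
  refine .ite (fun hS => isTwistedForm_of_shape (n := 7) (h := 1) (.congr
    (hL (N := 7) (by decide)) fun τ => ?_) hS (by decide +kernel)) ?_
  rotate_left
  refine .ite (fun hS => isTwistedForm_of_shape (n := 8) (h := 1) (.congr
    ((hL (N := 8) (by decide)).sub (hL (N := 4) (by decide))) fun τ => ?_) hS (by decide +kernel)) ?_
  rotate_left
  refine .ite (fun hS => isTwistedForm_of_shape (n := 10) (h := 2) (.congr
    ((EtaQuotCheck.isTwistedForm (n := 10) (h := 2) (s := 10)
      (l := [(1, 3), (2, 1), (5, 1), (10, -1)]) (by decide +kernel)).const_mul 2) fun τ => ?_) hS (by decide +kernel)) ?_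
  rotate_left
  refine .ite (fun hS => isTwistedForm_of_shape (n := 11) (h := 1) (.congr
    (((hL (N := 11) (by decide)).sub ((EtaQuotCheck.isTwistedForm (n := 11) (h := 1) (s := 11)
      (l := [(1, 2), (11, 2)]) (by decide +kernel)).const_mul 11)).const_mul (2 / 5)) fun τ => ?_) hS (by decide +kernel)) ?_
  rotate_left
  refine .ite (fun hS => isTwistedForm_of_shape (n := 12) (h := 2) (.congr
    ((EtaQuotCheck.isTwistedForm (n := 12) (h := 2) (s := 1728)
      (l := [(1, 3), (4, 2), (6, 3), (2, -1), (3, -1), (12, -2)]) (by decide +kernel)).const_mul 2) fun τ => ?_) hS (by decide +kernel)) ?_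
  rotate_left
  refine .ite (fun hS => isTwistedForm_of_shape (n := 12) (h := 12) (.congr
    ((EtaQuotCheck.isTwistedForm (n := 12) (h := 12) (s := 24)
      (l := [(1, 4), (4, 1), (6, 1), (2, -1), (12, -1)]) (by decide +kernel)).const_mul 2) fun τ => ?_) hS (by decide +kernel)) ?_
  rotate_left
  refine .ite (fun hS => isTwistedForm_of_shape (n := 14) (h := 1) (.congr
    (((((hL (N := 14) (by decide)).sub (hL (N := 2) (by decide))).sub (hL (N := 7) (by decide))).sub
      ((EtaQuotCheck.isTwistedForm (n := 14) (h := 1) (s := 14)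
      (l := [(1, 1), (2, 1), (7, 1), (14, 1)]) (by decide +kernel)).const_mul 14)).const_mul (1 / 3)) fun τ => ?_) hS (by decide +kernel)) ?_
  rotate_left
  refine .ite (fun hS => isTwistedForm_of_shape (n := 15) (h := 1) (.congr
    (((((hL (N := 15) (by decide)).sub (hL (N := 3) (by decide))).sub (hL (N := 5) (by decide))).sub
      ((EtaQuotCheck.isTwistedForm (n := 15) (h := 1) (s := 15)
      (l := [(1, 1), (3, 1), (5, 1), (15, 1)]) (by decide +kernel)).const_mul 15)).const_mul (1 / 4)) fun τ => ?_) hS (by decide +kernel)) ?_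
  rotate_left
  -- The quotient η₁⁶/η₃² has level 3 and multiplier e(cd/9). On Γ₀(21) this agrees with e(cd/63),
  -- as 7 ≡ 1 modulo 3, so the check succeeds directly at level 21.
  refine .ite (fun hS => isTwistedForm_of_shape (n := 21) (h := 3) (.congr
    ((((EtaQuotCheck.isTwistedForm (n := 21) (h := 3) (s := 147)
      (l := [(1, 3), (7, 3), (3, -1), (21, -1)]) (by decide +kernel)).const_mul 7).sub
      (EtaQuotCheck.isTwistedForm (n := 21) (h := 3) (s := 3)
      (l := [(1, 6), (3, -2)]) (by decide +kernel))).const_mul (1 / 3)) fun τ => ?_) hS (by decide +kernel)) ?_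
  rotate_left
  refine .ite (fun hS => isTwistedForm_of_shape (n := 23) (h := 1) (.congr
    ((((hL (N := 23) (by decide)).sub (isTwistedForm_cusp23.const_mul 23)).add
      (isTwistedForm_f232.const_mul 23)).const_mul (1 / 11)) fun τ => ?_) hS (by decide +kernel)) ?_
  rotate_left
  · exact IsTwistedForm.zero
  all_goals
    simp only [List.map_cons, List.map_nil, List.prod_cons, List.prod_nil, zpow_neg, zpow_ofNat,
      mul_one, Pi.zero_apply] <;> ring

/-! ### Cycle shapes, levels and characters -/

lemma cycleShape_pos {g : Equiv.Perm (Fin 24)} {i : ℕ} (hi : i ∈ cycleShape g) : 0 < i :=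
  g.partition.parts_pos hi

lemma exists_mem_cycleShape (g : Equiv.Perm (Fin 24)) : ∃ i, i ∈ cycleShape g := by
  by_contra! h
  have h0 : cycleShape g = 0 := Multiset.eq_zero_of_forall_notMem h
  have h1 := g.partition.parts_sum
  rw [← cycleShape, h0] at h1
  simp at h1

lemma le_longest {g : Equiv.Perm (Fin 24)} {i : ℕ} (hi : i ∈ cycleShape g) : i ≤ longest g :=
  Multiset.le_sup hi

lemma shortest_le {g : Equiv.Perm (Fin 24)} {i : ℕ} (hi : i ∈ cycleShape g) : shortest g ≤ i :=
  Nat.sInf_le hi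

lemma shortest_mem (g : Equiv.Perm (Fin 24)) : shortest g ∈ cycleShape g :=
  Nat.sInf_mem (exists_mem_cycleShape g)

lemma longest_mem (g : Equiv.Perm (Fin 24)) : longest g ∈ cycleShape g := by
  obtain ⟨i, hi, hmax⟩ := Finset.exists_max_image (cycleShape g).toFinset id
    ((exists_mem_cycleShape g).imp fun i hi => Multiset.mem_toFinset.2 hi)
  have hi' := Multiset.mem_toFinset.1 hi
  have : longest g = i := le_antisymm
    (Multiset.sup_le.2 fun b hb => hmax b (Multiset.mem_toFinset.2 hb)) (le_longest hi')
  rwa [this]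

lemma longest_pos (g : Equiv.Perm (Fin 24)) : 0 < longest g := cycleShape_pos (longest_mem g)

lemma shortest_pos (g : Equiv.Perm (Fin 24)) : 0 < shortest g := cycleShape_pos (shortest_mem g)

/-- The map i ↦ N/i permutes the cycle lengths and reverses their order, so it exchanges the longest
and the shortest. -/
lemma IsBalanced.eq_mul {g : Equiv.Perm (Fin 24)} {N : ℕ} (h : IsBalanced g N) :
    N = longest g * shortest g := by
  obtain ⟨-, hdvd, hmap⟩ := h
  have hmem : ∀ i ∈ cycleShape g, N / i ∈ cycleShape g := fun i hi => by
    rw [← hmap]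
    exact Multiset.mem_map_of_mem (fun i => N / i) hi
  apply le_antisymm
  · rw [← Nat.div_mul_cancel (hdvd _ (shortest_mem g))]
    exact Nat.mul_le_mul_right _ (le_longest (hmem _ (shortest_mem g)))
  · conv_rhs => rw [← Nat.div_mul_cancel (hdvd _ (longest_mem g)), mul_comm]
    exact Nat.mul_le_mul_left _ (shortest_le (hmem _ (longest_mem g)))

lemma mul_dvd_level (g : Equiv.Perm (Fin 24)) : longest g * shortest g ∣ level g := by
  rcases Set.eq_empty_or_nonempty {N | IsBalanced g N} with h | h
  -- If the cycle shape is not balanced for any N, the infimum is 0, which every number divides.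
  · rw [level, h, Nat.sInf_empty]; exact dvd_zero _
  · have h1 : IsBalanced g (level g) := Nat.sInf_mem h
    exact dvd_of_eq h1.eq_mul.symm

/-- The trace of a permutation matrix counts fixed points. -/
lemma shortest_eq_one_of_chi_ne_zero {g : Equiv.Perm (Fin 24)} (h : chi g ≠ 0) :
    shortest g = 1 := by
  have h1 : 1 ∈ cycleShape g := by
    rw [cycleShape, Equiv.Perm.parts_partition, Multiset.mem_add]
    right
    rw [Multiset.mem_replicate]
    refine ⟨fun h0 => h ?_, rfl⟩
    have hsupp : g.support = Finset.univ := by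
      rw [← Finset.card_eq_iff_eq_univ]
      have := Finset.card_le_univ g.support
      omega
    rw [chi, Matrix.trace_permutation]
    have : Function.fixedPoints g = ∅ := by
      ext i
      have hi : i ∈ g.support := by rw [hsupp]; exact Finset.mem_univ i
      exact iff_of_false (Equiv.Perm.mem_support.1 hi) (Set.notMem_empty i)
    rw [this]
    simp
  exact le_antisymm (shortest_le h1) (shortest_pos g)

/-! ### The twisted elliptic genera -/

/-- Both Jacobi forms are invariant in their own weights, so the weight 0 action reaches only T̃_g,
and there as the weight 2 action. -/
lemma jacobiSlash_ellGenus (g : Equiv.Perm (Fin 24)) (γ : SL(2, ℤ)) (τ : ℍ) (z : ℂ) :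
    jacobiSlash 0 1 (ellGenus g) γ τ z =
      chi g / 12 * phi01 τ z + (jfac γ τ ^ 2)⁻¹ * tildeT g (γ • τ) * phi21 τ z := by
  have h1 := congrFun (congrFun (phi01_slash γ) τ) z
  have h2 := congrFun (congrFun (phi21_slash γ) τ) z
  have hj := jfac_ne_zero γ τ
  rw [jacobiSlash_eq] at h1 h2 ⊢
  rw [← h1, ← h2, ellGenus, neg_neg, neg_zero, zpow_zero, show (2 : ℤ) = ((2 : ℕ) : ℤ) by rfl, zpow_natCast]
  field_simp

lemma e_mul_rho {n h : ℕ} (γ : SL(2, ℤ)) :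
    rho n h γ * e ((γ 1 0 : ℂ) * (γ 1 1 : ℂ) / (n * h)) = 1 := by
  rw [rho, ← e_add, neg_add_cancel, e_zero]

lemma rho_eq_one {n h : ℕ} (hpos : 0 < n * h) {γ : SL(2, ℤ)} (hγ : ((n * h : ℕ) : ℤ) ∣ γ 1 0) :
    rho n h γ = 1 := by
  have h1 := e_mul_rho (n := n) (h := h) γ
  have h2 := e_div_of_dvd (γ 1 1) hpos hγ
  push_cast at h2
  rwa [h2, mul_one] at h1

/-- The multiplier of T̃_g is inverse to ρ. The term with φ_{0,1} carries no multiplier, which is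
consistent because ρ is trivial whenever χ(g) ≠ 0. -/
theorem ellGenus_eq_rho_mul (g : Equiv.Perm (Fin 24)) {γ : SL(2, ℤ)}
    (hγ : γ ∈ CongruenceSubgroup.Gamma0 (longest g)) (τ : ℍ) (z : ℂ) :
    ellGenus g τ z = rho (longest g) (shortest g) γ * jacobiSlash 0 1 (ellGenus g) γ τ z := by
  have hj := jfac_ne_zero γ τ
  rw [jacobiSlash_ellGenus, (isTwistedForm_tildeT g).law γ hγ]
  have hrho := e_mul_rho (n := longest g) (h := shortest g) γ
  have hchi : rho (longest g) (shortest g) γ * chi g = chi g := by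
    by_cases h0 : chi g = 0
    · rw [h0, mul_zero]
    · have h1 := shortest_eq_one_of_chi_ne_zero h0
      rw [rho_eq_one (by rw [h1, mul_one]; exact longest_pos g)
        (by rw [h1, mul_one]; exact mem_Gamma0_iff.1 hγ), one_mul]
  set ε := e ((γ 1 0 : ℂ) * (γ 1 1 : ℂ) / (longest g * shortest g))
  have hcancel : (jfac γ τ ^ 2)⁻¹ * (ε * jfac γ τ ^ 2 * tildeT g τ) = ε * tildeT g τ := by
    field_simp
  rw [hcancel, ellGenus]
  linear_combination (-phi01 τ z / 12) * hchi - (tildeT g τ * phi21 τ z) * hrho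

lemma differentiableOn_slash {f : ℍ → ℂ}
    (hf : DifferentiableOn ℂ (fun w => f (ofComplex w)) {w | 0 < w.im}) (γ : SL(2, ℤ)) :
    DifferentiableOn ℂ (fun w => (jfac γ (ofComplex w) ^ 2)⁻¹ * f (γ • ofComplex w))
      {w | 0 < w.im} := by
  have hj : DifferentiableOn ℂ (fun w : ℂ => (γ 1 0 : ℂ) * w + (γ 1 1 : ℂ)) {w | 0 < w.im} := by
    fun_prop
  have hn : DifferentiableOn ℂ (fun w : ℂ => (γ 0 0 : ℂ) * w + (γ 0 1 : ℂ)) {w | 0 < w.im} := by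
    fun_prop
  have hj0 : ∀ w ∈ {w : ℂ | 0 < w.im}, (γ 1 0 : ℂ) * w + (γ 1 1 : ℂ) ≠ 0 := fun w hw =>
    mobius_denom_ne_zero (det_eq_int γ) hw
  have hmob := differentiableOn_fun_div hn hj hj0
  have hcomp := hf.comp hmob fun w hw => mobius_im_pos (det_eq_int γ) hw
  refine (((hj.fun_pow 2).fun_inv fun w hw => pow_ne_zero 2 (hj0 w hw)).fun_mul hcomp).congr
    fun w hw => ?_
  have hw' : ((ofComplex w : ℍ) : ℂ) = w := by rw [ofComplex_apply_of_im_pos hw]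
  have hγ : γ • ofComplex w =
      ofComplex (((γ 0 0 : ℂ) * w + (γ 0 1 : ℂ)) / ((γ 1 0 : ℂ) * w + (γ 1 1 : ℂ))) := by
    apply UpperHalfPlane.ext
    rw [ofComplex_apply_of_im_pos (mobius_im_pos (det_eq_int γ) hw), coe_smul_eq, jfac, hw']
  rw [hγ, jfac, hw']
  rfl

lemma T_pow_apply (M : ℕ) : (ModularGroup.T ^ M) 0 0 = 1 ∧ (ModularGroup.T ^ M) 0 1 = M ∧
    (ModularGroup.T ^ M) 1 0 = 0 ∧ (ModularGroup.T ^ M) 1 1 = 1 := by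
  have := ModularGroup.coe_T_zpow (M : ℤ)
  rw [zpow_natCast] at this
  rw [this]
  simp

lemma jfac_T_pow (M : ℕ) (τ : ℍ) : jfac (ModularGroup.T ^ M) τ = 1 := by
  obtain ⟨-, -, h1, h2⟩ := T_pow_apply M
  rw [jfac, h1, h2]; simp

lemma eq_T_pow_smul {M : ℕ} {τ τ' : ℍ} (h : (τ' : ℂ) = τ + M) : τ' = ModularGroup.T ^ M • τ := by
  obtain ⟨h1, h2, -, -⟩ := T_pow_apply M
  apply UpperHalfPlane.ext
  rw [coe_smul_eq, jfac_T_pow, h1, h2, h]; simp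

/-- The conjugate γ Tᴹ γ⁻¹ has lower left entry -Mc². By hypothesis this is divisible by nh, and on
Γ₀(nh) the multiplier is trivial. -/
lemma IsTwistedForm.slash_periodic {n h : ℕ} (hn : 0 < n * h) {f : ℍ → ℂ}
    (hf : IsTwistedForm n h f) (γ : SL(2, ℤ)) {M : ℕ} (hM : ((n * h : ℕ) : ℤ) ∣ M * γ 1 0)
    {τ τ' : ℍ} (hτ : (τ' : ℂ) = τ + M) :
    (jfac γ τ' ^ 2)⁻¹ * f (γ • τ') = (jfac γ τ ^ 2)⁻¹ * f (γ • τ) := by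
  rw [eq_T_pow_smul hτ]
  set t := ModularGroup.T ^ M with ht
  obtain ⟨δ, hδ⟩ : ∃ δ, δ * γ = γ * t := ⟨γ * t * γ⁻¹, by group⟩
  have hδ' : δ = γ * t * γ⁻¹ := by rw [← hδ]; group
  have h10 : δ 1 0 = -(M * γ 1 0) * γ 1 0 := by
    obtain ⟨h1, h2, h3, h4⟩ := T_pow_apply M
    rw [hδ']
    simp only [Matrix.SpecialLinearGroup.coe_mul, Matrix.mul_apply, Fin.sum_univ_two,
      Matrix.SpecialLinearGroup.coe_inv, Matrix.adjugate_fin_two, ht, h1, h2, h3, h4]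
    simp
    ring
  have hdvd : ((n * h : ℕ) : ℤ) ∣ δ 1 0 := by
    rw [h10]; exact (dvd_neg.2 hM).mul_right _
  have hlaw := hf.law δ (mem_Gamma0_iff.2 ((Int.natCast_dvd_natCast.2 (dvd_mul_right n h)).trans hdvd))
    (γ • τ)
  have he := e_div_of_dvd (δ 1 1) hn hdvd
  push_cast at he
  rw [he, one_mul] at hlaw
  have hsm : γ • t • τ = δ • γ • τ := by rw [← mul_smul, ← mul_smul, hδ]
  have hjf : jfac γ (t • τ) = jfac δ (γ • τ) * jfac γ τ := by
    have := jfac_mul γ t τ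
    rw [jfac_T_pow, mul_one, ← hδ, jfac_mul] at this
    exact this.symm
  rw [hsm, hlaw, hjf]
  have h1 := jfac_ne_zero δ (γ • τ)
  have h2 := jfac_ne_zero γ τ
  field_simp

lemma IsTwistedForm.hasWeakFourierExpansion {n h : ℕ} (hn : 0 < n * h) {f : ℍ → ℂ}
    (hf : IsTwistedForm n h f) (γ : SL(2, ℤ)) {M : ℕ} (hM0 : 0 < M)
    (hM : ((n * h : ℕ) : ℤ) ∣ M * γ 1 0) :
    HasWeakFourierExpansion M fun τ _ => (jfac γ τ ^ 2)⁻¹ * f (γ • τ) :=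
  hasWeakFourierExpansion_of_bounded hM0 (differentiableOn_slash hf.holo γ)
    (fun _ _ hτ => hf.slash_periodic hn γ hM hτ) (hf.bdd γ)

/-- The condition on M covers both needs: M = nh is admissible at every cusp, and M = 1 for the
identity, where c = 0. -/
lemma ellGenus_slash_fourier (g : Equiv.Perm (Fin 24)) (γ : SL(2, ℤ)) {M : ℕ} (hM0 : 0 < M)
    (hM : ((longest g * shortest g : ℕ) : ℤ) ∣ M * γ 1 0) :
    HasWeakFourierExpansion M (jacobiSlash 0 1 (ellGenus g) γ) := by
  have hn := Nat.mul_pos (longest_pos g) (shortest_pos g)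
  have h1 := phi01_hasWeakFourierExpansion.mul_level hM0
  have h2 := phi21_hasWeakFourierExpansion.mul_level hM0
  rw [one_mul] at h1 h2
  have h3 := (isTwistedForm_tildeT g).hasWeakFourierExpansion hn γ hM0 hM
  have h4 := (h1.const_mul (chi g / 12)).add (h3.mul h2)
  convert! h4 using 2
  rename_i τ
  funext z
  exact jacobiSlash_ellGenus g γ τ z

theorem ellGenus_isWeakJacobiForm (g : Equiv.Perm (Fin 24)) :
    IsWeakJacobiForm (level g) 0 1 (ellGenus g) where
  holo := by
    have h : DifferentiableOn ℂ (fun p : ℂ × ℂ => tildeT g (ofComplex p.1)) {p | 0 < p.1.im} :=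
      (isTwistedForm_tildeT g).holo.comp differentiableOn_fst fun p hp => hp
    exact (differentiableOn_phi01.const_mul _).fun_add (h.fun_mul differentiableOn_phi21)
  modular γ hγ τ z := by
    have hdvd := (Int.natCast_dvd_natCast.2 (mul_dvd_level g)).trans (mem_Gamma0_iff.1 hγ)
    have h1 := ellGenus_eq_rho_mul g (mem_Gamma0_iff.2
      ((Int.natCast_dvd_natCast.2 (dvd_mul_right _ _)).trans hdvd)) τ z
    rwa [rho_eq_one (Nat.mul_pos (longest_pos g) (shortest_pos g)) hdvd, one_mul] at h1
  elliptic lam mu τ z := by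
    rw [Int.cast_one, one_mul, ellGenus, ellGenus, phi01_elliptic lam mu, phi21_elliptic lam mu]
    ring
  fourier := by
    have := ellGenus_slash_fourier g 1 one_pos (by simp)
    rwa [jacobiSlash_one] at this
  cusps γ := ⟨longest g * shortest g, Nat.mul_pos (longest_pos g) (shortest_pos g),
    ellGenus_slash_fourier g γ (Nat.mul_pos (longest_pos g) (shortest_pos g)) (dvd_mul_right _ _)⟩

end MathieuMoonshine

open MathieuMoonshine

theorem mainTheorem2 (C : Submodule (ZMod 2) (Fin 24 → ZMod 2)) (hC : IsGolayCode C)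
    (g : Equiv.Perm (Fin 24)) (hg : g ∈ mathieu24 C) :
    IsWeakJacobiForm (level g) 0 1 (ellGenus g) ∧
      ∀ γ ∈ CongruenceSubgroup.Gamma0 (longest g), ∀ (τ : ℍ) (z : ℂ),
        ellGenus g τ z =
          rho (longest g) (shortest g) γ *
            MathieuMoonshine.e (-((γ 1 0 : ℂ) * z ^ 2 / ((γ 1 0 : ℂ) * τ + (γ 1 1 : ℂ)))) *
            ellGenus g (γ • τ) (z / ((γ 1 0 : ℂ) * τ + (γ 1 1 : ℂ))) := by
  refine ⟨ellGenus_isWeakJacobiForm g, fun γ hγ τ z => ?_⟩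
  have h := ellGenus_eq_rho_mul g hγ τ z
  rw [jacobiSlash, neg_zero, zpow_zero, one_mul, Int.cast_one, one_mul] at h
  rw [mul_assoc]
  exact h
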